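/- Let $M$ be a smooth (Hausdorff, second countable, finite-dimensional) manifold; all vector bundles are smooth, real, of finite rank over $M$, and all bundle maps cover $\mathrm{id}_M$. **Lie 2-algebroids.** A (semi-strict) Lie 2-algebroid $L=([\cdot,\cdot]_E,\rho,t,\nabla,H)$ on $(E,V)$ consists of bundle maps $V\xrightarrow{t}E\xrightarrow{\rho}TM$ with $\rho\circ t=0$, an antisymmetric $\mathbb R$-bilinear bracket on $\Gamma(E)$ with $[X,fY]=\rho(X)f\,Y+f[X,Y]$, an $E$-connection $\nabla$ on $V$ ($C^\infty(M)$-linear in $X$, $\nabla_X(fv)=\rho(X)f\,v+f\nabla_Xv$) and $H\in\Gamma(\Lambda^3E^*\otimes V)$ such that $[X,[Y,Z]]+\text{cycl.}=t(H(X,Y,Z))$, $[\nabla_X,\nabla_Y]v-\nabla_{[X,Y]}v=H(X,Y,t v)$, $t(\nabla_Xv)=[X,tv]$, $\nabla_{tv}w=-\nabla_{tw}v$, and $DH=0$. Here $D$ is the exterior covariant derivative on $V$-valued $E$-forms defined by $\nabla$ and $[\cdot,\cdot]_E$ through the Cartan formula. **$V$-twisted Courant algebroids.** Such a structure on a bundle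 $W$ consists of a bundle map $\rho_W:W\to TM$, an $\mathbb R$-bilinear bracket on $\Gamma(W)$ with $[\psi,[\phi_1,\phi_2]]=[[\psi,\phi_1],\phi_2]+[\phi_1,[\psi,\phi_2]]$, a fibrewise non-degenerate symmetric product $\langle\cdot,\cdot\rangle:W\otimes W\to V$ that is surjective, and a $W$-connection ${}^W\nabla$ on $V$ (with anchor $\rho_W$) such that $\langle[\psi,\phi],\phi\rangle=\tfrac12{}^W\nabla_\psi\langle\phi,\phi\rangle=\langle\psi,[\phi,\phi]\rangle$. It is $V$-exact over $E$ if a bundle map $\pi:W\to E$ is given through which $\rho_W$ factors, together with the bundle map $\pi^*:\operatorname{Hom}(E,V)\to W$ determined by $\langle\pi^*a,\psi\rangle=a(\pi\psi)$, such that $0\to\operatorname{Hom}(E,V)\xrightarrow{\pi^*}W\xrightarrow{\pi}E\to0$ is exact. An isotropic splitting is a bundle map $j:E\to W$ with $\pi j=\mathrm{id}$ and $\langle jX,jY\rangle=0$; we then write $X\oplus a=j(X)+\pi^*(a)$. We say that $W$ has standard form for $(j,L)$ if $$\rho_W(X\oplus a)=\rho(X),\quad {}^W\nabla_{X\oplus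 a}v=\nabla_Xv-a(tv),\quad\langle X\oplus a,Y\oplus b\rangle=a(Y)+b(X),$$ $$[X\oplus a,Y\oplus b]_W=\big([X,Y]_E-t(a(Y))\big)\oplus\big([\iota_X,D]b-\iota_YDa+\iota_X\iota_YH-T(a,b)\big),$$ where $T(a,b)=a\circ t\circ b-b\circ t\circ a$, $[\iota_X,D]=\iota_XD+D\iota_X$ and $(\iota_X\iota_YH)(Z)=H(Y,X,Z)$. **Isomorphisms.** For $B\in\Gamma(\Lambda^2E^*\otimes V)$, the $B$-change of $L$ has the same $\rho,t$ and $$[X,Y]+tB(X,Y),\qquad\nabla_Xv+B(X,tv),\qquad H+DB-C,\qquad C(X,Y,Z)=B(tB(X,Y),Z)+\text{cycl.}$$ An isomorphism from $L$ on $(E,V)$ to $L'$ on $(E',V')$ is a triple $(\varphi,\nu,B)$ of bundle isomorphisms $\varphi:E\to E'$, $\nu:V\to V'$ and $B\in\Gamma(\Lambda^2E^*\otimes V)$ such that $(\varphi,\nu)$ carries the $B$-change of $L$ to $L'$. An isomorphism of exact algebroids $(W,V,E)\to(W',V',E')$ is a triple $(\varphi,\nu,\Phi)$ of bundle isomorphisms,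 $\Phi:W\to W'$, with $\pi'\Phi=\varphi\pi$ that preserves anchors, and preserves products, connections and brackets via $\Phi$ and $\nu$. **Theorem.** 1. If $\operatorname{rk}E\ge1$ and $\operatorname{rk}V\ge1$, then for every Lie 2-algebroid $L$ on $(E,V)$ there is exactly one $V$-exact Courant algebroid structure over $E$ on $W_L:=E\oplus\operatorname{Hom}(E,V)$, with $\pi$ the projection and $\pi^*$ the inclusion, that has standard form for $L$ and the canonical splitting $E\to W_L$. Assume $\operatorname{rk}V>1$. 2. Every $V$-exact Courant algebroid $W$ over $E$ has an isotropic splitting, and for every isotropic splitting $j$ there is exactly one Lie 2-algebroid $L$ on $(E,V)$ such that $W$ has standard form for $(j,L)$. 3. If $W$ has standard form for $(j,L)$, with $j$ an isotropic splitting, then $j'$ is an isotropic splitting iff $j'(X)=j(X)-\pi^*(B(X,\cdot))$ for a (then unique) $B\in\Gamma(\Lambda^2E^*\otimes V)$. Every such $B$ gives a splitting $j'$, and $W$ has standard form for $(j',L')$ iff $L'$ is the $B$-change of $L$. 4. $L\mapsto W_L$ is a 1:1 correspondence up to isomorphism: for Lie 2-algebroids $L$ on $(E,V)$ and $L'$ on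 $(E',V')$ and bundle maps $\varphi:E\to E'$, $\nu:V\to V'$, there is $B$ such that $(\varphi,\nu,B)$ is an isomorphism $L\to L'$ iff there is $\Phi$ such that $(\varphi,\nu,\Phi)$ is an isomorphism $W_L\to W_{L'}$; and every $V$-exact Courant algebroid over $E$ is isomorphic to $W_L$ for some Lie 2-algebroid $L$ on $(E,V)$, by an isomorphism with $\varphi=\mathrm{id}_E$ and $\nu=\mathrm{id}_V$. -/

import Mathlib

open Bundle Module
open scoped Manifold ContDiff

noncomputable section

namespace Lie2Courant

/-! ### Sections and bundle maps

`M` is a smooth manifold modelled on `EM`; a vector bundle `E → M` with model fibre `FE` is a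
smooth vector bundle in the sense of Mathlib.  All bundle maps cover the identity of `M`. -/

section Basic

variable (EM : Type*) [NormedAddCommGroup EM] [NormedSpace ℝ EM]
  {M : Type*} [TopologicalSpace M] [ChartedSpace EM M]

/-- The space `Γ(E)` of smooth sections of a vector bundle `E → M`. -/
abbrev Sec (FE : Type*) [NormedAddCommGroup FE] [NormedSpace ℝ FE]
    (E : M → Type*) [TopologicalSpace (TotalSpace FE E)] [∀ x, TopologicalSpace (E x)]
    [FiberBundle FE E] :=
  ContMDiffSection 𝓘(ℝ, EM) FE ∞ E

/-- The space of smooth bundle maps `E → V` over the identity, i.e. the sections of `Hom(E, V)`;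
equivalently, the `E`-one-forms with values in `V`. -/
abbrev HomSec (FE : Type*) [NormedAddCommGroup FE] [NormedSpace ℝ FE]
    (E : M → Type*) [TopologicalSpace (TotalSpace FE E)] [∀ x, TopologicalSpace (E x)]
    [∀ x, AddCommGroup (E x)] [∀ x, Module ℝ (E x)] [FiberBundle FE E] [VectorBundle ℝ FE E]
    (FV : Type*) [NormedAddCommGroup FV] [NormedSpace ℝ FV]
    (V : M → Type*) [TopologicalSpace (TotalSpace FV V)] [∀ x, TopologicalSpace (V x)]
    [∀ x, AddCommGroup (V x)] [∀ x, Module ℝ (V x)]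
    [∀ x, IsTopologicalAddGroup (V x)] [∀ x, ContinuousSMul ℝ (V x)]
    [FiberBundle FV V] [VectorBundle ℝ FV V] :=
  Sec EM (FE →L[ℝ] FV) (fun x : M => E x →L[ℝ] V x)

/-- Smooth bundle maps `E → Hom(E, V)`, i.e. smooth families of bilinear maps `E × E → V`. -/
abbrev BilinSec (FE : Type*) [NormedAddCommGroup FE] [NormedSpace ℝ FE]
    (E : M → Type*) [TopologicalSpace (TotalSpace FE E)] [∀ x, TopologicalSpace (E x)]
    [∀ x, AddCommGroup (E x)] [∀ x, Module ℝ (E x)] [FiberBundle FE E] [VectorBundle ℝ FE E]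
    (FV : Type*) [NormedAddCommGroup FV] [NormedSpace ℝ FV]
    (V : M → Type*) [TopologicalSpace (TotalSpace FV V)] [∀ x, TopologicalSpace (V x)]
    [∀ x, AddCommGroup (V x)] [∀ x, Module ℝ (V x)]
    [∀ x, IsTopologicalAddGroup (V x)] [∀ x, ContinuousSMul ℝ (V x)]
    [FiberBundle FV V] [VectorBundle ℝ FV V] :=
  HomSec EM FE E (FE →L[ℝ] FV) (fun x : M => E x →L[ℝ] V x)

variable (FE : Type*) [NormedAddCommGroup FE] [NormedSpace ℝ FE]
  (E : M → Type*) [TopologicalSpace (TotalSpace FE E)] [∀ x, TopologicalSpace (E x)]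
  [∀ x, AddCommGroup (E x)] [∀ x, Module ℝ (E x)]
  [∀ x, IsTopologicalAddGroup (E x)] [∀ x, ContinuousSMul ℝ (E x)]
  [FiberBundle FE E] [VectorBundle ℝ FE E]
  (FV : Type*) [NormedAddCommGroup FV] [NormedSpace ℝ FV]
  (V : M → Type*) [TopologicalSpace (TotalSpace FV V)] [∀ x, TopologicalSpace (V x)]
  [∀ x, AddCommGroup (V x)] [∀ x, Module ℝ (V x)]
  [∀ x, IsTopologicalAddGroup (V x)] [∀ x, ContinuousSMul ℝ (V x)]
  [FiberBundle FV V] [VectorBundle ℝ FV V]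

/-- `E`-three-forms with values in `V`, i.e. smooth sections of `Λ³E* ⊗ V`: families of alternating
trilinear maps on the fibres that are smooth when evaluated on smooth sections. -/
@[ext]
structure ThreeForm where
  /-- the alternating trilinear map on the fibre over `x` -/
  val : ∀ x : M, E x [⋀^Fin 3]→ₗ[ℝ] V x
  smooth : ∀ X Y Z : Sec EM FE E, ContMDiff 𝓘(ℝ, EM) (𝓘(ℝ, EM).prod 𝓘(ℝ, FV)) ∞
    fun x : M => TotalSpace.mk' FV x (val x ![X x, Y x, Z x])

variable {EM FE E FV V}

/-- The product `f s` of a smooth function and a smooth section. -/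
def fsmul (f : C^∞⟮𝓘(ℝ, EM), M; ℝ⟯) (s : Sec EM FE E) : Sec EM FE E :=
  ⟨fun x => f x • s x, f.contMDiff.smul_section s.contMDiff⟩

/-- The section `x ↦ a_x (X_x)`, for a bundle map `a : E → V` and a section `X` of `E`. -/
def happ (a : HomSec EM FE E FV V) (X : Sec EM FE E) : Sec EM FV V :=
  ⟨fun x => a x (X x), ContMDiff.clm_bundle_apply a.contMDiff X.contMDiff⟩

/-- The section `B(X, Y)`. -/
def happ₂ (B : BilinSec EM FE E FV V) (X Y : Sec EM FE E) : Sec EM FV V :=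
  happ (happ B X) Y

/-- The section `H(X, Y, Z)`. -/
def happ₃ (H : ThreeForm EM FE E FV V) (X Y Z : Sec EM FE E) : Sec EM FV V :=
  ⟨fun x => H.val x ![X x, Y x, Z x], H.smooth X Y Z⟩

/-- `B` is alternating, i.e. an `E`-two-form with values in `V`. -/
def IsTwoForm (B : BilinSec EM FE E FV V) : Prop :=
  ∀ (x : M) (u : E x), B x u u = 0

/-- A bundle map over the identity is an isomorphism when it is bijective on the fibres. -/
def IsBundleIso (φ : HomSec EM FE E FV V) : Prop :=
  ∀ x : M, Function.Bijective (φ x)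

variable [IsManifold 𝓘(ℝ, EM) ∞ M]

/-- The derivative `ρ(X) f` of a function `f` along the image of a section `X` under `ρ : E → TM`. -/
def anchorDeriv (ρ : HomSec EM FE E EM (fun x : M => TangentSpace 𝓘(ℝ, EM) x))
    (X : Sec EM FE E) (f : C^∞⟮𝓘(ℝ, EM), M; ℝ⟯) (x : M) : ℝ :=
  mvfderiv 𝓘(ℝ, EM) f x (ρ x (X x))

end Basic

/-! ### Lie 2-algebroids -/

section Lie2

variable (EM : Type*) [NormedAddCommGroup EM] [NormedSpace ℝ EM]
  {M : Type*} [TopologicalSpace M] [ChartedSpace EM M] [IsManifold 𝓘(ℝ, EM) ∞ M]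
  (FE : Type*) [NormedAddCommGroup FE] [NormedSpace ℝ FE]
  (E : M → Type*) [TopologicalSpace (TotalSpace FE E)] [∀ x, TopologicalSpace (E x)]
  [∀ x, AddCommGroup (E x)] [∀ x, Module ℝ (E x)]
  [∀ x, IsTopologicalAddGroup (E x)] [∀ x, ContinuousSMul ℝ (E x)]
  [FiberBundle FE E] [VectorBundle ℝ FE E]
  (FV : Type*) [NormedAddCommGroup FV] [NormedSpace ℝ FV]
  (V : M → Type*) [TopologicalSpace (TotalSpace FV V)] [∀ x, TopologicalSpace (V x)]
  [∀ x, AddCommGroup (V x)] [∀ x, Module ℝ (V x)]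
  [∀ x, IsTopologicalAddGroup (V x)] [∀ x, ContinuousSMul ℝ (V x)]
  [FiberBundle FV V] [VectorBundle ℝ FV V]

/-- The structural data of a Lie 2-algebroid `V → E → TM`: the bundle maps `ρ` and `t`, the bracket
on `Γ(E)`, the `E`-derivative `∇` on `V`, and `H`. -/
structure Lie2Data where
  /-- the anchor `ρ : E → TM` -/
  anchor : HomSec EM FE E EM (fun x : M => TangentSpace 𝓘(ℝ, EM) x)
  /-- the bundle map `t : V → E` -/
  t : HomSec EM FV V FE E
  /-- the bracket on `Γ(E)` -/
  bracket : Sec EM FE E →ₗ[ℝ] Sec EM FE E →ₗ[ℝ] Sec EM FE E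
  /-- the operator `(X, v) ↦ ∇_X v` -/
  conn : Sec EM FE E →ₗ[ℝ] Sec EM FV V →ₗ[ℝ] Sec EM FV V
  /-- the anomaly `H`, an `E`-three-form with values in `V` -/
  H : ThreeForm EM FE E FV V

namespace Lie2Data

variable {EM FE E FV V}
variable (L : Lie2Data EM FE E FV V)

/-- `(D a)(X, Y)` for an `E`-one-form `a` with values in `V`, where `D` is the exterior covariant
derivative given by the Cartan formula. -/
def extD₁ (a : HomSec EM FE E FV V) (X Y : Sec EM FE E) : Sec EM FV V :=
  L.conn X (happ a Y) - L.conn Y (happ a X) - happ a (L.bracket X Y)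

/-- `(D B)(X, Y, Z)` for an `E`-two-form `B` with values in `V`. -/
def extD₂ (B : BilinSec EM FE E FV V) (X Y Z : Sec EM FE E) : Sec EM FV V :=
  L.conn X (happ₂ B Y Z) - L.conn Y (happ₂ B X Z) + L.conn Z (happ₂ B X Y)
    - happ₂ B (L.bracket X Y) Z + happ₂ B (L.bracket X Z) Y - happ₂ B (L.bracket Y Z) X

/-- `(D η)(X, Y, Z, U)` for an `E`-three-form `η` with values in `V`. -/
def extD₃ (η : ThreeForm EM FE E FV V) (X Y Z U : Sec EM FE E) : Sec EM FV V :=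
  L.conn X (happ₃ η Y Z U) - L.conn Y (happ₃ η X Z U)
    + L.conn Z (happ₃ η X Y U) - L.conn U (happ₃ η X Y Z)
    - happ₃ η (L.bracket X Y) Z U + happ₃ η (L.bracket X Z) Y U
    - happ₃ η (L.bracket X U) Y Z - happ₃ η (L.bracket Y Z) X U
    + happ₃ η (L.bracket Y U) X Z - happ₃ η (L.bracket Z U) X Y

/-- The value at `Z` of `[ι_X, D] b`, where `[ι_X, D] = ι_X D + D ι_X` is the graded commutator and
`(D v)(Z) = ∇_Z v` for a section `v` of `V`. -/
def lieDer (X : Sec EM FE E) (b : HomSec EM FE E FV V) (Z : Sec EM FE E) : Sec EM FV V :=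
  L.extD₁ b X Z + L.conn Z (happ b X)

/-- The value at `Z` of `T(a, b) = a ∘ t ∘ b - b ∘ t ∘ a`. -/
def T (a b : HomSec EM FE E FV V) (Z : Sec EM FE E) : Sec EM FV V :=
  happ a (happ L.t (happ b Z)) - happ b (happ L.t (happ a Z))

/-- The value at `Z` of the `Hom(E, V)`-component
`[ι_X, D] b - ι_Y D a + ι_X ι_Y H - T(a, b)` of the bracket of `X ⊕ a` and `Y ⊕ b`. -/
def formPart (X : Sec EM FE E) (a : HomSec EM FE E FV V) (Y : Sec EM FE E)
    (b : HomSec EM FE E FV V) (Z : Sec EM FE E) : Sec EM FV V :=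
  L.lieDer X b Z - L.extD₁ a Y Z + happ₃ L.H Y X Z - L.T a b Z

end Lie2Data

/-- A (semi-strict) Lie 2-algebroid `V → E → TM` over `M`. -/
structure Lie2Algebroid extends Lie2Data EM FE E FV V where
  anchor_t : ∀ (x : M) (v : V x), anchor x (t x v) = 0
  bracket_skew : ∀ X Y, bracket X Y = -bracket Y X
  bracket_leibniz : ∀ X Y f (x : M),
    bracket X (fsmul f Y) x = anchorDeriv anchor X f x • Y x + f x • bracket X Y x
  conn_fsmul : ∀ f X v, conn (fsmul f X) v = fsmul f (conn X v)
  conn_leibniz : ∀ X f v (x : M),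
    conn X (fsmul f v) x = anchorDeriv anchor X f x • v x + f x • conn X v x
  jacobi : ∀ X Y Z,
    bracket X (bracket Y Z) + bracket Y (bracket Z X) + bracket Z (bracket X Y)
      = happ t (happ₃ H X Y Z)
  curvature : ∀ X Y v,
    conn X (conn Y v) - conn Y (conn X v) - conn (bracket X Y) v = happ₃ H X Y (happ t v)
  t_conn : ∀ X v, happ t (conn X v) = bracket X (happ t v)
  conn_t_skew : ∀ v w, conn (happ t v) w = -conn (happ t w) v
  closed : ∀ X Y Z U, toLie2Data.extD₃ H X Y Z U = 0

end Lie2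

/-! ### Vector bundle twisted Courant algebroids -/

section Courant

variable (EM : Type*) [NormedAddCommGroup EM] [NormedSpace ℝ EM]
  {M : Type*} [TopologicalSpace M] [ChartedSpace EM M] [IsManifold 𝓘(ℝ, EM) ∞ M]

/-- A `V`-twisted Courant algebroid structure on the vector bundle `W → M`. -/
structure VTwistedCourant
  (FV : Type*) [NormedAddCommGroup FV] [NormedSpace ℝ FV]
  (V : M → Type*) [TopologicalSpace (TotalSpace FV V)] [∀ x, TopologicalSpace (V x)]
  [∀ x, AddCommGroup (V x)] [∀ x, Module ℝ (V x)]
  [∀ x, IsTopologicalAddGroup (V x)] [∀ x, ContinuousSMul ℝ (V x)]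
  [FiberBundle FV V] [VectorBundle ℝ FV V]
  (FW : Type*) [NormedAddCommGroup FW] [NormedSpace ℝ FW]
  (W : M → Type*) [TopologicalSpace (TotalSpace FW W)] [∀ x, TopologicalSpace (W x)]
  [∀ x, AddCommGroup (W x)] [∀ x, Module ℝ (W x)]
  [∀ x, IsTopologicalAddGroup (W x)] [∀ x, ContinuousSMul ℝ (W x)]
  [FiberBundle FW W] [VectorBundle ℝ FW W] where
  /-- the anchor `ρ_W : W → TM` -/
  anchor : HomSec EM FW W EM (fun x : M => TangentSpace 𝓘(ℝ, EM) x)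
  /-- the bracket on `Γ(W)` -/
  bracket : Sec EM FW W →ₗ[ℝ] Sec EM FW W →ₗ[ℝ] Sec EM FW W
  /-- the `V`-valued product on `W` -/
  pairing : BilinSec EM FW W FV V
  /-- the `W`-connection on `V` -/
  conn : Sec EM FW W →ₗ[ℝ] Sec EM FV V →ₗ[ℝ] Sec EM FV V
  pairing_symm : ∀ (x : M) (w w' : W x), pairing x w w' = pairing x w' w
  pairing_nondeg : ∀ (x : M) (w : W x), (∀ w' : W x, pairing x w w' = 0) → w = 0
  /-- the product, as a linear map on `W ⊗ W`, is onto `V` -/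
  pairing_surj : ∀ x : M, Submodule.span ℝ {v : V x | ∃ w w' : W x, pairing x w w' = v} = ⊤
  conn_fsmul : ∀ f ψ v, conn (fsmul f ψ) v = fsmul f (conn ψ v)
  conn_leibniz : ∀ ψ f v (x : M),
    conn ψ (fsmul f v) x = anchorDeriv anchor ψ f x • v x + f x • conn ψ v x
  loday : ∀ ψ φ₁ φ₂,
    bracket ψ (bracket φ₁ φ₂) = bracket (bracket ψ φ₁) φ₂ + bracket φ₁ (bracket ψ φ₂)
  invariance : ∀ ψ φ,
    happ₂ pairing (bracket ψ φ) φ = (1 / 2 : ℝ) • conn ψ (happ₂ pairing φ φ)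
  symmetric_part : ∀ ψ φ,
    happ₂ pairing ψ (bracket φ φ) = (1 / 2 : ℝ) • conn ψ (happ₂ pairing φ φ)

variable (FE : Type*) [NormedAddCommGroup FE] [NormedSpace ℝ FE]
  (E : M → Type*) [TopologicalSpace (TotalSpace FE E)] [∀ x, TopologicalSpace (E x)]
  [∀ x, AddCommGroup (E x)] [∀ x, Module ℝ (E x)]
  [∀ x, IsTopologicalAddGroup (E x)] [∀ x, ContinuousSMul ℝ (E x)]
  [FiberBundle FE E] [VectorBundle ℝ FE E]
  (FV : Type*) [NormedAddCommGroup FV] [NormedSpace ℝ FV]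
  (V : M → Type*) [TopologicalSpace (TotalSpace FV V)] [∀ x, TopologicalSpace (V x)]
  [∀ x, AddCommGroup (V x)] [∀ x, Module ℝ (V x)]
  [∀ x, IsTopologicalAddGroup (V x)] [∀ x, ContinuousSMul ℝ (V x)]
  [FiberBundle FV V] [VectorBundle ℝ FV V]
  (FW : Type*) [NormedAddCommGroup FW] [NormedSpace ℝ FW]
  (W : M → Type*) [TopologicalSpace (TotalSpace FW W)] [∀ x, TopologicalSpace (W x)]
  [∀ x, AddCommGroup (W x)] [∀ x, Module ℝ (W x)]
  [∀ x, IsTopologicalAddGroup (W x)] [∀ x, ContinuousSMul ℝ (W x)]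
  [FiberBundle FW W] [VectorBundle ℝ FW W]

/-- A `V`-exact Courant algebroid over `E`: a `V`-twisted Courant algebroid `W` whose anchor factors
through `π : W → E` and such that `0 → Hom(E, V) → W → E → 0` is exact, where `Hom(E, V) → W` is the
map `π^*` that is adjoint to `π` with respect to the product of `W`. -/
structure VExactCourant extends VTwistedCourant EM FV V FW W where
  /-- the projection `π` -/
  pi : HomSec EM FW W FE E
  /-- the map `π^*` -/
  piStar : HomSec EM (FE →L[ℝ] FV) (fun x : M => E x →L[ℝ] V x) FW W
  anchor_factors : ∃ ρ : HomSec EM FE E EM (fun x : M => TangentSpace 𝓘(ℝ, EM) x),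
    ∀ (x : M) (w : W x), anchor x w = ρ x (pi x w)
  piStar_adjoint : ∀ (x : M) (a : E x →L[ℝ] V x) (w : W x),
    pairing x (piStar x a) w = a (pi x w)
  piStar_injective : ∀ x : M, Function.Injective (piStar x)
  exact : ∀ x : M, Function.Exact (piStar x) (pi x)
  pi_surjective : ∀ x : M, Function.Surjective (pi x)

namespace VExactCourant

variable {EM FE E FV V FW W}

/-- `j : E → W` is an isotropic splitting of the exact sequence. -/
def IsIsotropicSplitting (C : VExactCourant EM FE E FV V FW W) (j : HomSec EM FE E FW W) : Prop :=
  (∀ (x : M) (u : E x), C.pi x (j x u) = u) ∧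
    ∀ (x : M) (u w : E x), C.pairing x (j x u) (j x w) = 0

/-- The section `X ⊕ a = j(X) + π^*(a)` of `W`. -/
def oplus (C : VExactCourant EM FE E FV V FW W) (j : HomSec EM FE E FW W)
    (X : Sec EM FE E) (a : HomSec EM FE E FV V) : Sec EM FW W :=
  happ j X + happ C.piStar a

/-- Under `(X, a) ↦ X ⊕ a = j(X) + π^*(a)`, the structure of `W` is the one
that is built from the Lie 2-algebroid `L` by the explicit formulas. A section of `Hom(E, V)` is given
by its values on all sections `Z` of `E`. -/
structure HasStandardForm (C : VExactCourant EM FE E FV V FW W) (j : HomSec EM FE E FW W)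
    (L : Lie2Algebroid EM FE E FV V) : Prop where
  anchor_eq : ∀ (x : M) (u : E x) (a : E x →L[ℝ] V x),
    C.anchor x (j x u + C.piStar x a) = L.anchor x u
  conn_eq : ∀ X a v,
    C.conn (C.oplus j X a) v = L.conn X v - happ a (happ L.t v)
  pairing_eq : ∀ (x : M) (u w : E x) (a b : E x →L[ℝ] V x),
    C.pairing x (j x u + C.piStar x a) (j x w + C.piStar x b) = a w + b u
  bracket_eq : ∀ X a Y b, ∃ c : HomSec EM FE E FV V,
    (∀ Z, happ c Z = L.formPart X a Y b Z) ∧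
      C.bracket (C.oplus j X a) (C.oplus j Y b)
        = C.oplus j (L.bracket X Y - happ L.t (happ a Y)) c

/-- A `V`-exact Courant algebroid structure on `W = E ⊕ Hom(E, V)`, with the canonical maps
`Hom(E, V) → W → E` and the canonical splitting `j : E → W`, given by the explicit formulas
in terms of the Lie 2-algebroid `L`. -/
structure IsStandardModel
    (C : VExactCourant EM FE E FV V (FE × (FE →L[ℝ] FV)) (E ×ᵇ fun x : M => E x →L[ℝ] V x))
    (j : HomSec EM FE E (FE × (FE →L[ℝ] FV)) (E ×ᵇ fun x : M => E x →L[ℝ] V x))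
    (L : Lie2Algebroid EM FE E FV V) : Prop where
  pi_eq : ∀ (x : M) (u : E x) (a : E x →L[ℝ] V x), C.pi x (u, a) = u
  piStar_eq : ∀ (x : M) (a : E x →L[ℝ] V x), C.piStar x a = (0, a)
  j_eq : ∀ (x : M) (u : E x), j x u = (u, 0)
  standardForm : C.HasStandardForm j L

end VExactCourant

end Courant

/-! ### Isomorphisms and changes of splitting -/

section Iso

variable {EM : Type*} [NormedAddCommGroup EM] [NormedSpace ℝ EM]
  {M : Type*} [TopologicalSpace M] [ChartedSpace EM M] [IsManifold 𝓘(ℝ, EM) ∞ M]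
  {FE : Type*} [NormedAddCommGroup FE] [NormedSpace ℝ FE]
  {E : M → Type*} [TopologicalSpace (TotalSpace FE E)] [∀ x, TopologicalSpace (E x)]
  [∀ x, AddCommGroup (E x)] [∀ x, Module ℝ (E x)]
  [∀ x, IsTopologicalAddGroup (E x)] [∀ x, ContinuousSMul ℝ (E x)]
  [FiberBundle FE E] [VectorBundle ℝ FE E]
  {FV : Type*} [NormedAddCommGroup FV] [NormedSpace ℝ FV]
  {V : M → Type*} [TopologicalSpace (TotalSpace FV V)] [∀ x, TopologicalSpace (V x)]
  [∀ x, AddCommGroup (V x)] [∀ x, Module ℝ (V x)]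
  [∀ x, IsTopologicalAddGroup (V x)] [∀ x, ContinuousSMul ℝ (V x)]
  [FiberBundle FV V] [VectorBundle ℝ FV V]
  {FE' : Type*} [NormedAddCommGroup FE'] [NormedSpace ℝ FE']
  {E' : M → Type*} [TopologicalSpace (TotalSpace FE' E')] [∀ x, TopologicalSpace (E' x)]
  [∀ x, AddCommGroup (E' x)] [∀ x, Module ℝ (E' x)]
  [∀ x, IsTopologicalAddGroup (E' x)] [∀ x, ContinuousSMul ℝ (E' x)]
  [FiberBundle FE' E'] [VectorBundle ℝ FE' E']
  {FV' : Type*} [NormedAddCommGroup FV'] [NormedSpace ℝ FV']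
  {V' : M → Type*} [TopologicalSpace (TotalSpace FV' V')] [∀ x, TopologicalSpace (V' x)]
  [∀ x, AddCommGroup (V' x)] [∀ x, Module ℝ (V' x)]
  [∀ x, IsTopologicalAddGroup (V' x)] [∀ x, ContinuousSMul ℝ (V' x)]
  [FiberBundle FV' V'] [VectorBundle ℝ FV' V']

/-- `C(X, Y, Z) = B(t B(X, Y), Z) + B(t B(Y, Z), X) + B(t B(Z, X), Y)`. -/
def cubicTerm (L : Lie2Algebroid EM FE E FV V) (B : BilinSec EM FE E FV V)
    (X Y Z : Sec EM FE E) : Sec EM FV V :=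
  happ₂ B (happ L.t (happ₂ B X Y)) Z + happ₂ B (happ L.t (happ₂ B Y Z)) X
    + happ₂ B (happ L.t (happ₂ B Z X)) Y

/-- `L'` arises from `L` by the change of splitting given by the `E`-two-form `B`. -/
structure IsChangeOfSplitting (L : Lie2Algebroid EM FE E FV V) (B : BilinSec EM FE E FV V)
    (L' : Lie2Algebroid EM FE E FV V) : Prop where
  anchor_eq : L'.anchor = L.anchor
  t_eq : L'.t = L.t
  bracket_eq : ∀ X Y, L'.bracket X Y = L.bracket X Y + happ L.t (happ₂ B X Y)
  conn_eq : ∀ X v, L'.conn X v = L.conn X v + happ₂ B X (happ L.t v)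
  H_eq : ∀ X Y Z, happ₃ L'.H X Y Z
    = happ₃ L.H X Y Z + L.extD₂ B X Y Z - cubicTerm L B X Y Z

/-- `(φ, ν, B)` is an isomorphism of Lie 2-algebroids over the identity of `M`: up to the bundle
isomorphisms `φ : E → E'` and `ν : V → V'`, the Lie 2-algebroid `L'` is obtained from `L` by the
change of splitting `B`. -/
structure IsLie2Iso (L : Lie2Algebroid EM FE E FV V) (L' : Lie2Algebroid EM FE' E' FV' V')
    (φ : HomSec EM FE E FE' E') (ν : HomSec EM FV V FV' V') (B : BilinSec EM FE E FV V) :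
    Prop where
  φ_iso : IsBundleIso φ
  ν_iso : IsBundleIso ν
  twoForm : IsTwoForm B
  anchor_eq : ∀ (x : M) (u : E x), L'.anchor x (φ x u) = L.anchor x u
  t_eq : ∀ (x : M) (v : V x), L'.t x (ν x v) = φ x (L.t x v)
  bracket_eq : ∀ X Y, L'.bracket (happ φ X) (happ φ Y)
    = happ φ (L.bracket X Y + happ L.t (happ₂ B X Y))
  conn_eq : ∀ X v, L'.conn (happ φ X) (happ ν v) = happ ν (L.conn X v + happ₂ B X (happ L.t v))
  H_eq : ∀ X Y Z, happ₃ L'.H (happ φ X) (happ φ Y) (happ φ Z)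
    = happ ν (happ₃ L.H X Y Z + L.extD₂ B X Y Z - cubicTerm L B X Y Z)

variable {FW : Type*} [NormedAddCommGroup FW] [NormedSpace ℝ FW]
  {W : M → Type*} [TopologicalSpace (TotalSpace FW W)] [∀ x, TopologicalSpace (W x)]
  [∀ x, AddCommGroup (W x)] [∀ x, Module ℝ (W x)]
  [∀ x, IsTopologicalAddGroup (W x)] [∀ x, ContinuousSMul ℝ (W x)]
  [FiberBundle FW W] [VectorBundle ℝ FW W]
  {FW' : Type*} [NormedAddCommGroup FW'] [NormedSpace ℝ FW']
  {W' : M → Type*} [TopologicalSpace (TotalSpace FW' W')] [∀ x, TopologicalSpace (W' x)]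
  [∀ x, AddCommGroup (W' x)] [∀ x, Module ℝ (W' x)]
  [∀ x, IsTopologicalAddGroup (W' x)] [∀ x, ContinuousSMul ℝ (W' x)]
  [FiberBundle FW' W'] [VectorBundle ℝ FW' W']

/-- `(φ, ν, Φ)` is an isomorphism of exact vector bundle twisted Courant algebroids over the identity
of `M`. -/
structure IsCourantIso (C : VExactCourant EM FE E FV V FW W)
    (C' : VExactCourant EM FE' E' FV' V' FW' W')
    (φ : HomSec EM FE E FE' E') (ν : HomSec EM FV V FV' V') (Φ : HomSec EM FW W FW' W') :
    Prop where
  φ_iso : IsBundleIso φ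
  ν_iso : IsBundleIso ν
  Φ_iso : IsBundleIso Φ
  pi_eq : ∀ (x : M) (w : W x), C'.pi x (Φ x w) = φ x (C.pi x w)
  anchor_eq : ∀ (x : M) (w : W x), C'.anchor x (Φ x w) = C.anchor x w
  pairing_eq : ∀ (x : M) (w₁ w₂ : W x),
    C'.pairing x (Φ x w₁) (Φ x w₂) = ν x (C.pairing x w₁ w₂)
  conn_eq : ∀ ψ v, C'.conn (happ Φ ψ) (happ ν v) = happ ν (C.conn ψ v)
  bracket_eq : ∀ ψ₁ ψ₂, C'.bracket (happ Φ ψ₁) (happ Φ ψ₂) = happ Φ (C.bracket ψ₁ ψ₂)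

end Iso

end Lie2Courant

end

open Topology

noncomputable section

namespace Lie2Courant

set_option linter.unusedSectionVars false
set_option linter.unusedSimpArgs false

/-! ### Sections and tensorial operators -/

section Sections

variable {EM : Type*} [NormedAddCommGroup EM] [NormedSpace ℝ EM] [FiniteDimensional ℝ EM]
  {M : Type*} [TopologicalSpace M] [ChartedSpace EM M] [IsManifold 𝓘(ℝ, EM) ∞ M] [T2Space M]
  {FE : Type*} [NormedAddCommGroup FE] [NormedSpace ℝ FE]
  {E : M → Type*} [TopologicalSpace (TotalSpace FE E)] [∀ x, TopologicalSpace (E x)]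
  [∀ x, AddCommGroup (E x)] [∀ x, Module ℝ (E x)]
  [FiberBundle FE E] [VectorBundle ℝ FE E] [ContMDiffVectorBundle ∞ FE E 𝓘(ℝ, EM)]

/-! Relative to an isotropic splitting `j`, every section of `W` is `j(X) + π^*(a)`, and the
structure of `W` is read off from what it does on these two kinds of sections.

From `L` to `W_L`, the only laborious axiom is the Loday identity. Its `E`-component is the Jacobi
identity up to `t H` (`loday_base`). Its form component is trilinear and splits into eight blocks
(`loday_form`): three base sections give `D H = 0`, two give the curvature and Jacobi identities,
and the remaining blocks need only `t ∇ = [·, t]`, the skewness of `∇_{t v} w`, or the associativity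
of `a ∘ t ∘ b`.

The converse rests on three facts. The first is that the Leibniz rule, the compatibility of the
anchor with brackets and the flatness of the `W`-connection follow from the Loday identity,
invariance and non-degeneracy (`bracket_fsmul`, `anchorFun_bracket`, `conn_flat`).

The second is that `[ψ, π^* b]` has no `E`-component. With `A b = π[ψ, π^* b]`, invariance on the
isotropic subbundle `Hom(E, V)` gives `c(A b) = -b(A c)`. Testing against maps of rank one forces `A
= 0` as soon as `rk V > 1` (`eq_zero_of_forall_apply_eq_neg`, `proj_bracket_star`); the rank
hypothesis beyond `V ≠ 0` enters only through this.

The third is that the symmetric part of the bracket is dual to the connection. Taking `ψ = π^* a` in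
`⟨ψ, [φ₁, φ₂] + [φ₂, φ₁]⟩ = ∇_ψ ⟨φ₁, φ₂⟩` shows that `∇_{π^* a} v = -a(t v)` for a bundle map `t`
with `t⟨φ₁, φ₂⟩ = -π([φ₁, φ₂] + [φ₂, φ₁])` (`exists_t`, `t_prod`). As products span `V`, an identity
tensorial in `v` need only be checked for `v` a product (`eq_zero_of_prod`).

The axioms of `L` are then components of the axioms of `W`, and for an isotropic splitting the
standard form is equivalent to `L` being the induced data (`IsInduced`). Two isotropic splittings
differ by a two-form, and recomputing the induced data gives the `B`-change (`IsInduced.shift_iff`).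
An isomorphism of algebroids transports splittings, so after a change of splitting the question
about isomorphisms reduces to strict ones (`exists_isLie2Iso_iff`). -/

/-- A smooth bump function at `x₀` supported in a given neighbourhood. -/
theorem exists_bump {x₀ : M} {u : Set M} (hu : u ∈ 𝓝 x₀) :
    ∃ g : C^∞⟮𝓘(ℝ, EM), M; ℝ⟯, g =ᶠ[𝓝 x₀] 1 ∧ tsupport g ⊆ u := by
  obtain ⟨f, -, hf⟩ := (SmoothBumpFunction.nhds_basis_tsupport (I := 𝓘(ℝ, EM)) x₀).mem_iff.1 hu
  exact ⟨⟨f, f.contMDiff⟩, f.eventuallyEq_one, hf⟩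

/-- A local section, cut off by a function supported in its domain. -/
theorem exists_sec_eq_smul {u : Set M} (hu : IsOpen u) {s : ∀ x : M, E x}
    (hs : ContMDiffOn 𝓘(ℝ, EM) (𝓘(ℝ, EM).prod 𝓘(ℝ, FE)) ∞ (fun x => TotalSpace.mk' FE x (s x)) u)
    {g : C^∞⟮𝓘(ℝ, EM), M; ℝ⟯} (hg : tsupport g ⊆ u) :
    ∃ S : Sec EM FE E, ∀ x, S x = g x • s x :=
  ⟨⟨fun x => g x • s x,
    ContMDiffOn.smul_section_of_tsupport g.contMDiff.contMDiffOn hu hg hs⟩, fun _ => rfl⟩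

theorem contMDiffOn_symm (x₀ : M) (w : FE) :
    ContMDiffOn 𝓘(ℝ, EM) (𝓘(ℝ, EM).prod 𝓘(ℝ, FE)) ∞
      (fun x => TotalSpace.mk' FE x ((trivializationAt FE E x₀).symm x w))
      (trivializationAt FE E x₀).baseSet := by
  rw [Trivialization.contMDiffOn_section_baseSet_iff]
  refine (contMDiffOn_const (c := w)).congr fun y hy => ?_
  rw [Trivialization.apply_mk_symm _ hy]

/-- The constant local sections of a trivialization extend to global sections. -/
theorem exists_sec_eventuallyEq_symm (x₀ : M) (w : FE) :
    ∃ s : Sec EM FE E, ∀ᶠ x in 𝓝 x₀, s x = (trivializationAt FE E x₀).symm x w := by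
  obtain ⟨g, hg, hgs⟩ := exists_bump (EM := EM)
    ((trivializationAt FE E x₀).open_baseSet.mem_nhds (FiberBundle.mem_baseSet_trivializationAt' x₀))
  obtain ⟨s, hs⟩ := exists_sec_eq_smul (trivializationAt FE E x₀).open_baseSet
    (contMDiffOn_symm x₀ w) hgs
  refine ⟨s, hg.mono fun x hx => ?_⟩
  rw [hs, hx, Pi.one_apply, one_smul]

theorem exists_sec_apply_eq {x₀ : M} (v : E x₀) : ∃ s : Sec EM FE E, s x₀ = v := by
  obtain ⟨s, hs⟩ := exists_sec_eventuallyEq_symm (EM := EM) (E := E) x₀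
    ((trivializationAt FE E x₀) ⟨x₀, v⟩).2
  refine ⟨s, ?_⟩
  rw [hs.self_of_nhds]
  exact Trivialization.symm_proj_apply _ ⟨x₀, v⟩ (FiberBundle.mem_baseSet_trivializationAt' x₀)

@[simp] theorem fsmul_apply (f : C^∞⟮𝓘(ℝ, EM), M; ℝ⟯) (s : Sec EM FE E) (x : M) :
    fsmul f s x = f x • s x := rfl

/-- Near a point, sections are combinations of finitely many global sections. -/
theorem exists_local_expansion [FiniteDimensional ℝ FE] (x₀ : M) :
    ∃ (s : Fin (finrank ℝ FE) → Sec EM FE E)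
      (c : Sec EM FE E → Fin (finrank ℝ FE) → C^∞⟮𝓘(ℝ, EM), M; ℝ⟯) (g : C^∞⟮𝓘(ℝ, EM), M; ℝ⟯),
      g x₀ = 1 ∧ ∀ X, fsmul g X = ∑ i, fsmul (c X i) (s i) ∧ (X x₀ = 0 → ∀ i, c X i x₀ = 0) := by
  set e := trivializationAt FE E x₀ with he
  have hx₀ : x₀ ∈ e.baseSet := FiberBundle.mem_baseSet_trivializationAt' x₀
  obtain ⟨g, hg, hgs⟩ := exists_bump (EM := EM) (e.open_baseSet.mem_nhds hx₀)
  let b := finBasis ℝ FE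
  choose s hs using fun i => exists_sec_eq_smul e.open_baseSet
    (contMDiffOn_symm (EM := EM) x₀ (b i)) hgs
  have hc : ∀ (X : Sec EM FE E) i, ContMDiff 𝓘(ℝ, EM) 𝓘(ℝ, ℝ) ∞
      (fun x => g x • b.repr (e ⟨x, X x⟩).2 i) := by
    intro X i
    refine contMDiff_of_tsupport fun x hx => ?_
    have hxe : x ∈ e.baseSet := hgs (closure_mono (Function.support_smul_subset_left _ _) hx)
    refine g.contMDiff.contMDiffAt.smul ?_
    have h₁ := (e.contMDiffAt_section_iff hxe).1 (X.contMDiff x)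
    exact ((LinearMap.toContinuousLinearMap (b.coord i)).contDiff.contMDiff.contMDiffAt).comp x h₁
  -- One factor `g` makes the frame global, the other the coefficients; hence the square.
  refine ⟨s, fun X i => ⟨_, hc X i⟩, g * g, ?_, fun X => ⟨?_, fun hX i => ?_⟩⟩
  · simp [hg.self_of_nhds]
  · ext x
    have : (∑ i, fsmul (⟨_, hc X i⟩ : C^∞⟮𝓘(ℝ, EM), M; ℝ⟯) (s i) : Sec EM FE E) x
        = ∑ i, (g x • b.repr (e ⟨x, X x⟩).2 i) • s i x := by
      have := congrFun (map_sum (ContMDiffSection.coeAddHom 𝓘(ℝ, EM) FE ∞ E)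
        (fun i => fsmul (⟨_, hc X i⟩ : C^∞⟮𝓘(ℝ, EM), M; ℝ⟯) (s i)) Finset.univ) x
      rw [Finset.sum_apply] at this
      exact this
    rw [this]
    by_cases hx : x ∈ e.baseSet
    · have h1 : X x = ∑ i, b.repr (e ⟨x, X x⟩).2 i • e.symm x (b i) := by
        have : e.symm x (e ⟨x, X x⟩).2 = X x := Trivialization.symm_proj_apply _ ⟨x, X x⟩ hx
        conv_lhs => rw [← this, ← b.sum_repr (e ⟨x, X x⟩).2]
        simp_rw [← Trivialization.symmL_apply (R := ℝ) e hx, map_sum, map_smul]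
      conv_lhs => rw [fsmul_apply, h1]
      simp only [hs, Finset.smul_sum, smul_smul, ContMDiffMap.coe_mul, Pi.mul_apply, smul_eq_mul]
      refine Finset.sum_congr rfl fun i _ => ?_
      congr 1; ring
    · have : g x = 0 := image_eq_zero_of_notMem_tsupport fun h => hx (hgs h)
      simp [this, hs]
  · have : (e ⟨x₀, X x₀⟩).2 = 0 := by
      rw [hX]
      exact (congrFun (Trivialization.coe_linearMapAt_of_mem (R := ℝ) e hx₀) 0).symm.trans
        (map_zero _)
    simp [this]

variable {FV : Type*} [NormedAddCommGroup FV] [NormedSpace ℝ FV]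
  {V : M → Type*} [TopologicalSpace (TotalSpace FV V)] [∀ x, TopologicalSpace (V x)]
  [∀ x, AddCommGroup (V x)] [∀ x, Module ℝ (V x)]
  [FiberBundle FV V] [VectorBundle ℝ FV V] [ContMDiffVectorBundle ∞ FV V 𝓘(ℝ, EM)]

/-- The value at a point of a `C^∞`-linear operator only depends on the value of the section. -/
theorem apply_eq_zero_of_fsmul [FiniteDimensional ℝ FE] {T : Sec EM FE E → Sec EM FV V}
    (hadd : ∀ X Y, T (X + Y) = T X + T Y) (hT : ∀ f X, T (fsmul f X) = fsmul f (T X))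
    {X : Sec EM FE E} {x₀ : M} (hX : X x₀ = 0) : T X x₀ = 0 := by
  obtain ⟨s, c, g, hg, h⟩ := exists_local_expansion (EM := EM) (FE := FE) (E := E) x₀
  have h1 : T (fsmul g X) = ∑ i, fsmul (c X i) (T (s i)) := by
    rw [(h X).1]
    have := map_sum (AddMonoidHom.mk' T hadd) (fun i => fsmul (c X i) (s i)) Finset.univ
    simp only [AddMonoidHom.mk'_apply] at this
    rw [this]
    simp only [hT]
  -- Since `g x₀ = 1`, multiplying by `g` is invisible at `x₀`, while it turns `X` into a finite
  -- combination whose coefficients vanish there.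
  have h2 : T X x₀ = T (fsmul g X) x₀ := by rw [hT, fsmul_apply, hg, one_smul]
  rw [h2, h1]
  have := congrFun (map_sum (ContMDiffSection.coeAddHom 𝓘(ℝ, EM) FV ∞ V)
    (fun i => fsmul (c X i) (T (s i))) Finset.univ) x₀
  rw [Finset.sum_apply] at this
  refine this.trans (Finset.sum_eq_zero fun i _ => ?_)
  simp only [ContMDiffSection.coeAddHom_apply, fsmul_apply]
  rw [(h X).2 hX i, zero_smul]

theorem apply_eq_of_fsmul [FiniteDimensional ℝ FE] {T : Sec EM FE E → Sec EM FV V}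
    (hadd : ∀ X Y, T (X + Y) = T X + T Y) (hT : ∀ f X, T (fsmul f X) = fsmul f (T X))
    {X Y : Sec EM FE E} {x₀ : M} (hX : X x₀ = Y x₀) : T X x₀ = T Y x₀ := by
  have h : T (X - Y) x₀ = 0 := apply_eq_zero_of_fsmul hadd hT (by
    rw [ContMDiffSection.coe_sub, Pi.sub_apply, hX, sub_self])
  have h2 : T X = T (X - Y) + T Y := by rw [← hadd, sub_add_cancel]
  rw [h2, ContMDiffSection.coe_add, Pi.add_apply, h, zero_add]

variable [∀ x, IsTopologicalAddGroup (V x)] [∀ x, ContinuousSMul ℝ (V x)]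

/-- A family of linear maps between fibres is smooth when its values on smooth sections are. -/
theorem contMDiffAt_hom_of_forall_sec [FiniteDimensional ℝ FE] {a : ∀ x : M, E x →L[ℝ] V x} {x₀ : M}
    (ha : ∀ X : Sec EM FE E, ContMDiffAt 𝓘(ℝ, EM) (𝓘(ℝ, EM).prod 𝓘(ℝ, FV)) ∞
      (fun x => TotalSpace.mk' FV x (a x (X x))) x₀) :
    ContMDiffAt 𝓘(ℝ, EM) (𝓘(ℝ, EM).prod 𝓘(ℝ, FE →L[ℝ] FV)) ∞
      (fun x => TotalSpace.mk' (FE →L[ℝ] FV) (E := fun x => E x →L[ℝ] V x) x (a x)) x₀ := by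
  rw [contMDiffAt_hom_bundle]
  refine ⟨contMDiffAt_id, ?_⟩
  let b := finBasis ℝ FE
  choose s hs using fun i => exists_sec_eventuallyEq_symm (EM := EM) (E := E) x₀ (b i)
  -- In coordinates `a x` is the sum of the dual basis vectors tensored with the images of the
  -- frame, and these images are smooth by hypothesis.
  have key : ∀ᶠ x in 𝓝 x₀, ContinuousLinearMap.inCoordinates FE E FV V x₀ x x₀ x (a x)
      = ∑ i, ContinuousLinearMap.smulRightL ℝ FE FV (LinearMap.toContinuousLinearMap (b.coord i))
          ((trivializationAt FV V x₀) ⟨x, a x (s i x)⟩).2 := by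
    filter_upwards [(trivializationAt FE E x₀).open_baseSet.mem_nhds
      (FiberBundle.mem_baseSet_trivializationAt' x₀),
      (trivializationAt FV V x₀).open_baseSet.mem_nhds
      (FiberBundle.mem_baseSet_trivializationAt' x₀), Filter.eventually_all.2 hs] with x h1 h2 h3
    refine ContinuousLinearMap.coe_injective (b.ext fun j => ?_)
    rw [ContinuousLinearMap.inCoordinates_eq h1 h2]
    simp [h3, Finsupp.single_apply]
  refine ContMDiffAt.congr_of_eventuallyEq ?_ key
  refine ContMDiffAt.sum fun i _ => ?_
  have h1 := ((trivializationAt FV V x₀).contMDiffAt_section_iff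
    (FiberBundle.mem_baseSet_trivializationAt' x₀)).1 (ha (s i))
  exact (ContinuousLinearMap.contDiff _).contMDiff.contMDiffAt.comp x₀ h1

/-- The bundle map with given smooth values on sections. -/
def HomSec.ofSmooth [FiniteDimensional ℝ FE] (a : ∀ x : M, E x →L[ℝ] V x)
    (ha : ∀ X : Sec EM FE E, ContMDiff 𝓘(ℝ, EM) (𝓘(ℝ, EM).prod 𝓘(ℝ, FV)) ∞
      (fun x => TotalSpace.mk' FV x (a x (X x)))) : HomSec EM FE E FV V :=
  ⟨a, fun x => contMDiffAt_hom_of_forall_sec fun X => ha X x⟩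

theorem ext_of_sec {a b : HomSec EM FE E FV V} (h : ∀ X, happ a X = happ b X) : a = b := by
  ext x v
  obtain ⟨X, rfl⟩ := exists_sec_apply_eq (EM := EM) (FE := FE) v
  exact congrArg (fun s : Sec EM FV V => s x) (h X)

variable [∀ x, IsTopologicalAddGroup (E x)] [∀ x, ContinuousSMul ℝ (E x)]

/-- The value at a vector is computed on any global section through it; tensoriality makes the
choice immaterial, and smoothness is inherited from the sections `T X`. -/
theorem exists_homSec_of_fsmul [FiniteDimensional ℝ FE] (T : Sec EM FE E →ₗ[ℝ] Sec EM FV V)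
    (hT : ∀ f X, T (fsmul f X) = fsmul f (T X)) :
    ∃ a : HomSec EM FE E FV V, ∀ X, happ a X = T X := by
  have hT2 : ∀ x (v : E x) (X : Sec EM FE E), X x = v →
      T (exists_sec_apply_eq (EM := EM) v).choose x = T X x := fun x v X hX =>
    apply_eq_of_fsmul (fun X Y => map_add T X Y) hT
      ((exists_sec_apply_eq (EM := EM) v).choose_spec.trans hX.symm)
  have hfin : ∀ x, FiniteDimensional ℝ (E x) := fun x => VectorBundle.finiteDimensional ℝ FE E x
  have hT2' : ∀ x, T2Space (E x) := fun x => FiberBundle.t2Space FE E x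
  let a : ∀ x, E x →L[ℝ] V x := fun x => LinearMap.toContinuousLinearMap
    { toFun := fun v => T (exists_sec_apply_eq (EM := EM) v).choose x
      map_add' := fun v w => by
        obtain ⟨X, hX⟩ := exists_sec_apply_eq (EM := EM) v
        obtain ⟨Y, hY⟩ := exists_sec_apply_eq (EM := EM) w
        rw [hT2 x v X hX, hT2 x w Y hY, hT2 x (v + w) (X + Y) (by simp [hX, hY]), map_add]
        rfl
      map_smul' := fun c v => by
        obtain ⟨X, hX⟩ := exists_sec_apply_eq (EM := EM) v
        rw [hT2 x v X hX, hT2 x (c • v) (c • X) (by simp [hX]), map_smul]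
        rfl }
  have ha : ∀ (X : Sec EM FE E) x, a x (X x) = T X x := fun X x => hT2 x _ X rfl
  refine ⟨HomSec.ofSmooth a fun X => ?_, fun X => ContMDiffSection.ext fun x => ha X x⟩
  simp only [ha]
  exact (T X).contMDiff

/-- The bundle map given by a `C^∞`-linear operator on sections. -/
def HomSec.ofTensorial [FiniteDimensional ℝ FE] (T : Sec EM FE E →ₗ[ℝ] Sec EM FV V)
    (hT : ∀ f X, T (fsmul f X) = fsmul f (T X)) : HomSec EM FE E FV V :=
  (exists_homSec_of_fsmul T hT).choose

@[simp] theorem happ_ofTensorial [FiniteDimensional ℝ FE] (T : Sec EM FE E →ₗ[ℝ] Sec EM FV V)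
    (hT : ∀ f X, T (fsmul f X) = fsmul f (T X)) (X : Sec EM FE E) :
    happ (HomSec.ofTensorial T hT) X = T X :=
  (exists_homSec_of_fsmul T hT).choose_spec X

/-- Tensoriality is required in the last slot only, because alternation carries it to the other two.
-/
theorem exists_threeForm [FiniteDimensional ℝ FE]
    (T : Sec EM FE E →ₗ[ℝ] Sec EM FE E →ₗ[ℝ] Sec EM FE E →ₗ[ℝ] Sec EM FV V)
    (h₁ : ∀ X Y, T X X Y = 0) (h₂ : ∀ X Y, T X Y Y = 0)
    (h₃ : ∀ f X Y Z, T X Y (fsmul f Z) = fsmul f (T X Y Z)) :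
    ∃ H : ThreeForm EM FE E FV V, ∀ X Y Z, happ₃ H X Y Z = T X Y Z := by
  have s₁ : ∀ X Y Z, T X Y Z = - T Y X Z := fun X Y Z => by
    have := h₁ (X + Y) Z
    simp only [map_add, LinearMap.add_apply, h₁, zero_add, add_zero] at this
    exact eq_neg_of_add_eq_zero_right this
  have s₂ : ∀ X Y Z, T X Y Z = - T X Z Y := fun X Y Z => by
    have := h₂ X (Y + Z)
    simp only [map_add, LinearMap.add_apply, h₂, zero_add, add_zero] at this
    exact eq_neg_of_add_eq_zero_right this
  have loc3 : ∀ X Y Z Z' x, Z x = Z' x → T X Y Z x = T X Y Z' x := fun X Y Z Z' x h =>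
    apply_eq_of_fsmul (fun _ _ => map_add _ _ _) (fun f Z => h₃ f X Y Z) h
  have loc2 : ∀ X Y Y' Z x, Y x = Y' x → T X Y Z x = T X Y' Z x := fun X Y Y' Z x h => by
    rw [s₂, s₂ X Y', ContMDiffSection.coe_neg, ContMDiffSection.coe_neg, Pi.neg_apply, Pi.neg_apply,
      loc3 X Z Y Y' x h]
  have loc1 : ∀ X X' Y Z x, X x = X' x → T X Y Z x = T X' Y Z x := fun X X' Y Z x h => by
    rw [s₁, s₁ X', ContMDiffSection.coe_neg, ContMDiffSection.coe_neg, Pi.neg_apply, Pi.neg_apply,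
      loc2 Y X X' Z x h]
  let r : ∀ x, E x → Sec EM FE E := fun x v => (exists_sec_apply_eq (EM := EM) v).choose
  have hr : ∀ x (v : E x), r x v x = v := fun x v => (exists_sec_apply_eq (EM := EM) v).choose_spec
  have hT : ∀ x (u v w : E x) X Y Z, X x = u → Y x = v → Z x = w →
      T (r x u) (r x v) (r x w) x = T X Y Z x := fun x u v w X Y Z hX hY hZ => by
    rw [loc1 (r x u) X _ _ x ((hr x u).trans hX.symm),
      loc2 _ (r x v) Y _ x ((hr x v).trans hY.symm), loc3 _ _ (r x w) Z x ((hr x w).trans hZ.symm)]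
  let val : ∀ x : M, E x [⋀^Fin 3]→ₗ[ℝ] V x := fun x =>
    { toFun := fun m => T (r x (m 0)) (r x (m 1)) (r x (m 2)) x
      map_update_add' := @fun inst m i u v => by
        -- The field quantifies over all decidability instances; fixing the canonical one lets the
        -- `Function.update` terms simplify.
        obtain rfl : inst = instDecidableEqFin 3 := Subsingleton.elim _ _
        fin_cases i
        · simp only [Fin.zero_eta, Fin.isValue, Function.update_self, ne_eq, one_ne_zero,
            not_false_eq_true, Function.update_of_ne, Fin.reduceEq]
          rw [hT x (u + v) _ _ (r x u + r x v) (r x (m 1)) (r x (m 2)) (by simp [hr]) (hr _ _)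
            (hr _ _)]
          simp
        · simp only [Fin.mk_one, Fin.isValue, Function.update_self, ne_eq, zero_ne_one,
            not_false_eq_true, Function.update_of_ne, Fin.reduceEq]
          rw [hT x _ (u + v) _ (r x (m 0)) (r x u + r x v) (r x (m 2)) (hr _ _) (by simp [hr])
            (hr _ _)]
          simp
        · simp only [Fin.reduceFinMk, Fin.isValue, Function.update_self, ne_eq,
            not_false_eq_true, Function.update_of_ne, Fin.reduceEq]
          rw [hT x _ _ (u + v) (r x (m 0)) (r x (m 1)) (r x u + r x v) (hr _ _) (hr _ _)
            (by simp [hr])]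
          simp
      map_update_smul' := @fun inst m i c u => by
        obtain rfl : inst = instDecidableEqFin 3 := Subsingleton.elim _ _
        fin_cases i
        · simp only [Fin.zero_eta, Fin.isValue, Function.update_self, ne_eq, one_ne_zero,
            not_false_eq_true, Function.update_of_ne, Fin.reduceEq]
          rw [hT x (c • u) _ _ (c • r x u) (r x (m 1)) (r x (m 2)) (by simp [hr]) (hr _ _)
            (hr _ _)]
          simp
        · simp only [Fin.mk_one, Fin.isValue, Function.update_self, ne_eq, zero_ne_one,
            not_false_eq_true, Function.update_of_ne, Fin.reduceEq]
          rw [hT x _ (c • u) _ (r x (m 0)) (c • r x u) (r x (m 2)) (hr _ _) (by simp [hr])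
            (hr _ _)]
          simp
        · simp only [Fin.reduceFinMk, Fin.isValue, Function.update_self, ne_eq,
            not_false_eq_true, Function.update_of_ne, Fin.reduceEq]
          rw [hT x _ _ (c • u) (r x (m 0)) (r x (m 1)) (c • r x u) (hr _ _) (hr _ _)
            (by simp [hr])]
          simp
      map_eq_zero_of_eq' := fun m i j hij hne => by
        have e01 : ∀ u w : E x, T (r x u) (r x u) (r x w) x = 0 := fun u w => by simp [h₁]
        have e12 : ∀ u w : E x, T (r x u) (r x w) (r x w) x = 0 := fun u w => by simp [h₂]
        have e02 : ∀ u w : E x, T (r x u) (r x w) (r x u) x = 0 := fun u w => by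
          rw [s₁]; simp [h₂]
        fin_cases i <;> fin_cases j <;> first
          | exact absurd rfl hne
          | (simp only [Fin.zero_eta, Fin.mk_one, Fin.reduceFinMk, Fin.isValue] at hij
             rw [hij]
             first
              | exact e01 _ _
              | exact e12 _ _
              | exact e02 _ _) }
  have hval : ∀ X Y Z : Sec EM FE E, ∀ x, val x ![X x, Y x, Z x] = T X Y Z x :=
    fun X Y Z x => hT x _ _ _ X Y Z rfl rfl rfl
  refine ⟨⟨val, fun X Y Z => ?_⟩, fun X Y Z => ContMDiffSection.ext fun x => hval X Y Z x⟩
  simp only [hval]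
  exact (T X Y Z).contMDiff

end Sections

/-! ### Inverses of bundle maps -/

section Inverse

variable {EM : Type*} [NormedAddCommGroup EM] [NormedSpace ℝ EM] [FiniteDimensional ℝ EM]
  {M : Type*} [TopologicalSpace M] [ChartedSpace EM M] [IsManifold 𝓘(ℝ, EM) ∞ M] [T2Space M]
  {FE : Type*} [NormedAddCommGroup FE] [NormedSpace ℝ FE] [FiniteDimensional ℝ FE]
  {E : M → Type*} [TopologicalSpace (TotalSpace FE E)] [∀ x, TopologicalSpace (E x)]
  [∀ x, AddCommGroup (E x)] [∀ x, Module ℝ (E x)]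
  [∀ x, IsTopologicalAddGroup (E x)] [∀ x, ContinuousSMul ℝ (E x)]
  [FiberBundle FE E] [VectorBundle ℝ FE E] [ContMDiffVectorBundle ∞ FE E 𝓘(ℝ, EM)]
  {FV : Type*} [NormedAddCommGroup FV] [NormedSpace ℝ FV] [FiniteDimensional ℝ FV]
  {V : M → Type*} [TopologicalSpace (TotalSpace FV V)] [∀ x, TopologicalSpace (V x)]
  [∀ x, AddCommGroup (V x)] [∀ x, Module ℝ (V x)]
  [∀ x, IsTopologicalAddGroup (V x)] [∀ x, ContinuousSMul ℝ (V x)]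
  [FiberBundle FV V] [VectorBundle ℝ FV V] [ContMDiffVectorBundle ∞ FV V 𝓘(ℝ, EM)]

/-- Near a point where it is invertible, a bundle map is invertible with smooth inverse. -/
theorem eventually_isInvertible_contMDiffAt_inverse (φ : HomSec EM FE E FV V) {x₀ : M}
    (h : (φ x₀).IsInvertible) :
    ∀ᶠ x in 𝓝 x₀, (φ x).IsInvertible ∧
      ContMDiffAt 𝓘(ℝ, EM) (𝓘(ℝ, EM).prod 𝓘(ℝ, FV →L[ℝ] FE)) ∞
      (fun x => TotalSpace.mk' (FV →L[ℝ] FE) (E := fun x => V x →L[ℝ] E x) x (φ x).inverse) x := by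
  -- Smoothness at a point and openness of invertibility are proved at an arbitrary point, so that
  -- smoothness also holds at all nearby points.
  have key : ∀ x₀, (φ x₀).IsInvertible → ContMDiffAt 𝓘(ℝ, EM) (𝓘(ℝ, EM).prod 𝓘(ℝ, FV →L[ℝ] FE)) ∞
      (fun x => TotalSpace.mk' (FV →L[ℝ] FE) (E := fun x => V x →L[ℝ] E x) x (φ x).inverse) x₀ ∧
      ∀ᶠ x in 𝓝 x₀, (φ x).IsInvertible := by
    intro x₀ h
    have h1 := (contMDiffAt_hom_bundle _).1 (φ.contMDiff x₀)
    have hb : ∀ᶠ x in 𝓝 x₀, x ∈ (trivializationAt FE E x₀).baseSet ∧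
        x ∈ (trivializationAt FV V x₀).baseSet :=
      Filter.Eventually.and
        ((trivializationAt FE E x₀).open_baseSet.mem_nhds
          (FiberBundle.mem_baseSet_trivializationAt' x₀))
        ((trivializationAt FV V x₀).open_baseSet.mem_nhds
          (FiberBundle.mem_baseSet_trivializationAt' x₀))
    have hinv : (ContinuousLinearMap.inCoordinates FE E FV V x₀ x₀ x₀ x₀ (φ x₀)).IsInvertible := by
      rw [ContinuousLinearMap.inCoordinates_eq hb.self_of_nhds.1 hb.self_of_nhds.2]
      simpa using h
    constructor
    · rw [contMDiffAt_hom_bundle]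
      refine ⟨contMDiffAt_id, ?_⟩
      have h2 := (hinv.contDiffAt_map_inverse (n := ∞)).contMDiffAt.comp x₀ h1.2
      refine h2.congr_of_eventuallyEq ?_
      filter_upwards [hb] with x hx
      simp only [Function.comp_apply]
      rw [ContinuousLinearMap.inCoordinates_eq hx.1 hx.2,
        ContinuousLinearMap.inCoordinates_eq hx.2 hx.1]
      simp [ContinuousLinearMap.comp_assoc]
    · have h3 : ∀ᶠ x in 𝓝 x₀,
          (ContinuousLinearMap.inCoordinates FE E FV V x₀ x x₀ x (φ x)).IsInvertible := by
        refine h1.2.continuousAt.eventually (p := fun a => a.IsInvertible) ?_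
        obtain ⟨e, he⟩ := hinv
        have := e.nhds
        rw [he] at this
        exact Filter.mem_of_superset this (by rintro _ ⟨e', rfl⟩; exact ⟨e', rfl⟩)
      filter_upwards [h3, hb] with x h3 hx
      rw [ContinuousLinearMap.inCoordinates_eq hx.1 hx.2] at h3
      simpa using h3
  exact (key x₀ h).2.mono fun x hx => ⟨hx, (key x hx).1⟩

/-- Fibres are finite-dimensional, so a bijective fibre map is an invertible operator, and operator
inversion is smooth. -/
theorem IsBundleIso.exists_inverse {φ : HomSec EM FE E FV V} (h : IsBundleIso φ) :
    ∃ ψ : HomSec EM FV V FE E, (∀ x v, φ x (ψ x v) = v) ∧ ∀ x u, ψ x (φ x u) = u := by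
  have h1 : ∀ x, (φ x).IsInvertible := fun x => by
    have hE : FiniteDimensional ℝ (E x) := VectorBundle.finiteDimensional ℝ FE E x
    have hE' : T2Space (E x) := FiberBundle.t2Space FE E x
    have hV' : T2Space (V x) := FiberBundle.t2Space FV V x
    exact ⟨(LinearEquiv.ofBijective (φ x : E x →ₗ[ℝ] V x) (h x)).toContinuousLinearEquiv,
      by ext v; rfl⟩
  refine ⟨⟨fun x => (φ x).inverse, fun x =>
    (eventually_isInvertible_contMDiffAt_inverse φ (h1 x)).self_of_nhds.2⟩, fun x v => ?_,
    fun x u => ?_⟩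
  · exact congrArg (fun a : V x →L[ℝ] V x => a v) (h1 x).self_comp_inverse
  · exact congrArg (fun a : E x →L[ℝ] E x => a u) (h1 x).inverse_comp_self

/-- A surjective bundle map has a smooth right inverse. -/
theorem exists_rightInverse [SigmaCompactSpace M] (p : HomSec EM FE E FV V)
    (h : ∀ x, Function.Surjective (p x)) :
    ∃ s : HomSec EM FV V FE E, ∀ x v, p x (s x v) = v := by
  -- Right inverses of a linear map form an affine, hence convex, set, so local smooth choices glue
  -- by a partition of unity.
  refine exists_contMDiffSection_forall_mem_convex_of_local 𝓘(ℝ, EM) (n := ⊤)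
    (fun x : M => V x →L[ℝ] E x) (fun x => {s | ∀ v, p x (s v) = v}) ?_ ?_
  · intro x s hs t ht a b _ _ hab v
    simp only [Set.mem_ofPred_eq] at hs ht
    simp [hs, ht, ← add_smul, hab]
  · intro x₀
    have hV : FiniteDimensional ℝ (V x₀) := VectorBundle.finiteDimensional ℝ FV V x₀
    have hV' : T2Space (V x₀) := FiberBundle.t2Space FV V x₀
    obtain ⟨r, hr⟩ := (p x₀ : E x₀ →ₗ[ℝ] V x₀).exists_rightInverse_of_surjective
      (LinearMap.range_eq_top.2 (h x₀))
    obtain ⟨R, hR⟩ := exists_sec_apply_eq (EM := EM) (FE := FV →L[ℝ] FE)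
      (E := fun x : M => V x →L[ℝ] E x) (LinearMap.toContinuousLinearMap r)
    -- `R` is a right inverse at `x₀` only. The defect `P = p R` is the identity there, hence
    -- invertible nearby, and `R P⁻¹` is a right inverse on that neighbourhood.
    let P : HomSec EM FV V FV V := HomSec.ofSmooth (fun x => (p x).comp (R x))
      fun X => (happ p (happ R X)).contMDiff
    have hP : (P x₀).IsInvertible := by
      have : P x₀ = ContinuousLinearMap.id ℝ (V x₀) := by
        ext v
        change p x₀ (R x₀ v) = v
        rw [hR]
        exact LinearMap.congr_fun hr v
      rw [this]
      exact ⟨ContinuousLinearEquiv.refl ℝ _, rfl⟩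
    have hev := eventually_isInvertible_contMDiffAt_inverse P hP
    refine ⟨_, hev, fun x => (R x).comp (P x).inverse, fun x hx => ?_, fun x hx v => ?_⟩
    · refine ContMDiffAt.contMDiffWithinAt (contMDiffAt_hom_of_forall_sec fun X => ?_)
      exact (R.contMDiff x).clm_bundle_apply (hx.2.clm_bundle_apply (X.contMDiff x))
    · exact congrArg (fun a : V x →L[ℝ] V x => a v) hx.1.self_comp_inverse

end Inverse

/-! ### Derivatives of functions along the anchor -/

section Anchor

variable {EM : Type*} [NormedAddCommGroup EM] [NormedSpace ℝ EM] [FiniteDimensional ℝ EM]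
  {M : Type*} [TopologicalSpace M] [ChartedSpace EM M] [IsManifold 𝓘(ℝ, EM) ∞ M] [T2Space M]

/-- Smooth functions separate tangent vectors. -/
theorem eq_zero_of_forall_mvfderiv {x : M} {u : TangentSpace 𝓘(ℝ, EM) x}
    (h : ∀ f : C^∞⟮𝓘(ℝ, EM), M; ℝ⟯, mvfderiv 𝓘(ℝ, EM) f x u = 0) : u = 0 := by
  obtain ⟨g, hg, hgs⟩ := exists_bump (EM := EM) (chart_source_mem_nhds EM x)
  -- The test functions are linear functionals of the chart, cut off to be global; the cut-off is
  -- one near `x` and does not affect the derivative there.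
  have hF : ∀ ℓ : EM →L[ℝ] ℝ, ContMDiff 𝓘(ℝ, EM) 𝓘(ℝ, ℝ) ∞
      (fun y => g y • ℓ (extChartAt 𝓘(ℝ, EM) x y)) := by
    intro ℓ
    refine contMDiff_of_tsupport fun y hy => ?_
    have hys : y ∈ (chartAt EM x).source := hgs (closure_mono (Function.support_smul_subset_left _ _) hy)
    exact g.contMDiff.contMDiffAt.smul
      (ℓ.contDiff.contMDiff.contMDiffAt.comp y (contMDiffAt_extChartAt' hys))
  have hc : MDifferentiableAt 𝓘(ℝ, EM) 𝓘(ℝ, EM) (extChartAt 𝓘(ℝ, EM) x) x :=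
    mdifferentiableAt_extChartAt (mem_chart_source EM x)
  let D : EM →L[ℝ] EM := mfderiv 𝓘(ℝ, EM) 𝓘(ℝ, EM) (extChartAt 𝓘(ℝ, EM) x) x
  have h1 : ∀ ℓ : EM →L[ℝ] ℝ, ℓ (D u) = 0 := by
    intro ℓ
    have h3 : mfderiv 𝓘(ℝ, EM) 𝓘(ℝ, ℝ) (fun y => g y • ℓ (extChartAt 𝓘(ℝ, EM) x y)) x
        = mfderiv 𝓘(ℝ, EM) 𝓘(ℝ, ℝ) (ℓ ∘ extChartAt 𝓘(ℝ, EM) x) x :=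
      Filter.EventuallyEq.mfderiv_eq (hg.mono fun y hy => by simp [hy])
    have h4 : mfderiv 𝓘(ℝ, EM) 𝓘(ℝ, ℝ) (fun y => g y • ℓ (extChartAt 𝓘(ℝ, EM) x y)) x u = 0 :=
      h ⟨_, hF ℓ⟩
    rw [h3, mfderiv_comp x ℓ.mdifferentiableAt hc, ContinuousLinearMap.mfderiv_eq] at h4
    exact h4
  have h2 : D u = 0 := by
    by_contra hne
    obtain ⟨ℓ, hℓ⟩ := SeparatingDual.exists_ne_zero (R := ℝ) (V := EM) hne
    exact hℓ (h1 ℓ)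
  obtain ⟨e, he⟩ := isInvertible_mfderiv_extChartAt (I := 𝓘(ℝ, EM))
    (mem_extChartAt_source (I := 𝓘(ℝ, EM)) x)
  have : e u = 0 := (congrArg (fun a => a u) he).trans h2
  exact e.injective (this.trans (map_zero e).symm)

variable {FE : Type*} [NormedAddCommGroup FE] [NormedSpace ℝ FE]
  {E : M → Type*} [TopologicalSpace (TotalSpace FE E)] [∀ x, TopologicalSpace (E x)]
  [∀ x, AddCommGroup (E x)] [∀ x, Module ℝ (E x)]
  [FiberBundle FE E] [VectorBundle ℝ FE E]
  [∀ x, IsTopologicalAddGroup (E x)] [∀ x, ContinuousSMul ℝ (E x)]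

theorem contMDiff_anchorDeriv (ρ : HomSec EM FE E EM (fun x : M => TangentSpace 𝓘(ℝ, EM) x))
    (X : Sec EM FE E) (f : C^∞⟮𝓘(ℝ, EM), M; ℝ⟯) :
    ContMDiff 𝓘(ℝ, EM) 𝓘(ℝ, ℝ) ∞ (anchorDeriv ρ X f) := by
  have h1 : ContMDiff 𝓘(ℝ, EM).tangent 𝓘(ℝ, ℝ).tangent ∞ (tangentMap 𝓘(ℝ, EM) 𝓘(ℝ, ℝ) f) :=
    f.contMDiff.contMDiff_tangentMap (by simp)
  have h2 := h1.comp (happ ρ X).contMDiff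
  exact (contMDiff_snd_tangentBundle_modelSpace ℝ 𝓘(ℝ, ℝ) (n := ∞)).comp h2

/-- The derivative `ρ(X) f` as a smooth function. -/
def anchorFun (ρ : HomSec EM FE E EM (fun x : M => TangentSpace 𝓘(ℝ, EM) x))
    (X : Sec EM FE E) (f : C^∞⟮𝓘(ℝ, EM), M; ℝ⟯) : C^∞⟮𝓘(ℝ, EM), M; ℝ⟯ :=
  ⟨anchorDeriv ρ X f, contMDiff_anchorDeriv ρ X f⟩

end Anchor

/-! ### The algebra of the standard bracket -/

/-- The algebraic identities between the operations on the sections of a Lie 2-algebroid. -/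
structure SectionAlgebra (A P : Type*) [AddCommGroup A] [Module ℝ A] [AddCommGroup P]
    [Module ℝ P] where
  /-- the bracket -/
  br : A →ₗ[ℝ] A →ₗ[ℝ] A
  /-- the derivative -/
  conn : A →ₗ[ℝ] P →ₗ[ℝ] P
  /-- the structure map -/
  t : P →ₗ[ℝ] A
  /-- the anomaly -/
  H : A →ₗ[ℝ] A →ₗ[ℝ] A →ₗ[ℝ] P
  skew : ∀ X Y, br X Y = -br Y X
  H_swap₁ : ∀ X Y Z, H X Y Z = -H Y X Z
  H_swap₂ : ∀ X Y Z, H X Y Z = -H X Z Y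
  jacobi : ∀ X Y Z, br X (br Y Z) + br Y (br Z X) + br Z (br X Y) = t (H X Y Z)
  curvature : ∀ X Y v, conn X (conn Y v) - conn Y (conn X v) - conn (br X Y) v = H X Y (t v)
  t_conn : ∀ X v, t (conn X v) = br X (t v)
  conn_t_skew : ∀ v w, conn (t v) w = -conn (t w) v
  closed : ∀ X Y Z U, conn X (H Y Z U) - conn Y (H X Z U) + conn Z (H X Y U) - conn U (H X Y Z)
    - H (br X Y) Z U + H (br X Z) Y U - H (br X U) Y Z - H (br Y Z) X U + H (br Y U) X Z
    - H (br Z U) X Y = 0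

namespace SectionAlgebra

variable {A P : Type*} [AddCommGroup A] [Module ℝ A] [AddCommGroup P] [Module ℝ P]
  (S : SectionAlgebra A P)

/-- The form part of the standard bracket. -/
def form (X : A) (a : A →ₗ[ℝ] P) (Y : A) (b : A →ₗ[ℝ] P) : A →ₗ[ℝ] P :=
  S.conn X ∘ₗ b - b ∘ₗ S.br X - S.conn Y ∘ₗ a + S.conn.flip (a Y) + a ∘ₗ S.br Y + S.H Y X
    - a ∘ₗ S.t ∘ₗ b + b ∘ₗ S.t ∘ₗ a

theorem form_apply (X : A) (a : A →ₗ[ℝ] P) (Y : A) (b : A →ₗ[ℝ] P) (Z : A) :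
    S.form X a Y b Z = S.conn X (b Z) - b (S.br X Z) - S.conn Y (a Z) + S.conn Z (a Y)
      + a (S.br Y Z) + S.H Y X Z - a (S.t (b Z)) + b (S.t (a Z)) := by
  simp [form]

theorem H_cyc (X Y Z : A) : S.H X Y Z = S.H Z X Y := by
  rw [S.H_swap₁ Z X Y, S.H_swap₂ X Z Y, neg_neg]

/-- Together with `curvature_left`, a rewriting rule that removes a bracket standing in the left
slot, so that both sides of the Loday blocks reach a common normal form. -/
theorem jacobi_left (X Y Z : A) :
    S.br (S.br X Y) Z = S.br X (S.br Y Z) - S.br Y (S.br X Z) - S.t (S.H X Y Z) := by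
  have h := S.jacobi X Y Z
  rw [S.skew Z X, map_neg, S.skew Z (S.br X Y)] at h
  linear_combination (norm := module) -h

theorem curvature_left (X Y : A) (v : P) :
    S.conn (S.br X Y) v = S.conn X (S.conn Y v) - S.conn Y (S.conn X v) - S.H X Y (S.t v) := by
  linear_combination (norm := module) -S.curvature X Y v

/-- The form part of the inner bracket contributes `t (H Y X Z)`, which is exactly the Jacobi
defect; the remaining terms cancel by `t ∇ = [·, t]`. -/
theorem loday_base (X : A) (a : A →ₗ[ℝ] P) (Y : A) (b : A →ₗ[ℝ] P) (Z : A) :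
    S.br X (S.br Y Z - S.t (b Z)) - S.t (a (S.br Y Z - S.t (b Z)))
      = (S.br (S.br X Y - S.t (a Y)) Z - S.t (S.form X a Y b Z))
        + (S.br Y (S.br X Z - S.t (a Z)) - S.t (b (S.br X Z - S.t (a Z)))) := by
  simp only [form_apply, map_sub, map_add, LinearMap.sub_apply, S.t_conn]
  have h1 := S.jacobi X Y Z
  rw [S.skew Z X, map_neg, S.skew Z (S.br X Y)] at h1
  rw [S.skew (S.t (a Y)) Z, S.H_swap₁ Y X Z, map_neg]
  linear_combination (norm := module) h1

/-- With no forms involved, all form parts are contractions of `H`, and reordering arguments turns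
the identity into `D H = 0`. -/
theorem loday_XYZ (X Y Z : A) :
    S.form X 0 (S.br Y Z) (S.form Y 0 Z 0)
      = S.form (S.br X Y) (S.form X 0 Y 0) Z 0 + S.form Y 0 (S.br X Z) (S.form X 0 Z 0) := by
  ext U
  simp only [form_apply, map_sub, map_add, LinearMap.sub_apply, LinearMap.add_apply,
    S.t_conn, LinearMap.zero_apply,
    map_zero, sub_zero, add_zero, zero_add]
  have h := S.closed X Y Z U
  rw [S.H_swap₁ Z Y U, S.H_swap₁ Y X U, S.H_swap₁ Y X Z, S.H_swap₁ Z X U, S.H_cyc Z Y (S.br X U),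
    S.H_cyc Y X (S.br Z U), S.H_cyc Z X (S.br Y U), S.H_swap₁ Z (S.br X Y) U,
    S.H_swap₂ (S.br X U) Z Y, S.H_swap₂ (S.br Z U) Y X, S.H_swap₂ (S.br Y U) Z X]
  simp only [map_neg]
  linear_combination (norm := module) -h

/-- The commutator of the two derivatives of `c` produces the curvature outside `c` and the Jacobi
defect inside it. Both are expressed by `H` and `t`, and they are matched by the `T`-term of `H Y X`
with `c`. The other two blocks with a single form work the same way. -/
theorem loday_XYc (X Y : A) (c : A →ₗ[ℝ] P) :
    S.form X 0 0 (S.form Y 0 0 c)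
      = S.form (S.br X Y) (S.form X 0 Y 0) 0 c + S.form Y 0 0 (S.form X 0 0 c) := by
  ext U
  simp only [form_apply, map_sub, map_add, LinearMap.sub_apply, LinearMap.add_apply,
    S.t_conn, LinearMap.zero_apply,
    map_zero, sub_zero, add_zero, zero_add]
  simp only [S.curvature_left, S.jacobi_left, S.H_swap₁ Y X, map_sub, map_neg]
  abel

theorem loday_XbZ (X Z : A) (b : A →ₗ[ℝ] P) :
    S.form X 0 (- S.t (b Z)) (S.form 0 b Z 0)
      = S.form 0 (S.form X 0 0 b) Z 0 + S.form 0 b (S.br X Z) (S.form X 0 Z 0) := by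
  ext U
  simp only [form_apply, map_sub, map_add, LinearMap.sub_apply, LinearMap.add_apply,
    S.t_conn, LinearMap.zero_apply,
    map_zero, sub_zero, add_zero, zero_add, map_neg, LinearMap.neg_apply]
  simp only [S.curvature_left, S.jacobi_left, S.H_swap₁ Z X, map_sub, map_neg,
    ← S.H_cyc X U (S.t (b Z))]
  abel

theorem loday_aYZ (Y Z : A) (a : A →ₗ[ℝ] P) :
    S.form 0 a (S.br Y Z) (S.form Y 0 Z 0)
      = S.form (-S.t (a Y)) (S.form 0 a Y 0) Z 0 + S.form Y 0 (- S.t (a Z)) (S.form 0 a Z 0) := by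
  ext U
  simp only [form_apply, map_sub, map_add, LinearMap.sub_apply, LinearMap.add_apply,
    S.t_conn, LinearMap.zero_apply,
    map_zero, sub_zero, add_zero, zero_add, map_neg, LinearMap.neg_apply]
  simp only [S.curvature_left, S.jacobi_left, S.H_swap₁ Z Y, map_sub, map_neg,
    ← S.H_cyc Y U (S.t (a Z)), S.H_swap₂ Z (S.t (a Y)) U]
  abel

theorem loday_Xbc (X : A) (b c : A →ₗ[ℝ] P) :
    S.form X 0 0 (S.form 0 b 0 c)
      = S.form 0 (S.form X 0 0 b) 0 c + S.form 0 b 0 (S.form X 0 0 c) := by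
  ext U
  simp only [form_apply, map_sub, map_add, LinearMap.sub_apply, LinearMap.add_apply,
    S.t_conn, LinearMap.zero_apply,
    map_zero, sub_zero, add_zero, zero_add, map_neg, LinearMap.neg_apply]
  abel

/-- Derivatives along `t (a Y)` on one side meet derivatives along `t (c U)` on the other; the axiom
`∇_{t v} w = -∇_{t w} v` exchanges them. It does the same in the block `loday_abZ`. -/
theorem loday_aYc (Y : A) (a c : A →ₗ[ℝ] P) :
    S.form 0 a 0 (S.form Y 0 0 c)
      = S.form (- S.t (a Y)) (S.form 0 a Y 0) 0 c + S.form Y 0 0 (S.form 0 a 0 c) := by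
  ext U
  simp only [form_apply, map_sub, map_add, LinearMap.sub_apply, LinearMap.add_apply,
    S.t_conn, LinearMap.zero_apply,
    map_zero, sub_zero, add_zero, zero_add, map_neg, LinearMap.neg_apply]
  rw [S.conn_t_skew (a Y) (c U), S.skew (S.t (a Y)) U]
  simp only [map_neg]
  abel

theorem loday_abZ (Z : A) (a b : A →ₗ[ℝ] P) :
    S.form 0 a (- S.t (b Z)) (S.form 0 b Z 0)
      = S.form 0 (S.form 0 a 0 b) Z 0 + S.form 0 b (- S.t (a Z)) (S.form 0 a Z 0) := by
  ext U
  simp only [form_apply, map_sub, map_add, LinearMap.sub_apply, LinearMap.add_apply,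
    S.t_conn, LinearMap.zero_apply,
    map_zero, sub_zero, add_zero, zero_add, map_neg, LinearMap.neg_apply]
  rw [S.conn_t_skew (b Z) (a U), S.conn_t_skew (a Z) (b U), S.skew (S.t (b Z)) U,
    S.skew (S.t (a Z)) U]
  simp only [map_neg]
  abel

/-- On forms alone the bracket is, up to sign, the commutator of the associative product `a ∘ t ∘
b`, so this is its Jacobi identity. -/
theorem loday_abc (a b c : A →ₗ[ℝ] P) :
    S.form 0 a 0 (S.form 0 b 0 c)
      = S.form 0 (S.form 0 a 0 b) 0 c + S.form 0 b 0 (S.form 0 a 0 c) := by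
  ext U
  simp only [form_apply, map_sub, map_add, LinearMap.sub_apply, LinearMap.add_apply,
    S.t_conn, LinearMap.zero_apply,
    map_zero, sub_zero, add_zero, zero_add, map_neg, LinearMap.neg_apply]
  abel

theorem form_add_left (X X' : A) (a a' : A →ₗ[ℝ] P) (Y : A) (b : A →ₗ[ℝ] P) :
    S.form (X + X') (a + a') Y b = S.form X a Y b + S.form X' a' Y b := by
  ext U
  simp only [form_apply, map_add, LinearMap.add_apply, LinearMap.add_apply]
  abel

theorem form_add_right (X : A) (a : A →ₗ[ℝ] P) (Y Y' : A) (b b' : A →ₗ[ℝ] P) :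
    S.form X a (Y + Y') (b + b') = S.form X a Y b + S.form X a Y' b' := by
  ext U
  simp only [form_apply, map_add, LinearMap.add_apply, LinearMap.add_apply]
  abel

theorem form_smul_left (r : ℝ) (X : A) (a : A →ₗ[ℝ] P) (Y : A) (b : A →ₗ[ℝ] P) :
    S.form (r • X) (r • a) Y b = r • S.form X a Y b := by
  ext U
  simp only [form_apply, map_smul, LinearMap.smul_apply, LinearMap.smul_apply]
  module

theorem form_smul_right (r : ℝ) (X : A) (a : A →ₗ[ℝ] P) (Y : A) (b : A →ₗ[ℝ] P) :
    S.form X a (r • Y) (r • b) = r • S.form X a Y b := by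
  ext U
  simp only [form_apply, map_smul, LinearMap.smul_apply, LinearMap.smul_apply]
  module

/-- Additivity in each of the three pairs reduces the identity to the eight blocks above. -/
theorem loday_form (X : A) (a : A →ₗ[ℝ] P) (Y : A) (b : A →ₗ[ℝ] P) (Z : A) (c : A →ₗ[ℝ] P) :
    S.form X a (S.br Y Z - S.t (b Z)) (S.form Y b Z c)
      = S.form (S.br X Y - S.t (a Y)) (S.form X a Y b) Z c
        + S.form Y b (S.br X Z - S.t (a Z)) (S.form X a Z c) := by
  have sl : ∀ (X : A) (a : A →ₗ[ℝ] P) (Y : A) (b : A →ₗ[ℝ] P),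
      S.form X a Y b = S.form X 0 Y b + S.form 0 a Y b := fun X a Y b => by
    rw [← form_add_left, add_zero, zero_add]
  have sr : ∀ (X : A) (a : A →ₗ[ℝ] P) (Y : A) (b : A →ₗ[ℝ] P),
      S.form X a Y b = S.form X a Y 0 + S.form X a 0 b := fun X a Y b => by
    rw [← form_add_right, add_zero, zero_add]
  have s4 : ∀ (X : A) (a : A →ₗ[ℝ] P) (Y : A) (b : A →ₗ[ℝ] P), S.form X a Y b
      = S.form X 0 Y 0 + S.form 0 a Y 0 + (S.form X 0 0 b + S.form 0 a 0 b) :=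
    fun X a Y b => by rw [sr X a, sl X a Y, sl X a 0]
  -- The padding by zeros gives the base component the same four-term shape as the form component in
  -- `s4`, so that the two split in parallel.
  have e1 : S.br Y Z - S.t (b Z) = S.br Y Z + -S.t (b Z) + (0 + 0) := by abel
  have e2 : S.br X Y - S.t (a Y) = S.br X Y + -S.t (a Y) + (0 + 0) := by abel
  have e3 : S.br X Z - S.t (a Z) = S.br X Z + -S.t (a Z) + (0 + 0) := by abel
  rw [e1, e2, e3, s4 Y b Z c, s4 X a Y b, s4 X a Z c]
  simp only [form_add_right, form_add_left]
  rw [sl X a, sl X a, sl X a, sl X a, sl Y b, sl Y b, sl Y b, sl Y b,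
    sr _ _ Z c, sr _ _ Z c, sr _ _ Z c, sr _ _ Z c]
  rw [loday_XYZ, loday_XYc, loday_XbZ, loday_aYZ, loday_Xbc, loday_aYc, loday_abZ, loday_abc]
  abel

end SectionAlgebra

/-! ### Linearity of the operations on sections -/

section Linear

variable {EM : Type*} [NormedAddCommGroup EM] [NormedSpace ℝ EM]
  {M : Type*} [TopologicalSpace M] [ChartedSpace EM M]
  {FE : Type*} [NormedAddCommGroup FE] [NormedSpace ℝ FE]
  {E : M → Type*} [TopologicalSpace (TotalSpace FE E)] [∀ x, TopologicalSpace (E x)]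
  [∀ x, AddCommGroup (E x)] [∀ x, Module ℝ (E x)]
  [FiberBundle FE E] [VectorBundle ℝ FE E]
  {FV : Type*} [NormedAddCommGroup FV] [NormedSpace ℝ FV]
  {V : M → Type*} [TopologicalSpace (TotalSpace FV V)] [∀ x, TopologicalSpace (V x)]
  [∀ x, AddCommGroup (V x)] [∀ x, Module ℝ (V x)]
  [∀ x, IsTopologicalAddGroup (V x)] [∀ x, ContinuousSMul ℝ (V x)]
  [FiberBundle FV V] [VectorBundle ℝ FV V]

@[simp] theorem sec_add_apply (X Y : Sec EM FE E) (x : M) : (X + Y) x = X x + Y x := rfl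
@[simp] theorem sec_sub_apply (X Y : Sec EM FE E) (x : M) : (X - Y) x = X x - Y x := rfl
@[simp] theorem sec_neg_apply (X : Sec EM FE E) (x : M) : (-X) x = -X x := rfl
@[simp] theorem sec_zero_apply (x : M) : (0 : Sec EM FE E) x = 0 := rfl
@[simp] theorem sec_smul_apply (r : ℝ) (X : Sec EM FE E) (x : M) : (r • X) x = r • X x := rfl

theorem happ_eval (a : HomSec EM FE E FV V) (X : Sec EM FE E) (x : M) :
    happ a X x = a x (X x) := rfl

/-- The operator on sections defined by a bundle map. -/
def happₗ (a : HomSec EM FE E FV V) : Sec EM FE E →ₗ[ℝ] Sec EM FV V where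
  toFun := happ a
  map_add' X Y := by ext x; exact map_add (a x) _ _
  map_smul' r X := by ext x; exact map_smul (a x) _ _

@[simp] theorem happₗ_apply (a : HomSec EM FE E FV V) (X : Sec EM FE E) :
    happₗ a X = happ a X := rfl

theorem happ_add (a : HomSec EM FE E FV V) (X Y : Sec EM FE E) :
    happ a (X + Y) = happ a X + happ a Y := map_add (happₗ a) X Y

theorem happ_sub (a : HomSec EM FE E FV V) (X Y : Sec EM FE E) :
    happ a (X - Y) = happ a X - happ a Y := map_sub (happₗ a) X Y

theorem happ_neg (a : HomSec EM FE E FV V) (X : Sec EM FE E) :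
    happ a (-X) = -happ a X := map_neg (happₗ a) X

theorem happ_zero (a : HomSec EM FE E FV V) : happ a (0 : Sec EM FE E) = 0 := map_zero (happₗ a)

theorem happ_smul (a : HomSec EM FE E FV V) (r : ℝ) (X : Sec EM FE E) :
    happ a (r • X) = r • happ a X := map_smul (happₗ a) r X

theorem happ_fsmul (a : HomSec EM FE E FV V) (f : C^∞⟮𝓘(ℝ, EM), M; ℝ⟯) (X : Sec EM FE E) :
    happ a (fsmul f X) = fsmul f (happ a X) := by
  ext x; exact map_smul (a x) _ _

theorem add_happ (a b : HomSec EM FE E FV V) (X : Sec EM FE E) :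
    happ (a + b) X = happ a X + happ b X := rfl

theorem neg_happ (a : HomSec EM FE E FV V) (X : Sec EM FE E) :
    happ (-a) X = -happ a X := rfl

theorem zero_happ (X : Sec EM FE E) : happ (0 : HomSec EM FE E FV V) X = 0 := rfl

theorem smul_happ (r : ℝ) (a : HomSec EM FE E FV V) (X : Sec EM FE E) :
    happ (r • a) X = r • happ a X := rfl

theorem fsmul_happ (f : C^∞⟮𝓘(ℝ, EM), M; ℝ⟯) (a : HomSec EM FE E FV V) (X : Sec EM FE E) :
    happ (fsmul f a) X = fsmul f (happ a X) := rfl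

theorem happₗ_add (a b : HomSec EM FE E FV V) : happₗ (a + b) = happₗ a + happₗ b := rfl

theorem happₗ_smul (r : ℝ) (a : HomSec EM FE E FV V) : happₗ (r • a) = r • happₗ a := rfl

theorem fsmul_add (f : C^∞⟮𝓘(ℝ, EM), M; ℝ⟯) (X Y : Sec EM FE E) :
    fsmul f (X + Y) = fsmul f X + fsmul f Y := by
  ext x; exact _root_.smul_add _ _ _

theorem fsmul_sub (f : C^∞⟮𝓘(ℝ, EM), M; ℝ⟯) (X Y : Sec EM FE E) :
    fsmul f (X - Y) = fsmul f X - fsmul f Y := by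
  ext x; exact _root_.smul_sub _ _ _

theorem fsmul_neg (f : C^∞⟮𝓘(ℝ, EM), M; ℝ⟯) (X : Sec EM FE E) :
    fsmul f (-X) = -fsmul f X := by
  ext x; exact _root_.smul_neg _ _

theorem fsmul_smul (f : C^∞⟮𝓘(ℝ, EM), M; ℝ⟯) (r : ℝ) (X : Sec EM FE E) :
    fsmul f (r • X) = r • fsmul f X := by
  ext x; exact smul_comm _ _ _

/-- The bilinear operator on sections defined by a family of bilinear maps. -/
def happ₂ₗ (B : BilinSec EM FE E FV V) : Sec EM FE E →ₗ[ℝ] Sec EM FE E →ₗ[ℝ] Sec EM FV V where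
  toFun X := happₗ (happ B X)
  map_add' X Y := by rw [happ_add]; rfl
  map_smul' r X := by rw [happ_smul]; rfl

@[simp] theorem happ₂ₗ_apply (B : BilinSec EM FE E FV V) (X Y : Sec EM FE E) :
    happ₂ₗ B X Y = happ₂ B X Y := rfl

theorem IsTwoForm.swap {B : BilinSec EM FE E FV V} (hB : IsTwoForm B) (x : M) (u v : E x) :
    B x u v = -B x v u := by
  have := hB x (u + v)
  simp only [map_add, add_apply, hB x u, hB x v, zero_add, add_zero] at this
  exact eq_neg_of_add_eq_zero_right this

theorem IsTwoForm.happ₂_swap {B : BilinSec EM FE E FV V} (hB : IsTwoForm B) (X Y : Sec EM FE E) :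
    happ₂ B X Y = -happ₂ B Y X :=
  ContMDiffSection.ext fun x => hB.swap x _ _

theorem happ₃_eval (H : ThreeForm EM FE E FV V) (X Y Z : Sec EM FE E) (x : M) :
    happ₃ H X Y Z x = H.val x ![X x, Y x, Z x] := rfl

theorem happ₃_swap₁ (H : ThreeForm EM FE E FV V) (X Y Z : Sec EM FE E) :
    happ₃ H X Y Z = -happ₃ H Y X Z := by
  ext x
  have h := (H.val x).map_swap ![Y x, X x, Z x] (show (0 : Fin 3) ≠ 1 by decide)
  rw [sec_neg_apply, happ₃_eval, happ₃_eval, ← h]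
  congr 1; funext i; fin_cases i <;> rfl

theorem happ₃_swap₂ (H : ThreeForm EM FE E FV V) (X Y Z : Sec EM FE E) :
    happ₃ H X Y Z = -happ₃ H X Z Y := by
  ext x
  have h := (H.val x).map_swap ![X x, Z x, Y x] (show (1 : Fin 3) ≠ 2 by decide)
  rw [sec_neg_apply, happ₃_eval, happ₃_eval, ← h]
  congr 1; funext i; fin_cases i <;> rfl

theorem update_two {F : Type*} (u v w w' : F) :
    Function.update ![u, v, w] 2 w' = ![u, v, w'] := by
  funext i; fin_cases i <;> rfl

/-- The trilinear operator on sections defined by a three-form. -/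
def happ₃ₗ (H : ThreeForm EM FE E FV V) :
    Sec EM FE E →ₗ[ℝ] Sec EM FE E →ₗ[ℝ] Sec EM FE E →ₗ[ℝ] Sec EM FV V :=
  have add₃ : ∀ X Y Z Z' : Sec EM FE E,
      happ₃ H X Y (Z + Z') = happ₃ H X Y Z + happ₃ H X Y Z' := fun X Y Z Z' => by
    ext x
    have := (H.val x).map_update_add ![X x, Y x, Z x] 2 (Z x) (Z' x)
    simp only [update_two] at this
    exact this
  have smul₃ : ∀ (r : ℝ) (X Y Z : Sec EM FE E),
      happ₃ H X Y (r • Z) = r • happ₃ H X Y Z := fun r X Y Z => by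
    ext x
    have := (H.val x).map_update_smul ![X x, Y x, Z x] 2 r (Z x)
    simp only [update_two] at this
    exact this
  { toFun := fun X =>
    { toFun := fun Y =>
      { toFun := fun Z => happ₃ H X Y Z
        map_add' := add₃ X Y
        map_smul' := fun r Z => smul₃ r X Y Z }
      map_add' := fun Y Y' => by
        ext1 Z
        change happ₃ H X (Y + Y') Z = happ₃ H X Y Z + happ₃ H X Y' Z
        rw [happ₃_swap₂, add₃, happ₃_swap₂ H X Z Y, happ₃_swap₂ H X Z Y']; abel
      map_smul' := fun r Y => by
        ext1 Z
        change happ₃ H X (r • Y) Z = r • happ₃ H X Y Z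
        rw [happ₃_swap₂, smul₃, happ₃_swap₂ H X Z Y]; module }
    map_add' := fun X X' => by
      ext1 Y; ext1 Z
      change happ₃ H (X + X') Y Z = happ₃ H X Y Z + happ₃ H X' Y Z
      rw [happ₃_swap₁, happ₃_swap₂, add₃, happ₃_swap₂ H Y Z X, happ₃_swap₂ H Y Z X',
        happ₃_swap₁ H X, happ₃_swap₁ H X']; abel
    map_smul' := fun r X => by
      ext1 Y; ext1 Z
      change happ₃ H (r • X) Y Z = r • happ₃ H X Y Z
      rw [happ₃_swap₁, happ₃_swap₂, smul₃, happ₃_swap₂ H Y Z X, happ₃_swap₁ H X]; module }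

@[simp] theorem happ₃ₗ_apply (H : ThreeForm EM FE E FV V) (X Y Z : Sec EM FE E) :
    happ₃ₗ H X Y Z = happ₃ H X Y Z := rfl

theorem happ₃_fsmul (H : ThreeForm EM FE E FV V) (f : C^∞⟮𝓘(ℝ, EM), M; ℝ⟯)
    (X Y Z : Sec EM FE E) : happ₃ H X Y (fsmul f Z) = fsmul f (happ₃ H X Y Z) := by
  ext x
  have := (H.val x).map_update_smul ![X x, Y x, Z x] 2 (f x) (Z x)
  simp only [update_two] at this
  exact this

end Linear

/-! ### Lie 2-algebroids as section algebras, and tensoriality of the form part -/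

section Algebra

variable {EM : Type*} [NormedAddCommGroup EM] [NormedSpace ℝ EM]
  {M : Type*} [TopologicalSpace M] [ChartedSpace EM M] [IsManifold 𝓘(ℝ, EM) ∞ M]
  {FE : Type*} [NormedAddCommGroup FE] [NormedSpace ℝ FE]
  {E : M → Type*} [TopologicalSpace (TotalSpace FE E)] [∀ x, TopologicalSpace (E x)]
  [∀ x, AddCommGroup (E x)] [∀ x, Module ℝ (E x)]
  [∀ x, IsTopologicalAddGroup (E x)] [∀ x, ContinuousSMul ℝ (E x)]
  [FiberBundle FE E] [VectorBundle ℝ FE E]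
  {FV : Type*} [NormedAddCommGroup FV] [NormedSpace ℝ FV]
  {V : M → Type*} [TopologicalSpace (TotalSpace FV V)] [∀ x, TopologicalSpace (V x)]
  [∀ x, AddCommGroup (V x)] [∀ x, Module ℝ (V x)]
  [∀ x, IsTopologicalAddGroup (V x)] [∀ x, ContinuousSMul ℝ (V x)]
  [FiberBundle FV V] [VectorBundle ℝ FV V]

theorem Lie2Data.formPart_eq (L : Lie2Data EM FE E FV V) (X : Sec EM FE E)
    (a : HomSec EM FE E FV V) (Y : Sec EM FE E) (b : HomSec EM FE E FV V) (Z : Sec EM FE E) :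
    L.formPart X a Y b Z = L.conn X (happ b Z) - happ b (L.bracket X Z) - L.conn Y (happ a Z)
      + L.conn Z (happ a Y) + happ a (L.bracket Y Z) + happ₃ L.H Y X Z
      - happ a (happ L.t (happ b Z)) + happ b (happ L.t (happ a Z)) := by
  simp only [Lie2Data.formPart, Lie2Data.lieDer, Lie2Data.extD₁, Lie2Data.T]
  abel

namespace Lie2Algebroid

variable (L : Lie2Algebroid EM FE E FV V)

/-- The operations of a Lie 2-algebroid on sections. -/
def algebra : SectionAlgebra (Sec EM FE E) (Sec EM FV V) where
  br := L.bracket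
  conn := L.conn
  t := happₗ L.t
  H := happ₃ₗ L.H
  skew := L.bracket_skew
  H_swap₁ := happ₃_swap₁ L.H
  H_swap₂ := happ₃_swap₂ L.H
  jacobi := L.jacobi
  curvature := L.curvature
  t_conn := L.t_conn
  conn_t_skew := L.conn_t_skew
  closed := L.closed

theorem algebra_form_apply (X : Sec EM FE E) (a : HomSec EM FE E FV V) (Y : Sec EM FE E)
    (b : HomSec EM FE E FV V) (Z : Sec EM FE E) :
    L.algebra.form X (happₗ a) Y (happₗ b) Z = L.formPart X a Y b Z := by
  rw [SectionAlgebra.form_apply]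
  simp only [algebra, happₗ_apply, happ₃ₗ_apply, Lie2Data.formPart, Lie2Data.lieDer,
    Lie2Data.extD₁, Lie2Data.T]
  abel

/-- The derivatives of `f` cancel in pairs, between `∇_X (b Z)` and `b [X, Z]` and between `∇_Y (a
Z)` and `a [Y, Z]`. Hence the form part of the bracket is a genuine bundle map. -/
theorem formPart_fsmul (X : Sec EM FE E) (a : HomSec EM FE E FV V) (Y : Sec EM FE E)
    (b : HomSec EM FE E FV V) (f : C^∞⟮𝓘(ℝ, EM), M; ℝ⟯) (Z : Sec EM FE E) :
    L.formPart X a Y b (fsmul f Z) = fsmul f (L.formPart X a Y b Z) := by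
  rw [Lie2Data.formPart_eq, Lie2Data.formPart_eq]
  simp only [happ_fsmul, happ₃_fsmul, L.conn_fsmul]
  have h1 : ∀ (c : HomSec EM FE E FV V) (X : Sec EM FE E) (x : M),
      happ c (L.bracket X (fsmul f Z)) x
        = anchorDeriv L.anchor X f x • happ c Z x + f x • happ c (L.bracket X Z) x := by
    intro c X x
    rw [happ_eval, L.bracket_leibniz, map_add, map_smul, map_smul]
    rfl
  ext x
  simp only [sec_add_apply, sec_sub_apply, L.conn_leibniz, h1]
  have e : ∀ s : Sec EM FV V, (fsmul f s) x = f x • s x := fun _ => rfl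
  simp only [e, sec_add_apply, sec_sub_apply]
  module

end Lie2Algebroid

end Algebra

/-! ### Bilinear bundle maps and homomorphisms of fibres -/

section Bilinear

variable {EM : Type*} [NormedAddCommGroup EM] [NormedSpace ℝ EM] [FiniteDimensional ℝ EM]
  {M : Type*} [TopologicalSpace M] [ChartedSpace EM M] [IsManifold 𝓘(ℝ, EM) ∞ M] [T2Space M]
  {FE : Type*} [NormedAddCommGroup FE] [NormedSpace ℝ FE] [FiniteDimensional ℝ FE]
  {E : M → Type*} [TopologicalSpace (TotalSpace FE E)] [∀ x, TopologicalSpace (E x)]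
  [∀ x, AddCommGroup (E x)] [∀ x, Module ℝ (E x)]
  [∀ x, IsTopologicalAddGroup (E x)] [∀ x, ContinuousSMul ℝ (E x)]
  [FiberBundle FE E] [VectorBundle ℝ FE E] [ContMDiffVectorBundle ∞ FE E 𝓘(ℝ, EM)]
  {FV : Type*} [NormedAddCommGroup FV] [NormedSpace ℝ FV]
  {V : M → Type*} [TopologicalSpace (TotalSpace FV V)] [∀ x, TopologicalSpace (V x)]
  [∀ x, AddCommGroup (V x)] [∀ x, Module ℝ (V x)]
  [∀ x, IsTopologicalAddGroup (V x)] [∀ x, ContinuousSMul ℝ (V x)]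
  [FiberBundle FV V] [VectorBundle ℝ FV V] [ContMDiffVectorBundle ∞ FV V 𝓘(ℝ, EM)]

/-- Tensoriality is used twice: in the second slot to obtain a homomorphism for each section, then
in the first slot for the resulting `Hom`-valued operator. -/
theorem exists_bilinSec (T : Sec EM FE E →ₗ[ℝ] Sec EM FE E →ₗ[ℝ] Sec EM FV V)
    (h₁ : ∀ f X Y, T (fsmul f X) Y = fsmul f (T X Y))
    (h₂ : ∀ f X Y, T X (fsmul f Y) = fsmul f (T X Y)) :
    ∃ B : BilinSec EM FE E FV V, ∀ X Y, happ₂ B X Y = T X Y := by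
  have hadd : ∀ X, ∀ Y, happ (HomSec.ofTensorial (T X) fun f Y => h₂ f X Y) Y = T X Y :=
    fun X Y => happ_ofTensorial _ _ _
  refine ⟨HomSec.ofTensorial
    { toFun := fun X => HomSec.ofTensorial (T X) fun f Y => h₂ f X Y
      map_add' := fun X X' => ext_of_sec fun Y => by
        rw [add_happ, hadd, hadd, hadd, map_add]; rfl
      map_smul' := fun r X => ext_of_sec fun Y => by
        rw [RingHom.id_apply, smul_happ, hadd, hadd, map_smul]; rfl }
    (fun f X => ext_of_sec fun Y => ?_), fun X Y => ?_⟩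
  · rw [fsmul_happ]
    exact (hadd _ _).trans ((h₁ f X Y).trans (congrArg _ (hadd X Y).symm))
  · rw [happ₂, happ_ofTensorial]
    exact hadd X Y

/-- A rank-one map built from a functional that does not vanish at `u`. The control of its range is
what the argument for `rk V > 1` relies on. -/
theorem exists_hom_apply_eq (FE : Type*) [NormedAddCommGroup FE] [NormedSpace ℝ FE]
    [FiniteDimensional ℝ FE] {E : M → Type*} [TopologicalSpace (TotalSpace FE E)]
    [∀ x, TopologicalSpace (E x)] [∀ x, AddCommGroup (E x)] [∀ x, Module ℝ (E x)]
    [∀ x, IsTopologicalAddGroup (E x)] [∀ x, ContinuousSMul ℝ (E x)]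
    [FiberBundle FE E] [VectorBundle ℝ FE E]
    {x : M} {u : E x} (hu : u ≠ 0) (v : V x) :
    ∃ a : E x →L[ℝ] V x, a u = v ∧ ∀ w, a w ∈ Submodule.span ℝ {v} := by
  have hfin : FiniteDimensional ℝ (E x) := VectorBundle.finiteDimensional ℝ FE E x
  have hT2 : T2Space (E x) := FiberBundle.t2Space FE E x
  have : ∃ ℓ : Module.Dual ℝ (E x), ℓ u ≠ 0 := by
    by_contra h
    push Not at h
    exact hu ((Module.forall_dual_apply_eq_zero_iff ℝ u).1 h)
  obtain ⟨ℓ, hℓ⟩ := this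
  refine ⟨LinearMap.toContinuousLinearMap ((ℓ u)⁻¹ • ℓ.smulRight v), ?_, fun w => ?_⟩
  · simp [smul_smul, hℓ]
  · simp only [LinearMap.coe_toContinuousLinearMap', LinearMap.smul_apply,
      LinearMap.smulRight_apply]
    exact Submodule.smul_mem _ _ (Submodule.smul_mem _ _ (Submodule.mem_span_singleton_self v))

theorem finrank_fiber (FV : Type*) [NormedAddCommGroup FV] [NormedSpace ℝ FV]
    (V : M → Type*) [TopologicalSpace (TotalSpace FV V)] [∀ x, TopologicalSpace (V x)]
    [∀ x, AddCommGroup (V x)] [∀ x, Module ℝ (V x)]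
    [FiberBundle FV V] [VectorBundle ℝ FV V] (x : M) : finrank ℝ (V x) = finrank ℝ FV :=
  (VectorBundle.continuousLinearEquivAt ℝ FV V x).toLinearEquiv.finrank_eq

theorem exists_ne_zero_fiber {FV : Type*} [NormedAddCommGroup FV] [NormedSpace ℝ FV]
    {V : M → Type*} [TopologicalSpace (TotalSpace FV V)] [∀ x, TopologicalSpace (V x)]
    [∀ x, AddCommGroup (V x)] [∀ x, Module ℝ (V x)]
    [FiberBundle FV V] [VectorBundle ℝ FV V] (h : 0 < finrank ℝ FV) (x : M) : ∃ v : V x, v ≠ 0 := by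
  rw [← finrank_fiber FV V x] at h
  have := Module.nontrivial_of_finrank_pos h
  exact exists_ne 0

/-- A nonzero vector of `E` can be sent to a nonzero vector of `V`, provided there is one. This lets
identities in `E` be tested against `Hom(E, V)`. -/
theorem eq_zero_of_forall_hom (hV : 0 < finrank ℝ FV) (FE : Type*) [NormedAddCommGroup FE]
    [NormedSpace ℝ FE]
    [FiniteDimensional ℝ FE] {E : M → Type*} [TopologicalSpace (TotalSpace FE E)]
    [∀ x, TopologicalSpace (E x)] [∀ x, AddCommGroup (E x)] [∀ x, Module ℝ (E x)]
    [∀ x, IsTopologicalAddGroup (E x)] [∀ x, ContinuousSMul ℝ (E x)]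
    [FiberBundle FE E] [VectorBundle ℝ FE E] {x : M} {u : E x}
    (h : ∀ a : E x →L[ℝ] V x, a u = 0) : u = 0 := by
  by_contra hu
  obtain ⟨v, hv⟩ := exists_ne_zero_fiber (V := V) hV x
  obtain ⟨a, ha, -⟩ := exists_hom_apply_eq FE hu v
  exact hv (ha ▸ h a)

end Bilinear

/-! ### Sections of a direct sum -/

section DirectSum

variable {EM : Type*} [NormedAddCommGroup EM] [NormedSpace ℝ EM]
  {M : Type*} [TopologicalSpace M] [ChartedSpace EM M]
  {FE : Type*} [NormedAddCommGroup FE] [NormedSpace ℝ FE]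
  {E : M → Type*} [TopologicalSpace (TotalSpace FE E)] [∀ x, TopologicalSpace (E x)]
  [∀ x, AddCommGroup (E x)] [∀ x, Module ℝ (E x)]
  [FiberBundle FE E] [VectorBundle ℝ FE E]
  {FV : Type*} [NormedAddCommGroup FV] [NormedSpace ℝ FV]
  {V : M → Type*} [TopologicalSpace (TotalSpace FV V)] [∀ x, TopologicalSpace (V x)]
  [∀ x, AddCommGroup (V x)] [∀ x, Module ℝ (V x)]
  [FiberBundle FV V] [VectorBundle ℝ FV V]

/-- The trivialization of a direct sum is the product of the trivializations, so smoothness is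
checked componentwise. -/
theorem contMDiff_prod_bundle_iff {s : ∀ x : M, E x × V x} :
    ContMDiff 𝓘(ℝ, EM) (𝓘(ℝ, EM).prod 𝓘(ℝ, FE × FV)) ∞
      (fun x => TotalSpace.mk' (FE × FV) (E := E ×ᵇ V) x (s x)) ↔
    ContMDiff 𝓘(ℝ, EM) (𝓘(ℝ, EM).prod 𝓘(ℝ, FE)) ∞ (fun x => TotalSpace.mk' FE x (s x).1) ∧
    ContMDiff 𝓘(ℝ, EM) (𝓘(ℝ, EM).prod 𝓘(ℝ, FV)) ∞ (fun x => TotalSpace.mk' FV x (s x).2) := by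
  have key : ∀ x₀, ContMDiffAt 𝓘(ℝ, EM) (𝓘(ℝ, EM).prod 𝓘(ℝ, FE × FV)) ∞
      (fun x => TotalSpace.mk' (FE × FV) (E := E ×ᵇ V) x (s x)) x₀ ↔
    ContMDiffAt 𝓘(ℝ, EM) (𝓘(ℝ, EM).prod 𝓘(ℝ, FE)) ∞ (fun x => TotalSpace.mk' FE x (s x).1) x₀ ∧
    ContMDiffAt 𝓘(ℝ, EM) (𝓘(ℝ, EM).prod 𝓘(ℝ, FV)) ∞ (fun x => TotalSpace.mk' FV x (s x).2) x₀ := by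
    intro x₀
    rw [contMDiffAt_section, contMDiffAt_section, contMDiffAt_section]
    exact contMDiffAt_prod_module_iff (𝕜 := ℝ) (I := 𝓘(ℝ, EM)) (fun x =>
      ((trivializationAt (FE × FV) (E ×ᵇ V) x₀) ⟨x, s x⟩).2)
  exact ⟨fun h => ⟨fun x => ((key x).1 (h x)).1, fun x => ((key x).1 (h x)).2⟩,
    fun h x => (key x).2 ⟨h.1 x, h.2 x⟩⟩

/-- The first component of a section of a direct sum. -/
def secFst (s : Sec EM (FE × FV) (E ×ᵇ V)) : Sec EM FE E :=
  ⟨fun x => (s x).1, (contMDiff_prod_bundle_iff.1 s.contMDiff).1⟩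

/-- The second component of a section of a direct sum. -/
def secSnd (s : Sec EM (FE × FV) (E ×ᵇ V)) : Sec EM FV V :=
  ⟨fun x => (s x).2, (contMDiff_prod_bundle_iff.1 s.contMDiff).2⟩

/-- The section of a direct sum with given components. -/
def secPair (X : Sec EM FE E) (v : Sec EM FV V) : Sec EM (FE × FV) (E ×ᵇ V) :=
  ⟨fun x => (X x, v x), contMDiff_prod_bundle_iff.2 ⟨X.contMDiff, v.contMDiff⟩⟩

@[simp] theorem secFst_pair (X : Sec EM FE E) (v : Sec EM FV V) : secFst (secPair X v) = X := rfl
@[simp] theorem secSnd_pair (X : Sec EM FE E) (v : Sec EM FV V) : secSnd (secPair X v) = v := rfl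
@[simp] theorem secPair_eta (s : Sec EM (FE × FV) (E ×ᵇ V)) : secPair (secFst s) (secSnd s) = s := rfl
@[simp] theorem secFst_add (s s' : Sec EM (FE × FV) (E ×ᵇ V)) :
    secFst (s + s') = secFst s + secFst s' := rfl
@[simp] theorem secSnd_add (s s' : Sec EM (FE × FV) (E ×ᵇ V)) :
    secSnd (s + s') = secSnd s + secSnd s' := rfl
@[simp] theorem secFst_smul (r : ℝ) (s : Sec EM (FE × FV) (E ×ᵇ V)) :
    secFst (r • s) = r • secFst s := rfl
@[simp] theorem secSnd_smul (r : ℝ) (s : Sec EM (FE × FV) (E ×ᵇ V)) :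
    secSnd (r • s) = r • secSnd s := rfl
@[simp] theorem secFst_fsmul (f : C^∞⟮𝓘(ℝ, EM), M; ℝ⟯) (s : Sec EM (FE × FV) (E ×ᵇ V)) :
    secFst (fsmul f s) = fsmul f (secFst s) := rfl
@[simp] theorem secSnd_fsmul (f : C^∞⟮𝓘(ℝ, EM), M; ℝ⟯) (s : Sec EM (FE × FV) (E ×ᵇ V)) :
    secSnd (fsmul f s) = fsmul f (secSnd s) := rfl

theorem secPair_ext {s s' : Sec EM (FE × FV) (E ×ᵇ V)} (h₁ : secFst s = secFst s')
    (h₂ : secSnd s = secSnd s') : s = s' := by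
  rw [← secPair_eta s, ← secPair_eta s', h₁, h₂]

end DirectSum

/-! ### The standard model -/

section Model

variable {EM : Type*} [NormedAddCommGroup EM] [NormedSpace ℝ EM] [FiniteDimensional ℝ EM]
  {M : Type*} [TopologicalSpace M] [ChartedSpace EM M] [IsManifold 𝓘(ℝ, EM) ∞ M] [T2Space M]
  {FE : Type*} [NormedAddCommGroup FE] [NormedSpace ℝ FE] [FiniteDimensional ℝ FE]
  {E : M → Type*} [TopologicalSpace (TotalSpace FE E)] [∀ x, TopologicalSpace (E x)]
  [∀ x, AddCommGroup (E x)] [∀ x, Module ℝ (E x)]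
  [∀ x, IsTopologicalAddGroup (E x)] [∀ x, ContinuousSMul ℝ (E x)]
  [FiberBundle FE E] [VectorBundle ℝ FE E] [ContMDiffVectorBundle ∞ FE E 𝓘(ℝ, EM)]
  {FV : Type*} [NormedAddCommGroup FV] [NormedSpace ℝ FV] [FiniteDimensional ℝ FV]
  {V : M → Type*} [TopologicalSpace (TotalSpace FV V)] [∀ x, TopologicalSpace (V x)]
  [∀ x, AddCommGroup (V x)] [∀ x, Module ℝ (V x)]
  [∀ x, IsTopologicalAddGroup (V x)] [∀ x, ContinuousSMul ℝ (V x)]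
  [FiberBundle FV V] [VectorBundle ℝ FV V] [ContMDiffVectorBundle ∞ FV V 𝓘(ℝ, EM)]

variable (EM FE E FV V) in
/-- The projection `E ⊕ Hom(E, V) → E`. -/
def modelPi : HomSec EM (FE × (FE →L[ℝ] FV)) (E ×ᵇ fun x : M => E x →L[ℝ] V x) FE E :=
  HomSec.ofSmooth (fun x => ContinuousLinearMap.fst ℝ (E x) (E x →L[ℝ] V x))
    fun s => (secFst s).contMDiff

variable (EM FE E FV V) in
/-- The inclusion `Hom(E, V) → E ⊕ Hom(E, V)`. -/
def modelPiStar : HomSec EM (FE →L[ℝ] FV) (fun x : M => E x →L[ℝ] V x)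
    (FE × (FE →L[ℝ] FV)) (E ×ᵇ fun x : M => E x →L[ℝ] V x) :=
  HomSec.ofSmooth (fun x => ContinuousLinearMap.inr ℝ (E x) (E x →L[ℝ] V x))
    fun s => (secPair (0 : Sec EM FE E) s).contMDiff

variable (EM FE E FV V) in
/-- The inclusion `E → E ⊕ Hom(E, V)`. -/
def modelSplitting : HomSec EM FE E (FE × (FE →L[ℝ] FV)) (E ×ᵇ fun x : M => E x →L[ℝ] V x) :=
  HomSec.ofSmooth (fun x => ContinuousLinearMap.inl ℝ (E x) (E x →L[ℝ] V x))
    fun s => (secPair s (0 : HomSec EM FE E FV V)).contMDiff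

theorem exists_modelPairing :
    ∃ B : BilinSec EM (FE × (FE →L[ℝ] FV)) (E ×ᵇ fun x : M => E x →L[ℝ] V x) FV V,
      ∀ x (w w' : E x × (E x →L[ℝ] V x)), B x w w' = w.2 w'.1 + w'.2 w.1 := by
  obtain ⟨B, hB⟩ := exists_bilinSec (EM := EM) (FE := FE × (FE →L[ℝ] FV))
    (E := E ×ᵇ fun x : M => E x →L[ℝ] V x) (FV := FV) (V := V)
    (LinearMap.mk₂ ℝ (fun ψ φ => happ (secSnd ψ) (secFst φ) + happ (secSnd φ) (secFst ψ))
      (fun ψ ψ' φ => by simp only [secFst_add, secSnd_add, happ_add, add_happ]; abel)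
      (fun r ψ φ => by simp only [secFst_smul, secSnd_smul, happ_smul, smul_happ]; module)
      (fun ψ φ φ' => by simp only [secFst_add, secSnd_add, happ_add, add_happ]; abel)
      (fun r ψ φ => by simp only [secFst_smul, secSnd_smul, happ_smul, smul_happ]; module))
    (fun f ψ φ => by
      simp only [LinearMap.mk₂_apply, secFst_fsmul, secSnd_fsmul, happ_fsmul, fsmul_happ,
        fsmul_add])
    (fun f ψ φ => by
      simp only [LinearMap.mk₂_apply, secFst_fsmul, secSnd_fsmul, happ_fsmul, fsmul_happ,
        fsmul_add])
  refine ⟨B, fun x w w' => ?_⟩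
  obtain ⟨ψ, rfl⟩ := exists_sec_apply_eq (EM := EM) (FE := FE × (FE →L[ℝ] FV))
    (E := E ×ᵇ fun x : M => E x →L[ℝ] V x) w
  obtain ⟨φ, rfl⟩ := exists_sec_apply_eq (EM := EM) (FE := FE × (FE →L[ℝ] FV))
    (E := E ×ᵇ fun x : M => E x →L[ℝ] V x) w'
  exact congrArg (fun s : Sec EM FV V => s x) (hB ψ φ)

variable (EM FE E FV V) in
/-- The product on `E ⊕ Hom(E, V)`. -/
def modelPairing : BilinSec EM (FE × (FE →L[ℝ] FV)) (E ×ᵇ fun x : M => E x →L[ℝ] V x) FV V :=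
  exists_modelPairing.choose

theorem modelPairing_apply (x : M) (w w' : E x × (E x →L[ℝ] V x)) :
    modelPairing EM FE E FV V x w w' = w.2 w'.1 + w'.2 w.1 :=
  exists_modelPairing.choose_spec x w w'

theorem happ₂_modelPairing
    (ψ φ : Sec EM (FE × (FE →L[ℝ] FV)) (E ×ᵇ fun x : M => E x →L[ℝ] V x)) :
    happ₂ (modelPairing EM FE E FV V) ψ φ
      = happ (secSnd ψ) (secFst φ) + happ (secSnd φ) (secFst ψ) :=
  ContMDiffSection.ext fun x => modelPairing_apply x (ψ x) (φ x)

theorem eq_zero_of_eq_neg {P : Type*} [AddCommGroup P] [Module ℝ P] {p : P} (h : p = -p) :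
    p = 0 := by
  have h2 : (2 : ℝ) • p = 0 := by rw [two_smul]; nth_rewrite 2 [h]; exact add_neg_cancel p
  exact (smul_eq_zero.mp h2).resolve_left two_ne_zero

theorem happ₃_self₁₂ (H : ThreeForm EM FE E FV V) (X Z : Sec EM FE E) : happ₃ H X X Z = 0 :=
  eq_zero_of_eq_neg (happ₃_swap₁ H X X Z)

theorem happ₃_self₁₃ (H : ThreeForm EM FE E FV V) (X Y : Sec EM FE E) : happ₃ H X Y X = 0 := by
  rw [happ₃_swap₂, happ₃_self₁₂, neg_zero]

namespace Lie2Algebroid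

variable (L : Lie2Algebroid EM FE E FV V)

/-- The `Hom(E, V)`-component of the standard bracket. -/
def formHom (X : Sec EM FE E) (a : HomSec EM FE E FV V) (Y : Sec EM FE E)
    (b : HomSec EM FE E FV V) : HomSec EM FE E FV V :=
  HomSec.ofTensorial (L.algebra.form X (happₗ a) Y (happₗ b)) fun f Z => by
    rw [algebra_form_apply, algebra_form_apply, formPart_fsmul]

@[simp] theorem happ_formHom (X : Sec EM FE E) (a : HomSec EM FE E FV V) (Y : Sec EM FE E)
    (b : HomSec EM FE E FV V) (Z : Sec EM FE E) :
    happ (L.formHom X a Y b) Z = L.formPart X a Y b Z := by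
  rw [formHom, happ_ofTensorial, algebra_form_apply]

theorem happₗ_formHom (X : Sec EM FE E) (a : HomSec EM FE E FV V) (Y : Sec EM FE E)
    (b : HomSec EM FE E FV V) :
    happₗ (L.formHom X a Y b) = L.algebra.form X (happₗ a) Y (happₗ b) :=
  LinearMap.ext fun Z => by rw [happₗ_apply, happ_formHom, algebra_form_apply]

theorem bracket_self (X : Sec EM FE E) : L.bracket X X = 0 :=
  eq_zero_of_eq_neg (L.bracket_skew X X)

theorem ext_of_happₗ {a b : HomSec EM FE E FV V} (h : happₗ a = happₗ b) : a = b :=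
  ext_of_sec fun X => LinearMap.congr_fun h X

/-- The bracket of the standard model. -/
def modelBracket : Sec EM (FE × (FE →L[ℝ] FV)) (E ×ᵇ fun x : M => E x →L[ℝ] V x) →ₗ[ℝ]
    Sec EM (FE × (FE →L[ℝ] FV)) (E ×ᵇ fun x : M => E x →L[ℝ] V x) →ₗ[ℝ]
    Sec EM (FE × (FE →L[ℝ] FV)) (E ×ᵇ fun x : M => E x →L[ℝ] V x) :=
  LinearMap.mk₂ ℝ
    (fun ψ φ => secPair
      (L.bracket (secFst ψ) (secFst φ) - happ L.t (happ (secSnd ψ) (secFst φ)))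
      (L.formHom (secFst ψ) (secSnd ψ) (secFst φ) (secSnd φ)))
    (fun ψ ψ' φ => secPair_ext
      (by
        simp only [secFst_add, secSnd_add, secFst_pair, happ_add, add_happ, map_add,
          LinearMap.add_apply]
        abel)
      (ext_of_happₗ (by
        simp only [secFst_add, secSnd_add, secSnd_pair, happₗ_add, happₗ_formHom]
        exact SectionAlgebra.form_add_left _ _ _ _ _ _ _)))
    (fun r ψ φ => secPair_ext
      (by
        simp only [secFst_smul, secSnd_smul, secFst_pair, happ_smul, smul_happ, map_smul,
          LinearMap.smul_apply]
        module)
      (ext_of_happₗ (by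
        simp only [secFst_smul, secSnd_smul, secSnd_pair, happₗ_smul, happₗ_formHom]
        exact SectionAlgebra.form_smul_left _ _ _ _ _ _)))
    (fun ψ φ φ' => secPair_ext
      (by
        simp only [secFst_add, secFst_pair, happ_add, map_add]
        abel)
      (ext_of_happₗ (by
        simp only [secFst_add, secSnd_add, secSnd_pair, happₗ_add, happₗ_formHom]
        exact SectionAlgebra.form_add_right _ _ _ _ _ _ _)))
    (fun r ψ φ => secPair_ext
      (by
        simp only [secFst_smul, secFst_pair, happ_smul, map_smul]
        module)
      (ext_of_happₗ (by
        simp only [secFst_smul, secSnd_smul, secSnd_pair, happₗ_smul, happₗ_formHom]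
        exact SectionAlgebra.form_smul_right _ _ _ _ _ _)))

theorem modelBracket_apply
    (ψ φ : Sec EM (FE × (FE →L[ℝ] FV)) (E ×ᵇ fun x : M => E x →L[ℝ] V x)) :
    L.modelBracket ψ φ = secPair
      (L.bracket (secFst ψ) (secFst φ) - happ L.t (happ (secSnd ψ) (secFst φ)))
      (L.formHom (secFst ψ) (secSnd ψ) (secFst φ) (secSnd φ)) := rfl

/-- The connection of the standard model. -/
def modelConn : Sec EM (FE × (FE →L[ℝ] FV)) (E ×ᵇ fun x : M => E x →L[ℝ] V x) →ₗ[ℝ]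
    Sec EM FV V →ₗ[ℝ] Sec EM FV V :=
  LinearMap.mk₂ ℝ (fun ψ v => L.conn (secFst ψ) v - happ (secSnd ψ) (happ L.t v))
    (fun ψ ψ' v => by
      simp only [secFst_add, secSnd_add, map_add, LinearMap.add_apply, add_happ]; abel)
    (fun r ψ v => by
      simp only [secFst_smul, secSnd_smul, map_smul, LinearMap.smul_apply, smul_happ]; module)
    (fun ψ v v' => by simp only [map_add, happ_add]; abel)
    (fun r ψ v => by simp only [map_smul, happ_smul]; module)

theorem modelConn_apply
    (ψ : Sec EM (FE × (FE →L[ℝ] FV)) (E ×ᵇ fun x : M => E x →L[ℝ] V x)) (v : Sec EM FV V) :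
    L.modelConn ψ v = L.conn (secFst ψ) v - happ (secSnd ψ) (happ L.t v) := rfl

/-- The exact Courant algebroid of a Lie 2-algebroid. -/
def model (hE : ∀ x : M, ∃ u : E x, u ≠ 0) (hV : 0 < finrank ℝ FV) :
    VExactCourant EM FE E FV V (FE × (FE →L[ℝ] FV)) (E ×ᵇ fun x : M => E x →L[ℝ] V x) where
  anchor := HomSec.ofSmooth
    (fun x => (L.anchor x).comp (ContinuousLinearMap.fst ℝ (E x) (E x →L[ℝ] V x)))
    fun s => (happ L.anchor (secFst s)).contMDiff
  bracket := L.modelBracket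
  pairing := modelPairing EM FE E FV V
  conn := L.modelConn
  pairing_symm x w w' := by rw [modelPairing_apply, modelPairing_apply, add_comm]
  pairing_nondeg x w hw := by
    have h1 : w.2 = 0 := by
      ext u
      have := hw (u, 0)
      rw [modelPairing_apply] at this
      simpa using this
    -- Pairing with forms detects the component in `E` because `V` is nonzero.
    have h2 : w.1 = 0 := eq_zero_of_forall_hom hV FE fun a => by
      have := hw (0, a)
      rw [modelPairing_apply] at this
      simpa using this
    exact Prod.ext h2 h1
  pairing_surj x := by
    rw [eq_top_iff]
    intro v _
    -- A nonzero vector of `E` lets the product reach every vector of `V`.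
    obtain ⟨u, hu⟩ := hE x
    obtain ⟨a, ha, -⟩ := exists_hom_apply_eq FE hu v
    exact Submodule.subset_span ⟨(0, a), (u, 0), by rw [modelPairing_apply]; simpa using ha⟩
  conn_fsmul f ψ v := by
    rw [modelConn_apply, modelConn_apply, secFst_fsmul, secSnd_fsmul, L.conn_fsmul, fsmul_happ,
      fsmul_sub]
  conn_leibniz ψ f v x := by
    rw [modelConn_apply, modelConn_apply, happ_fsmul, happ_fsmul, sec_sub_apply, L.conn_leibniz,
      fsmul_apply, sec_sub_apply, smul_sub, add_sub_assoc]
    rfl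
  loday ψ φ₁ φ₂ := by
    refine secPair_ext ?_ (ext_of_happₗ ?_)
    · simp only [modelBracket_apply, secFst_add, secFst_pair, secSnd_pair, happ_formHom]
      simp only [← algebra_form_apply]
      exact L.algebra.loday_base (secFst ψ) (happₗ (secSnd ψ)) (secFst φ₁) (happₗ (secSnd φ₁))
        (secFst φ₂)
    · simp only [modelBracket_apply, secSnd_add, secFst_pair, secSnd_pair, happₗ_add,
        happₗ_formHom]
      exact L.algebra.loday_form _ _ _ _ _ _
  invariance ψ φ := by
    -- For `ψ = X ⊕ a` and `φ = Y ⊕ b`, the terms in `H` and `[Y, Y]` vanish on repeated arguments,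
    -- and what remains is `∇_X (b Y) - a (t (b Y))`, the connection applied to half of the square
    -- of `φ`.
    rw [happ₂_modelPairing, happ₂_modelPairing, modelBracket_apply, modelConn_apply, secFst_pair,
      secSnd_pair, happ_formHom, Lie2Data.formPart_eq, happ₃_self₁₃, L.bracket_self]
    simp only [map_add, happ_add, happ_sub, happ_zero]
    module
  symmetric_part ψ φ := by
    rw [happ₂_modelPairing, happ₂_modelPairing, modelBracket_apply, modelConn_apply, secFst_pair,
      secSnd_pair, happ_formHom, Lie2Data.formPart_eq, happ₃_self₁₂, L.bracket_self]
    simp only [map_add, happ_add, happ_sub, happ_zero]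
    module
  pi := modelPi EM FE E FV V
  piStar := modelPiStar EM FE E FV V
  anchor_factors := ⟨L.anchor, fun x w => rfl⟩
  piStar_adjoint x a w := by
    rw [modelPairing_apply]
    change a w.1 + w.2 (0 : E x) = a w.1
    rw [map_zero, add_zero]
  piStar_injective x a b h := congrArg Prod.snd h
  exact x w := by
    constructor
    · intro h
      exact ⟨w.2, Prod.ext (Eq.symm h) rfl⟩
    · rintro ⟨a, rfl⟩
      rfl
  pi_surjective x u := ⟨(u, 0), rfl⟩

theorem secFst_oplus (hE : ∀ x : M, ∃ u : E x, u ≠ 0) (hV : 0 < finrank ℝ FV)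
    (X : Sec EM FE E) (a : HomSec EM FE E FV V) :
    secFst ((L.model hE hV).oplus (modelSplitting EM FE E FV V) X a) = X :=
  ContMDiffSection.ext fun x => add_zero (X x)

theorem secSnd_oplus (hE : ∀ x : M, ∃ u : E x, u ≠ 0) (hV : 0 < finrank ℝ FV)
    (X : Sec EM FE E) (a : HomSec EM FE E FV V) :
    secSnd ((L.model hE hV).oplus (modelSplitting EM FE E FV V) X a) = a :=
  ContMDiffSection.ext fun x => zero_add (a x)

theorem model_isStandardModel (hE : ∀ x : M, ∃ u : E x, u ≠ 0) (hV : 0 < finrank ℝ FV) :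
    (L.model hE hV).IsStandardModel (modelSplitting EM FE E FV V) L where
  pi_eq x u a := rfl
  piStar_eq x a := rfl
  j_eq x u := rfl
  standardForm :=
    { anchor_eq := fun x u a => congrArg (L.anchor x) (add_zero u)
      conn_eq := fun X a v => by
        refine (L.modelConn_apply _ v).trans ?_
        rw [secFst_oplus, secSnd_oplus]
      pairing_eq := fun x u w a b => by
        refine (modelPairing_apply x (u + 0, 0 + a) (w + 0, 0 + b)).trans ?_
        simp
      bracket_eq := fun X a Y b => by
        refine ⟨L.formHom X a Y b, fun Z => L.happ_formHom X a Y b Z, ?_⟩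
        refine (L.modelBracket_apply _ _).trans ?_
        refine secPair_ext ?_ ?_
        · rw [secFst_oplus, secFst_oplus, secSnd_oplus, secFst_oplus, secFst_pair]
        · rw [secFst_oplus, secFst_oplus, secSnd_oplus, secSnd_oplus, secSnd_oplus,
            secSnd_pair] }

end Lie2Algebroid

/-! ### Uniqueness of the standard model -/

namespace VExactCourant

variable {FW : Type*} [NormedAddCommGroup FW] [NormedSpace ℝ FW]
  {W : M → Type*} [TopologicalSpace (TotalSpace FW W)] [∀ x, TopologicalSpace (W x)]
  [∀ x, AddCommGroup (W x)] [∀ x, Module ℝ (W x)]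
  [∀ x, IsTopologicalAddGroup (W x)] [∀ x, ContinuousSMul ℝ (W x)]
  [FiberBundle FW W] [VectorBundle ℝ FW W]

theorem ext' {C C' : VExactCourant EM FE E FV V FW W} (hA : C.anchor = C'.anchor)
    (hB : C.bracket = C'.bracket) (hP : C.pairing = C'.pairing) (hC : C.conn = C'.conn)
    (hpi : C.pi = C'.pi) (hpiS : C.piStar = C'.piStar) : C = C' := by
  rcases C with ⟨⟨⟩, _⟩
  rcases C' with ⟨⟨⟩, _⟩
  subst hA hB hP hC hpi hpiS
  rfl

theorem IsStandardModel.oplus_eq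
    {C : VExactCourant EM FE E FV V (FE × (FE →L[ℝ] FV)) (E ×ᵇ fun x : M => E x →L[ℝ] V x)}
    {j : HomSec EM FE E (FE × (FE →L[ℝ] FV)) (E ×ᵇ fun x : M => E x →L[ℝ] V x)}
    {L : Lie2Algebroid EM FE E FV V} (h : C.IsStandardModel j L)
    (X : Sec EM FE E) (a : HomSec EM FE E FV V) : C.oplus j X a = secPair X a := by
  ext1 x
  refine (congrArg₂ (· + ·) (h.j_eq x (X x)) (h.piStar_eq x (a x))).trans ?_
  exact Prod.ext (add_zero (X x)) (zero_add (a x))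

/-- Every element of the direct sum is of the form `j u + π^* a`, so the formulas of the standard
form prescribe all the operations. -/
theorem IsStandardModel.unique
    {C C' : VExactCourant EM FE E FV V (FE × (FE →L[ℝ] FV)) (E ×ᵇ fun x : M => E x →L[ℝ] V x)}
    {j j' : HomSec EM FE E (FE × (FE →L[ℝ] FV)) (E ×ᵇ fun x : M => E x →L[ℝ] V x)}
    {L : Lie2Algebroid EM FE E FV V} (h : C.IsStandardModel j L) (h' : C'.IsStandardModel j' L) :
    C = C' ∧ j = j' := by
  have hj : ∀ (x : M) (u : E x) (a : E x →L[ℝ] V x), j x u + C.piStar x a = (u, a) := by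
    intro x u a
    rw [h.j_eq, h.piStar_eq]
    exact Prod.ext (add_zero u) (zero_add a)
  have hj' : ∀ (x : M) (u : E x) (a : E x →L[ℝ] V x), j' x u + C'.piStar x a = (u, a) := by
    intro x u a
    rw [h'.j_eq, h'.piStar_eq]
    exact Prod.ext (add_zero u) (zero_add a)
  refine ⟨ext' ?_ ?_ ?_ ?_ ?_ ?_, ?_⟩
  · ext1 x
    refine ContinuousLinearMap.ext fun w => ?_
    have e := h.standardForm.anchor_eq x w.1 w.2
    have e' := h'.standardForm.anchor_eq x w.1 w.2
    rw [hj] at e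
    rw [hj'] at e'
    exact e.trans e'.symm
  · refine LinearMap.ext fun ψ => LinearMap.ext fun φ => ?_
    obtain ⟨c, hc, e⟩ := h.standardForm.bracket_eq (secFst ψ) (secSnd ψ) (secFst φ) (secSnd φ)
    obtain ⟨c', hc', e'⟩ := h'.standardForm.bracket_eq (secFst ψ) (secSnd ψ) (secFst φ) (secSnd φ)
    have hcc : c = c' := ext_of_sec fun Z => (hc Z).trans (hc' Z).symm
    simp only [h.oplus_eq] at e
    simp only [h'.oplus_eq] at e'
    rw [hcc] at e
    exact e.trans e'.symm
  · ext1 x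
    refine ContinuousLinearMap.ext fun w => ?_
    refine ContinuousLinearMap.ext fun w' => ?_
    have e := h.standardForm.pairing_eq x w.1 w'.1 w.2 w'.2
    have e' := h'.standardForm.pairing_eq x w.1 w'.1 w.2 w'.2
    rw [hj, hj] at e
    rw [hj', hj'] at e'
    exact e.trans e'.symm
  · refine LinearMap.ext fun ψ => LinearMap.ext fun v => ?_
    have e := h.standardForm.conn_eq (secFst ψ) (secSnd ψ) v
    have e' := h'.standardForm.conn_eq (secFst ψ) (secSnd ψ) v
    rw [h.oplus_eq] at e
    rw [h'.oplus_eq] at e'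
    exact e.trans e'.symm
  · ext1 x
    refine ContinuousLinearMap.ext fun w => ?_
    exact (h.pi_eq x w.1 w.2).trans (h'.pi_eq x w.1 w.2).symm
  · ext1 x
    refine ContinuousLinearMap.ext fun a => ?_
    exact (h.piStar_eq x a).trans (h'.piStar_eq x a).symm
  · ext1 x
    refine ContinuousLinearMap.ext fun u => ?_
    exact (h.j_eq x u).trans (h'.j_eq x u).symm

end VExactCourant

end Model

/-! ### Calculus of exact Courant algebroids -/

section Calculus

variable {EM : Type*} [NormedAddCommGroup EM] [NormedSpace ℝ EM] [FiniteDimensional ℝ EM]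
  {M : Type*} [TopologicalSpace M] [ChartedSpace EM M] [IsManifold 𝓘(ℝ, EM) ∞ M] [T2Space M]
  {FE : Type*} [NormedAddCommGroup FE] [NormedSpace ℝ FE] [FiniteDimensional ℝ FE]
  {E : M → Type*} [TopologicalSpace (TotalSpace FE E)] [∀ x, TopologicalSpace (E x)]
  [∀ x, AddCommGroup (E x)] [∀ x, Module ℝ (E x)]
  [∀ x, IsTopologicalAddGroup (E x)] [∀ x, ContinuousSMul ℝ (E x)]
  [FiberBundle FE E] [VectorBundle ℝ FE E] [ContMDiffVectorBundle ∞ FE E 𝓘(ℝ, EM)]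
  {FV : Type*} [NormedAddCommGroup FV] [NormedSpace ℝ FV] [FiniteDimensional ℝ FV]
  {V : M → Type*} [TopologicalSpace (TotalSpace FV V)] [∀ x, TopologicalSpace (V x)]
  [∀ x, AddCommGroup (V x)] [∀ x, Module ℝ (V x)]
  [∀ x, IsTopologicalAddGroup (V x)] [∀ x, ContinuousSMul ℝ (V x)]
  [FiberBundle FV V] [VectorBundle ℝ FV V] [ContMDiffVectorBundle ∞ FV V 𝓘(ℝ, EM)]
  {FW : Type*} [NormedAddCommGroup FW] [NormedSpace ℝ FW] [FiniteDimensional ℝ FW]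
  {W : M → Type*} [TopologicalSpace (TotalSpace FW W)] [∀ x, TopologicalSpace (W x)]
  [∀ x, AddCommGroup (W x)] [∀ x, Module ℝ (W x)]
  [∀ x, IsTopologicalAddGroup (W x)] [∀ x, ContinuousSMul ℝ (W x)]
  [FiberBundle FW W] [VectorBundle ℝ FW W] [ContMDiffVectorBundle ∞ FW W 𝓘(ℝ, EM)]
theorem eq_of_forall_happ (hV : 0 < finrank ℝ FV) {X Y : Sec EM FE E}
    (h : ∀ a : HomSec EM FE E FV V, happ a X = happ a Y) : X = Y := by
  ext1 x
  rw [← sub_eq_zero]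
  refine eq_zero_of_forall_hom (V := V) hV FE fun a => ?_
  obtain ⟨a, rfl⟩ := exists_sec_apply_eq (EM := EM) (FE := FE →L[ℝ] FV)
    (E := fun x => E x →L[ℝ] V x) a
  rw [map_sub, sub_eq_zero]
  exact congrArg (fun s : Sec EM FV V => s x) (h a)

theorem fsmul_zero (f : C^∞⟮𝓘(ℝ, EM), M; ℝ⟯) : fsmul f (0 : Sec EM FV V) = 0 :=
  ContMDiffSection.ext fun x => smul_zero (A := V x) (f x)

theorem zero_fsmul (s : Sec EM FV V) : fsmul (0 : C^∞⟮𝓘(ℝ, EM), M; ℝ⟯) s = 0 :=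
  ContMDiffSection.ext fun x => zero_smul ℝ (s x)

theorem sub_fsmul (f g : C^∞⟮𝓘(ℝ, EM), M; ℝ⟯) (s : Sec EM FV V) :
    fsmul (f - g) s = fsmul f s - fsmul g s :=
  ContMDiffSection.ext fun x => sub_smul (f x) (g x) (s x)

namespace VExactCourant

variable (C : VExactCourant EM FE E FV V FW W)

/-- The product on sections. -/
def prod : Sec EM FW W →ₗ[ℝ] Sec EM FW W →ₗ[ℝ] Sec EM FV V := happ₂ₗ C.pairing

/-- The projection on sections. -/
def proj : Sec EM FW W →ₗ[ℝ] Sec EM FE E := happₗ C.pi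

/-- The map `π^*` on sections. -/
def star : HomSec EM FE E FV V →ₗ[ℝ] Sec EM FW W := happₗ C.piStar

theorem prod_symm (ψ φ : Sec EM FW W) : C.prod ψ φ = C.prod φ ψ :=
  ContMDiffSection.ext fun x => C.pairing_symm x _ _

theorem prod_fsmul_left (f : C^∞⟮𝓘(ℝ, EM), M; ℝ⟯) (ψ φ : Sec EM FW W) :
    C.prod (fsmul f ψ) φ = fsmul f (C.prod ψ φ) := by
  change happ (happ C.pairing (fsmul f ψ)) φ = _
  rw [happ_fsmul, fsmul_happ]
  rfl

theorem prod_fsmul_right (f : C^∞⟮𝓘(ℝ, EM), M; ℝ⟯) (ψ φ : Sec EM FW W) :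
    C.prod ψ (fsmul f φ) = fsmul f (C.prod ψ φ) := happ_fsmul _ _ _

theorem prod_star_left (a : HomSec EM FE E FV V) (ψ : Sec EM FW W) :
    C.prod (C.star a) ψ = happ a (C.proj ψ) :=
  ContMDiffSection.ext fun x => C.piStar_adjoint x _ _

theorem proj_star (a : HomSec EM FE E FV V) : C.proj (C.star a) = 0 :=
  ContMDiffSection.ext fun x => (C.exact x _).mpr ⟨a x, rfl⟩

theorem star_fsmul (f : C^∞⟮𝓘(ℝ, EM), M; ℝ⟯) (a : HomSec EM FE E FV V) :
    C.star (fsmul f a) = fsmul f (C.star a) := happ_fsmul _ _ _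

theorem proj_fsmul (f : C^∞⟮𝓘(ℝ, EM), M; ℝ⟯) (ψ : Sec EM FW W) :
    C.proj (fsmul f ψ) = fsmul f (C.proj ψ) := happ_fsmul _ _ _

theorem eq_of_prod_eq {ψ ψ' : Sec EM FW W} (h : ∀ φ, C.prod ψ φ = C.prod ψ' φ) : ψ = ψ' := by
  ext1 x
  rw [← sub_eq_zero]
  refine C.pairing_nondeg x _ fun w => ?_
  obtain ⟨φ, rfl⟩ := exists_sec_apply_eq (EM := EM) (FE := FW) w
  rw [map_sub, sub_apply, sub_eq_zero]
  exact congrArg (fun s : Sec EM FV V => s x) (h φ)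

/-- Polarization of the invariance axiom. -/
theorem conn_prod (ψ φ₁ φ₂ : Sec EM FW W) :
    C.conn ψ (C.prod φ₁ φ₂) = C.prod (C.bracket ψ φ₁) φ₂ + C.prod φ₁ (C.bracket ψ φ₂) := by
  have h : ∀ φ, C.prod (C.bracket ψ φ) φ = (1 / 2 : ℝ) • C.conn ψ (C.prod φ φ) := C.invariance ψ
  have h12 := h (φ₁ + φ₂)
  simp only [map_add, LinearMap.add_apply, h φ₁, h φ₂, C.prod_symm φ₂ φ₁] at h12
  rw [C.prod_symm φ₁ (C.bracket ψ φ₂)]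
  linear_combination (norm := module) -h12

/-- Polarization of the axiom on the symmetric part of the bracket. -/
theorem prod_bracket_add (ψ φ₁ φ₂ : Sec EM FW W) :
    C.prod ψ (C.bracket φ₁ φ₂) + C.prod ψ (C.bracket φ₂ φ₁) = C.conn ψ (C.prod φ₁ φ₂) := by
  have h : ∀ φ, C.prod ψ (C.bracket φ φ) = (1 / 2 : ℝ) • C.conn ψ (C.prod φ φ) :=
    C.symmetric_part ψ
  have h12 := h (φ₁ + φ₂)
  simp only [map_add, LinearMap.add_apply, h φ₁, h φ₂, C.prod_symm φ₂ φ₁] at h12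
  linear_combination (norm := module) h12

theorem conn_fsmul_right (ψ : Sec EM FW W) (f : C^∞⟮𝓘(ℝ, EM), M; ℝ⟯) (v : Sec EM FV V) :
    C.conn ψ (fsmul f v) = fsmul (anchorFun C.anchor ψ f) v + fsmul f (C.conn ψ v) :=
  ContMDiffSection.ext fun x => C.conn_leibniz ψ f v x

/-- The Leibniz rule is not among the axioms. It follows by pairing with an arbitrary section and
comparing the Leibniz rule of the connection with invariance. -/
theorem bracket_fsmul (ψ : Sec EM FW W) (f : C^∞⟮𝓘(ℝ, EM), M; ℝ⟯) (φ : Sec EM FW W) :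
    C.bracket ψ (fsmul f φ) = fsmul (anchorFun C.anchor ψ f) φ + fsmul f (C.bracket ψ φ) := by
  refine C.eq_of_prod_eq fun χ => ?_
  have h1 := C.conn_prod ψ (fsmul f φ) χ
  rw [C.prod_fsmul_left, C.prod_fsmul_left, C.conn_fsmul_right, C.conn_prod, fsmul_add] at h1
  rw [map_add, LinearMap.add_apply, C.prod_fsmul_left, C.prod_fsmul_left]
  linear_combination (norm := module) -h1

theorem anchor_star_fun (a : HomSec EM FE E FV V) (f : C^∞⟮𝓘(ℝ, EM), M; ℝ⟯) :
    anchorFun C.anchor (C.star a) f = 0 := by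
  obtain ⟨ρ, hρ⟩ := C.anchor_factors
  ext x
  have h : C.anchor x (C.star a x) = 0 := by
    rw [hρ, show C.pi x (C.star a x) = 0 from congrArg (fun s : Sec EM FE E => s x)
      (C.proj_star a), map_zero]
  change mvfderiv 𝓘(ℝ, EM) f x (C.anchor x (C.star a x)) = 0
  rw [h, map_zero]

/-- Adding the Loday identities for `φ₁, φ₂` and `φ₂, φ₁` shows that the symmetric part of the
bracket acts trivially from the left. -/
theorem bracket_sum_bracket (φ₁ φ₂ χ : Sec EM FW W) :
    C.bracket (C.bracket φ₁ φ₂ + C.bracket φ₂ φ₁) χ = 0 := by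
  rw [map_add, LinearMap.add_apply]
  linear_combination (norm := module) -C.loday φ₁ φ₂ χ - C.loday φ₂ φ₁ χ

/-- Over a zero fibre of `W` the products could not span the nonzero fibre of `V`. -/
theorem exists_ne_zero (C : VExactCourant EM FE E FV V FW W)
    (hV : 0 < finrank ℝ FV) (x : M) : ∃ w : W x, w ≠ 0 := by
  by_contra! h
  obtain ⟨v, hv⟩ := exists_ne_zero_fiber (V := V) hV x
  have h1 : v ∈ Submodule.span ℝ {v : V x | ∃ w w' : W x, C.pairing x w w' = v} := by
    rw [C.pairing_surj]; trivial
  refine hv ((Submodule.mem_bot ℝ).mp (Submodule.span_le.mpr ?_ h1))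
  rintro _ ⟨w, w', rfl⟩
  rw [h w, map_zero]
  rfl

theorem fun_eq_zero (C : VExactCourant EM FE E FV V FW W)
    (hV : 0 < finrank ℝ FV) {f : C^∞⟮𝓘(ℝ, EM), M; ℝ⟯}
    (h : ∀ χ : Sec EM FW W, fsmul f χ = 0) : f = 0 := by
  ext x
  obtain ⟨w, hw⟩ := C.exists_ne_zero hV x
  obtain ⟨χ, rfl⟩ := exists_sec_apply_eq (EM := EM) (FE := FW) w
  exact (smul_eq_zero.mp (congrArg (fun s : Sec EM FW W => s x) (h χ))).resolve_right hw

/-- The symmetric part of the bracket lies in the kernel of the anchor. -/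
theorem anchor_sum_bracket (hV : 0 < finrank ℝ FV) (φ₁ φ₂ : Sec EM FW W) (x : M) :
    C.anchor x ((C.bracket φ₁ φ₂ + C.bracket φ₂ φ₁) x) = 0 := by
  refine eq_zero_of_forall_mvfderiv fun f => ?_
  have h : anchorFun C.anchor (C.bracket φ₁ φ₂ + C.bracket φ₂ φ₁) f = 0 :=
    C.fun_eq_zero hV fun χ => by
      -- The symmetric part acts by zero from the left, so of the Leibniz rule only the term with
      -- the derivative of `f` survives.
      have h1 := C.bracket_fsmul (C.bracket φ₁ φ₂ + C.bracket φ₂ φ₁) f χ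
      rw [C.bracket_sum_bracket, C.bracket_sum_bracket, fsmul_zero, add_zero] at h1
      exact h1.symm
  exact congrArg (fun g : C^∞⟮𝓘(ℝ, EM), M; ℝ⟯ => g x) h

/-- The anchor is compatible with the brackets. -/
theorem anchorFun_bracket (hV : 0 < finrank ℝ FV) (ψ φ : Sec EM FW W)
    (f : C^∞⟮𝓘(ℝ, EM), M; ℝ⟯) :
    anchorFun C.anchor (C.bracket ψ φ) f
      = anchorFun C.anchor ψ (anchorFun C.anchor φ f)
        - anchorFun C.anchor φ (anchorFun C.anchor ψ f) := by
  rw [← sub_eq_zero]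
  refine C.fun_eq_zero hV fun χ => ?_
  -- Expanding by the Leibniz rule, the mixed first-order terms cancel, and the remaining
  -- coefficient of `χ` is the difference in question.
  have h := C.loday ψ φ (fsmul f χ)
  simp only [C.bracket_fsmul, map_add, C.loday ψ φ χ, fsmul_add] at h
  rw [sub_fsmul, sub_fsmul]
  linear_combination (norm := module) -h

/-- A tensorial operator on `Γ(V)` that vanishes on the values of the product is zero. -/
theorem eq_zero_of_prod {F : M → Type*} {FF : Type*} [NormedAddCommGroup FF] [NormedSpace ℝ FF]
    [FiniteDimensional ℝ FF]
    [TopologicalSpace (TotalSpace FF F)] [∀ x, TopologicalSpace (F x)]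
    [∀ x, AddCommGroup (F x)] [∀ x, Module ℝ (F x)]
    [∀ x, IsTopologicalAddGroup (F x)] [∀ x, ContinuousSMul ℝ (F x)]
    [FiberBundle FF F] [VectorBundle ℝ FF F] [ContMDiffVectorBundle ∞ FF F 𝓘(ℝ, EM)]
    {T : Sec EM FV V →ₗ[ℝ] Sec EM FF F}
    (hT : ∀ f v, T (fsmul f v) = fsmul f (T v)) (h : ∀ φ₁ φ₂, T (C.prod φ₁ φ₂) = 0) (v) :
    T v = 0 := by
  ext1 x
  rw [← happ_ofTensorial T hT v]
  set a := HomSec.ofTensorial T hT with ha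
  have h1 : v x ∈ Submodule.span ℝ {v : V x | ∃ w w' : W x, C.pairing x w w' = v} := by
    rw [C.pairing_surj]; trivial
  have h2 : Submodule.span ℝ {v : V x | ∃ w w' : W x, C.pairing x w w' = v}
      ≤ LinearMap.ker (a x : V x →ₗ[ℝ] F x) := by
    rw [Submodule.span_le]
    rintro _ ⟨w, w', rfl⟩
    obtain ⟨φ₁, rfl⟩ := exists_sec_apply_eq (EM := EM) (FE := FW) w
    obtain ⟨φ₂, rfl⟩ := exists_sec_apply_eq (EM := EM) (FE := FW) w'
    have := congrArg (fun s : Sec EM FF F => s x)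
      ((happ_ofTensorial T hT (C.prod φ₁ φ₂)).trans (h φ₁ φ₂))
    exact this
  exact h2 h1

/-- The `W`-connection on `V` is flat. -/
theorem conn_flat (hV : 0 < finrank ℝ FV) (ψ φ : Sec EM FW W) (v : Sec EM FV V) :
    C.conn ψ (C.conn φ v) - C.conn φ (C.conn ψ v) = C.conn (C.bracket ψ φ) v := by
  rw [← sub_eq_zero]
  -- The curvature is tensorial in `v` because the anchor respects brackets. On products it vanishes
  -- by invariance and the Loday identity.
  refine C.eq_zero_of_prod
    (T := C.conn ψ ∘ₗ C.conn φ - C.conn φ ∘ₗ C.conn ψ - C.conn (C.bracket ψ φ)) ?_ ?_ v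
  · intro f v
    simp only [LinearMap.sub_apply, LinearMap.comp_apply, C.conn_fsmul_right, map_add, fsmul_sub,
      C.anchorFun_bracket hV]
    rw [sub_fsmul]
    abel
  · intro φ₁ φ₂
    simp only [LinearMap.sub_apply, LinearMap.comp_apply, C.conn_prod, map_add,
      C.loday ψ φ φ₁, C.loday ψ φ φ₂, LinearMap.add_apply]
    abel

end VExactCourant

end Calculus

/-! ### Splittings of exact Courant algebroids -/

section Splittings

variable {EM : Type*} [NormedAddCommGroup EM] [NormedSpace ℝ EM] [FiniteDimensional ℝ EM]
  {M : Type*} [TopologicalSpace M] [ChartedSpace EM M] [IsManifold 𝓘(ℝ, EM) ∞ M] [T2Space M]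
  {FE : Type*} [NormedAddCommGroup FE] [NormedSpace ℝ FE] [FiniteDimensional ℝ FE]
  {E : M → Type*} [TopologicalSpace (TotalSpace FE E)] [∀ x, TopologicalSpace (E x)]
  [∀ x, AddCommGroup (E x)] [∀ x, Module ℝ (E x)]
  [∀ x, IsTopologicalAddGroup (E x)] [∀ x, ContinuousSMul ℝ (E x)]
  [FiberBundle FE E] [VectorBundle ℝ FE E] [ContMDiffVectorBundle ∞ FE E 𝓘(ℝ, EM)]
  {FV : Type*} [NormedAddCommGroup FV] [NormedSpace ℝ FV] [FiniteDimensional ℝ FV]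
  {V : M → Type*} [TopologicalSpace (TotalSpace FV V)] [∀ x, TopologicalSpace (V x)]
  [∀ x, AddCommGroup (V x)] [∀ x, Module ℝ (V x)]
  [∀ x, IsTopologicalAddGroup (V x)] [∀ x, ContinuousSMul ℝ (V x)]
  [FiberBundle FV V] [VectorBundle ℝ FV V] [ContMDiffVectorBundle ∞ FV V 𝓘(ℝ, EM)]
  {FW : Type*} [NormedAddCommGroup FW] [NormedSpace ℝ FW] [FiniteDimensional ℝ FW]
  {W : M → Type*} [TopologicalSpace (TotalSpace FW W)] [∀ x, TopologicalSpace (W x)]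
  [∀ x, AddCommGroup (W x)] [∀ x, Module ℝ (W x)]
  [∀ x, IsTopologicalAddGroup (W x)] [∀ x, ContinuousSMul ℝ (W x)]
  [FiberBundle FW W] [VectorBundle ℝ FW W] [ContMDiffVectorBundle ∞ FW W 𝓘(ℝ, EM)]
namespace VExactCourant

variable (C : VExactCourant EM FE E FV V FW W) (j : HomSec EM FE E FW W)

/-- The bundle map `X ↦ j(X) - π^*(B(X, ·))`. -/
def shift (B : BilinSec EM FE E FV V) : HomSec EM FE E FW W :=
  HomSec.ofSmooth (fun x => j x - (C.piStar x).comp (B x)) fun X =>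
    (happ j X - C.star (happ B X)).contMDiff

@[simp] theorem shift_apply (B : BilinSec EM FE E FV V) (x : M) (u : E x) :
    C.shift j B x u = j x u - C.piStar x (B x u) := rfl

theorem happ_shift (B : BilinSec EM FE E FV V) (X : Sec EM FE E) :
    happ (C.shift j B) X = happ j X - C.star (happ B X) := rfl

variable {j}

theorem pi_piStar (x : M) (a : E x →L[ℝ] V x) : C.pi x (C.piStar x a) = 0 :=
  (C.exact x _).mpr ⟨a, rfl⟩

theorem pairing_piStar (x : M) (a b : E x →L[ℝ] V x) :
    C.pairing x (C.piStar x a) (C.piStar x b) = 0 := by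
  rw [C.piStar_adjoint, pi_piStar, map_zero]

theorem pairing_shift (hj : ∀ (x : M) (u : E x), C.pi x (j x u) = u)
    (B : BilinSec EM FE E FV V) (x : M) (u w : E x) :
    C.pairing x (C.shift j B x u) (C.shift j B x w)
      = C.pairing x (j x u) (j x w) - B x u w - B x w u := by
  simp only [shift_apply, map_sub, sub_apply, pairing_piStar]
  rw [C.pairing_symm x (j x u) (C.piStar x _), C.piStar_adjoint, C.piStar_adjoint, hj, hj]
  abel

/-- Isotropic splittings exist. -/
theorem exists_isotropicSplitting [SigmaCompactSpace M] : ∃ j, C.IsIsotropicSplitting j := by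
  obtain ⟨j, hj⟩ := exists_rightInverse C.pi C.pi_surjective
  -- A shift by `B` changes `⟨j u, j w⟩` by `-B(u, w) - B(w, u)`, so half of the pulled-back product
  -- makes the splitting isotropic.
  obtain ⟨B, hB⟩ := exists_bilinSec
    ((1 / 2 : ℝ) • C.prod.compl₁₂ (happₗ j) (happₗ j))
    (fun f X Y => by
      simp only [LinearMap.smul_apply, LinearMap.compl₁₂_apply, happₗ_apply, happ_fsmul,
        C.prod_fsmul_left, fsmul_smul])
    (fun f X Y => by
      simp only [LinearMap.smul_apply, LinearMap.compl₁₂_apply, happₗ_apply, happ_fsmul,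
        C.prod_fsmul_right, fsmul_smul])
  have hB' : ∀ x u w, B x u w = (1 / 2 : ℝ) • C.pairing x (j x u) (j x w) := by
    intro x u w
    obtain ⟨X, rfl⟩ := exists_sec_apply_eq (EM := EM) (FE := FE) u
    obtain ⟨Y, rfl⟩ := exists_sec_apply_eq (EM := EM) (FE := FE) w
    exact congrArg (fun s : Sec EM FV V => s x) (hB X Y)
  refine ⟨C.shift j B, fun x u => ?_, fun x u w => ?_⟩
  · rw [shift_apply, map_sub, hj, pi_piStar, sub_zero]
  · rw [pairing_shift C hj, hB', hB', C.pairing_symm x (j x w)]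
    module

theorem IsIsotropicSplitting.proj {C : VExactCourant EM FE E FV V FW W}
    (hj : C.IsIsotropicSplitting j) (X : Sec EM FE E) : C.proj (happ j X) = X :=
  ContMDiffSection.ext fun x => hj.1 x _

theorem IsIsotropicSplitting.prod {C : VExactCourant EM FE E FV V FW W}
    (hj : C.IsIsotropicSplitting j) (X Y : Sec EM FE E) : C.prod (happ j X) (happ j Y) = 0 :=
  ContMDiffSection.ext fun x => hj.2 x _ _

/-- The difference `w - j (π w)` lies in the image of `π^*` by exactness. Isotropy of `j` lets the
form component be recovered by pairing with `j`. -/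
theorem IsIsotropicSplitting.exists_eq {C : VExactCourant EM FE E FV V FW W}
    (hj : C.IsIsotropicSplitting j) (x : M) (w : W x) :
    ∃ a : E x →L[ℝ] V x, w = j x (C.pi x w) + C.piStar x a ∧
      ∀ u, a u = C.pairing x w (j x u) := by
  obtain ⟨a, ha⟩ := (C.exact x (w - j x (C.pi x w))).mp (by rw [map_sub, hj.1, sub_self])
  refine ⟨a, by rw [ha, add_sub_cancel], fun u => ?_⟩
  rw [← hj.1 x u, ← C.piStar_adjoint, ha, map_sub, sub_apply, hj.1, hj.2, sub_zero]

variable (j) in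
/-- The `Hom(E, V)`-component of a section. -/
def coord (ψ : Sec EM FW W) : HomSec EM FE E FV V :=
  HomSec.ofTensorial (C.prod ψ ∘ₗ happₗ j) fun f X => by
    simp only [LinearMap.comp_apply, happₗ_apply, happ_fsmul, C.prod_fsmul_right]

@[simp] theorem happ_coord (ψ : Sec EM FW W) (X : Sec EM FE E) :
    happ (C.coord j ψ) X = C.prod ψ (happ j X) := happ_ofTensorial _ _ _

theorem IsIsotropicSplitting.decomp {C : VExactCourant EM FE E FV V FW W}
    (hj : C.IsIsotropicSplitting j) (ψ : Sec EM FW W) :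
    ψ = happ j (C.proj ψ) + C.star (C.coord j ψ) := by
  ext1 x
  obtain ⟨a, ha, ha'⟩ := hj.exists_eq x (ψ x)
  have h : a = C.coord j ψ x := by
    ext u
    obtain ⟨X, rfl⟩ := exists_sec_apply_eq (EM := EM) (FE := FE) u
    rw [ha']
    exact congrArg (fun s : Sec EM FV V => s x) (C.happ_coord ψ X).symm
  rw [h] at ha
  exact ha

/-- If `c (A b) = -b (A c)` for all bundle maps `b` and `c` and `V` has rank at least two, then
`A = 0`. -/
theorem eq_zero_of_forall_apply_eq_neg {x : M} (hV : 1 < finrank ℝ FV) (FE : Type*) [NormedAddCommGroup FE]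
    [NormedSpace ℝ FE] [FiniteDimensional ℝ FE] {E : M → Type*} [TopologicalSpace (TotalSpace FE E)]
    [∀ x, TopologicalSpace (E x)] [∀ x, AddCommGroup (E x)] [∀ x, Module ℝ (E x)]
    [∀ x, IsTopologicalAddGroup (E x)] [∀ x, ContinuousSMul ℝ (E x)]
    [FiberBundle FE E] [VectorBundle ℝ FE E] (A : (E x →L[ℝ] V x) → E x)
    (h : ∀ b c : E x →L[ℝ] V x, c (A b) = -b (A c)) (b) : A b = 0 := by
  have hspan : ∀ v : V x, ∃ w : V x, w ∉ Submodule.span ℝ {v} := by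
    intro v
    by_contra! hv
    have := finrank_le_one v fun w => Submodule.mem_span_singleton.mp (hv w)
    rw [finrank_fiber FV V x] at this
    omega
  -- If the values of `b` lie in a line and `A b ≠ 0`, choose `c` with `c (A b)` outside that line;
  -- but `c (A b) = -b (A c)` lies in it.
  have h1 : ∀ (v : V x) (b : E x →L[ℝ] V x), (∀ u, b u ∈ Submodule.span ℝ {v}) → A b = 0 := by
    intro v b hb
    by_contra hA
    obtain ⟨w, hw⟩ := hspan v
    obtain ⟨c, hc, -⟩ := exists_hom_apply_eq FE hA w
    refine hw ?_
    rw [← hc, h]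
    exact Submodule.neg_mem _ (hb _)
  -- For general `b`, take `c` of rank one with `c (A b) ≠ 0`; the previous case gives `A c = 0`,
  -- hence `c (A b) = -b (A c) = 0`.
  by_contra hA
  obtain ⟨v, hv⟩ := exists_ne_zero_fiber (V := V) (zero_lt_one.trans hV) x
  obtain ⟨c, hc, hc'⟩ := exists_hom_apply_eq FE hA v
  refine hv ?_
  rw [← hc, h, h1 v c hc', map_zero, neg_zero]

/-- The bracket with a section of `Hom(E, V)` from the right lies in `Hom(E, V)`. -/
theorem proj_bracket_star (hV : 1 < finrank ℝ FV) (ψ : Sec EM FW W) (b : HomSec EM FE E FV V) :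
    C.proj (C.bracket ψ (C.star b)) = 0 := by
  have hT : ∀ f (b : HomSec EM FE E FV V), (C.proj ∘ₗ C.bracket ψ ∘ₗ C.star) (fsmul f b)
      = fsmul f ((C.proj ∘ₗ C.bracket ψ ∘ₗ C.star) b) := by
    intro f b
    simp only [LinearMap.comp_apply, C.star_fsmul, C.bracket_fsmul, map_add, C.proj_fsmul,
      C.proj_star, fsmul_zero, zero_add]
  have hA := happ_ofTensorial _ hT
  set A := HomSec.ofTensorial _ hT
  -- The image of `π^*` is isotropic, so invariance for `π^* b` and `π^* c` has zero on the side of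
  -- the connection.
  have key : ∀ b c : HomSec EM FE E FV V, happ c (happ A b) = -happ b (happ A c) := by
    intro b c
    have h := C.conn_prod ψ (C.star b) (C.star c)
    rw [C.prod_star_left, C.proj_star, happ_zero, map_zero, C.prod_symm, C.prod_star_left,
      C.prod_star_left] at h
    rw [hA, hA]
    exact eq_neg_of_add_eq_zero_left h.symm
  ext1 x
  refine (congrArg (fun s : Sec EM FE E => s x) (hA b)).symm.trans ?_
  refine eq_zero_of_forall_apply_eq_neg (V := V) hV FE (fun a => A x a) (fun b c => ?_) (b x)
  obtain ⟨b, rfl⟩ := exists_sec_apply_eq (EM := EM) (FE := FE →L[ℝ] FV)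
    (E := fun x => E x →L[ℝ] V x) b
  obtain ⟨c, rfl⟩ := exists_sec_apply_eq (EM := EM) (FE := FE →L[ℝ] FV)
    (E := fun x => E x →L[ℝ] V x) c
  exact congrArg (fun s : Sec EM FV V => s x) (key b c)

end VExactCourant

end Splittings

/-! ### The map `t` of an exact Courant algebroid -/

section MapT

variable {EM : Type*} [NormedAddCommGroup EM] [NormedSpace ℝ EM] [FiniteDimensional ℝ EM]
  {M : Type*} [TopologicalSpace M] [ChartedSpace EM M] [IsManifold 𝓘(ℝ, EM) ∞ M] [T2Space M]
  {FE : Type*} [NormedAddCommGroup FE] [NormedSpace ℝ FE] [FiniteDimensional ℝ FE]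
  {E : M → Type*} [TopologicalSpace (TotalSpace FE E)] [∀ x, TopologicalSpace (E x)]
  [∀ x, AddCommGroup (E x)] [∀ x, Module ℝ (E x)]
  [∀ x, IsTopologicalAddGroup (E x)] [∀ x, ContinuousSMul ℝ (E x)]
  [FiberBundle FE E] [VectorBundle ℝ FE E] [ContMDiffVectorBundle ∞ FE E 𝓘(ℝ, EM)]
  {FV : Type*} [NormedAddCommGroup FV] [NormedSpace ℝ FV] [FiniteDimensional ℝ FV]
  {V : M → Type*} [TopologicalSpace (TotalSpace FV V)] [∀ x, TopologicalSpace (V x)]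
  [∀ x, AddCommGroup (V x)] [∀ x, Module ℝ (V x)]
  [∀ x, IsTopologicalAddGroup (V x)] [∀ x, ContinuousSMul ℝ (V x)]
  [FiberBundle FV V] [VectorBundle ℝ FV V] [ContMDiffVectorBundle ∞ FV V 𝓘(ℝ, EM)]
  {FW : Type*} [NormedAddCommGroup FW] [NormedSpace ℝ FW] [FiniteDimensional ℝ FW]
  {W : M → Type*} [TopologicalSpace (TotalSpace FW W)] [∀ x, TopologicalSpace (W x)]
  [∀ x, AddCommGroup (W x)] [∀ x, Module ℝ (W x)]
  [∀ x, IsTopologicalAddGroup (W x)] [∀ x, ContinuousSMul ℝ (W x)]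
  [FiberBundle FW W] [VectorBundle ℝ FW W] [ContMDiffVectorBundle ∞ FW W 𝓘(ℝ, EM)]
namespace VExactCourant

variable {C : VExactCourant EM FE E FV V FW W} {j : HomSec EM FE E FW W}

/-- If `E x = 0`, then `Hom(E x, V x) = 0`, and exactness makes the fibre of `W` vanish too. -/
theorem exists_ne_zero_base (C : VExactCourant EM FE E FV V FW W) (hV : 0 < finrank ℝ FV) (x : M) :
    ∃ u : E x, u ≠ 0 := by
  by_contra! h
  obtain ⟨w, hw⟩ := C.exists_ne_zero hV x
  obtain ⟨a, rfl⟩ := (C.exact x w).mp (h _)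
  refine hw ?_
  have ha : a = 0 := ContinuousLinearMap.ext fun u => by rw [h u, map_zero, map_zero]
  rw [ha, map_zero]

theorem conn_star_fsmul (C : VExactCourant EM FE E FV V FW W) (a : HomSec EM FE E FV V)
    (f : C^∞⟮𝓘(ℝ, EM), M; ℝ⟯) (v : Sec EM FV V) :
    C.conn (C.star a) (fsmul f v) = fsmul f (C.conn (C.star a) v) := by
  rw [C.conn_fsmul_right, C.anchor_star_fun, zero_fsmul, zero_add]

-- The symmetric-part axiom computes `∇_{π^* a}` on products as evaluation of `a` on a section of
-- `E`. It remains to write sections of `V` near `x₀` as products, linearly in the section: `S v` is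
-- such a product, and `S` is the identity at `x₀`.
set_option synthInstance.maxHeartbeats 400000 in
theorem IsIsotropicSplitting.exists_local_t (hj : C.IsIsotropicSplitting j)
    (hV : 0 < finrank ℝ FV) (x₀ : M) :
    ∃ (R : HomSec EM FV V FE E) (S : HomSec EM FV V FV V),
      S x₀ = ContinuousLinearMap.id ℝ (V x₀) ∧
      ∀ (a : HomSec EM FE E FV V) (v : Sec EM FV V),
        C.conn (C.star a) (happ S v) = -happ a (happ R v) := by
  obtain ⟨u₀, hu⟩ := C.exists_ne_zero_base hV x₀
  -- `η` takes values in `Hom(E, End V)` with `η(X₀)` the identity at `x₀`. With `A v = η(·) v`, the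
  -- section `η(X₀) v` is the product of `π^* (A v)` and `j X₀`.
  obtain ⟨η₀, hη₀, -⟩ := exists_hom_apply_eq (V := fun x => V x →L[ℝ] V x) FE hu
    (ContinuousLinearMap.id ℝ (V x₀))
  obtain ⟨X₀, rfl⟩ := exists_sec_apply_eq (EM := EM) (FE := FE) u₀
  obtain ⟨η, rfl⟩ := exists_sec_apply_eq (EM := EM) (FE := FE →L[ℝ] FV →L[ℝ] FV)
    (E := fun x => E x →L[ℝ] V x →L[ℝ] V x) η₀
  have hA₀ : ∀ v : Sec EM FV V, ∃ a : HomSec EM FE E FV V, ∀ X, happ a X = happ (happ η X) v :=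
    fun v => exists_homSec_of_fsmul
      { toFun := fun X => happ (happ η X) v
        map_add' := fun X Y => by rw [happ_add, add_happ]
        map_smul' := fun r X => by rw [happ_smul, smul_happ]; rfl }
      fun f X => by
        change happ (happ η (fsmul f X)) v = _
        rw [happ_fsmul, fsmul_happ]
        rfl
  choose A₀ hA₀ using hA₀
  let A : Sec EM FV V →ₗ[ℝ] HomSec EM FE E FV V :=
    { toFun := A₀
      map_add' := fun v w => ext_of_sec fun X => by rw [add_happ, hA₀, hA₀, hA₀, happ_add]
      map_smul' := fun r v => ext_of_sec fun X => by
        rw [RingHom.id_apply, smul_happ, hA₀, hA₀, happ_smul] }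
  have hA : ∀ v X, happ (A v) X = happ (happ η X) v := hA₀
  let T : Sec EM FV V →ₗ[ℝ] Sec EM FE E :=
    -(C.proj ∘ₗ (C.bracket.flip (happ j X₀) + C.bracket (happ j X₀)) ∘ₗ C.star ∘ₗ A)
  have hT : ∀ v, T v = -(C.proj (C.bracket (C.star (A v)) (happ j X₀))
      + C.proj (C.bracket (happ j X₀) (C.star (A v)))) := fun v => by
    rw [← map_add]; rfl
  have key : ∀ a v, C.conn (C.star a) (happ (happ η X₀) v) = -happ a (T v) := by
    intro a v
    have h := C.prod_bracket_add (C.star a) (C.star (A v)) (happ j X₀)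
    rw [C.prod_star_left, C.prod_star_left, C.prod_star_left, hj.proj, hA] at h
    rw [hT, happ_neg, happ_add, neg_neg, h]
  -- Tensoriality is not visible from the brackets defining `T`; it is inherited through `key` from
  -- the connection along `π^* a`, where the anchor vanishes.
  have hTf : ∀ f v, T (fsmul f v) = fsmul f (T v) := fun f v =>
    eq_of_forall_happ (FV := FV) (V := V) hV fun a => by
      rw [← neg_inj, ← key, happ_fsmul, C.conn_star_fsmul, key, happ_fsmul, fsmul_neg]
  exact ⟨HomSec.ofTensorial T hTf, happ η X₀, hη₀, fun a v => by rw [key, happ_ofTensorial]⟩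

/-- At each point `t` is the local operator centred there. Around `x₀` the local data satisfy `t ∘ S
= R`, and `S` is invertible near `x₀`, so `t = R ∘ S⁻¹` is smooth. -/
theorem IsIsotropicSplitting.exists_t (hj : C.IsIsotropicSplitting j) (hV : 0 < finrank ℝ FV) :
    ∃ t : HomSec EM FV V FE E, ∀ (a : HomSec EM FE E FV V) (v : Sec EM FV V),
      C.conn (C.star a) v = -happ a (happ t v) := by
  choose R S hS hRS using hj.exists_local_t hV
  have h1 : ∀ (x : M) (a : HomSec EM FE E FV V) (v : Sec EM FV V),
      C.conn (C.star a) v x = -a x (R x x (v x)) := by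
    intro x a v
    rw [apply_eq_of_fsmul (T := C.conn (C.star a)) (fun v w => map_add _ v w)
      (C.conn_star_fsmul a) (show v x = happ (S x) v x by rw [happ_eval, hS]; rfl), hRS]
    rfl
  have h2 : ∀ (x₀ x : M) (v : V x), R x x (S x₀ x v) = R x₀ x v := by
    intro x₀ x v
    obtain ⟨v, rfl⟩ := exists_sec_apply_eq (EM := EM) (FE := FV) v
    rw [← sub_eq_zero]
    refine eq_zero_of_forall_hom (V := V) hV FE fun a => ?_
    obtain ⟨a, rfl⟩ := exists_sec_apply_eq (EM := EM) (FE := FE →L[ℝ] FV)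
      (E := fun x => E x →L[ℝ] V x) a
    have h := h1 x a (happ (S x₀) v)
    rw [hRS] at h
    rw [map_sub, sub_eq_zero]
    exact neg_injective h.symm
  refine ⟨HomSec.ofSmooth (fun x => R x x) fun v x₀ => ?_, fun a v =>
    ContMDiffSection.ext fun x => h1 x a v⟩
  have hinv := eventually_isInvertible_contMDiffAt_inverse (S x₀) (x₀ := x₀)
    (by rw [hS]; exact ⟨ContinuousLinearEquiv.refl ℝ _, rfl⟩)
  have h3 : ContMDiffAt 𝓘(ℝ, EM) (𝓘(ℝ, EM).prod 𝓘(ℝ, FE)) ∞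
      (fun x => TotalSpace.mk' FE x (R x₀ x ((S x₀ x).inverse (v x)))) x₀ :=
    ContMDiffAt.clm_bundle_apply (R x₀).contMDiff.contMDiffAt
      (ContMDiffAt.clm_bundle_apply hinv.self_of_nhds.2 v.contMDiff.contMDiffAt)
  refine h3.congr_of_eventuallyEq (hinv.mono fun x hx => ?_)
  obtain ⟨e, he⟩ := hx.1
  dsimp only
  rw [← h2 x₀ x, ← he, ContinuousLinearMap.inverse_equiv]
  exact congrArg (fun w => TotalSpace.mk' FE x (R x x w)) (e.apply_symm_apply (v x)).symm

end VExactCourant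

end MapT

/-! ### The Lie 2-algebroid of an isotropic splitting -/

section Induced

variable {EM : Type*} [NormedAddCommGroup EM] [NormedSpace ℝ EM] [FiniteDimensional ℝ EM]
  {M : Type*} [TopologicalSpace M] [ChartedSpace EM M] [IsManifold 𝓘(ℝ, EM) ∞ M] [T2Space M]
  {FE : Type*} [NormedAddCommGroup FE] [NormedSpace ℝ FE] [FiniteDimensional ℝ FE]
  {E : M → Type*} [TopologicalSpace (TotalSpace FE E)] [∀ x, TopologicalSpace (E x)]
  [∀ x, AddCommGroup (E x)] [∀ x, Module ℝ (E x)]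
  [∀ x, IsTopologicalAddGroup (E x)] [∀ x, ContinuousSMul ℝ (E x)]
  [FiberBundle FE E] [VectorBundle ℝ FE E] [ContMDiffVectorBundle ∞ FE E 𝓘(ℝ, EM)]
  {FV : Type*} [NormedAddCommGroup FV] [NormedSpace ℝ FV] [FiniteDimensional ℝ FV]
  {V : M → Type*} [TopologicalSpace (TotalSpace FV V)] [∀ x, TopologicalSpace (V x)]
  [∀ x, AddCommGroup (V x)] [∀ x, Module ℝ (V x)]
  [∀ x, IsTopologicalAddGroup (V x)] [∀ x, ContinuousSMul ℝ (V x)]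
  [FiberBundle FV V] [VectorBundle ℝ FV V] [ContMDiffVectorBundle ∞ FV V 𝓘(ℝ, EM)]
  {FW : Type*} [NormedAddCommGroup FW] [NormedSpace ℝ FW] [FiniteDimensional ℝ FW]
  {W : M → Type*} [TopologicalSpace (TotalSpace FW W)] [∀ x, TopologicalSpace (W x)]
  [∀ x, AddCommGroup (W x)] [∀ x, Module ℝ (W x)]
  [∀ x, IsTopologicalAddGroup (W x)] [∀ x, ContinuousSMul ℝ (W x)]
  [FiberBundle FW W] [VectorBundle ℝ FW W] [ContMDiffVectorBundle ∞ FW W 𝓘(ℝ, EM)]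
namespace VExactCourant

/-- `L` consists of the operations that the splitting `j` of `C` induces on `E` and `V`. -/
structure IsInduced (C : VExactCourant EM FE E FV V FW W) (j : HomSec EM FE E FW W)
    (L : Lie2Data EM FE E FV V) : Prop where
  anchor_eq : ∀ (x : M) (u : E x), C.anchor x (j x u) = L.anchor x u
  t_eq : ∀ (a : HomSec EM FE E FV V) v, C.conn (C.star a) v = -happ a (happ L.t v)
  bracket_eq : ∀ X Y, C.proj (C.bracket (happ j X) (happ j Y)) = L.bracket X Y
  conn_eq : ∀ X v, C.conn (happ j X) v = L.conn X v
  H_eq : ∀ X Y Z, C.prod (C.bracket (happ j X) (happ j Y)) (happ j Z) = happ₃ L.H Y X Z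

variable {C : VExactCourant EM FE E FV V FW W} {j : HomSec EM FE E FW W}
  {L : Lie2Data EM FE E FV V}

namespace IsInduced

theorem anchorFun_eq (h : C.IsInduced j L) (X : Sec EM FE E) (f : C^∞⟮𝓘(ℝ, EM), M; ℝ⟯) :
    anchorFun C.anchor (happ j X) f = anchorFun L.anchor X f := by
  ext x
  exact congrArg (mvfderiv 𝓘(ℝ, EM) f x) (h.anchor_eq x (X x))

/-- Obtained by testing against all `a` in the symmetric-part axiom along `π^* a`. It turns
identities for `t` on products into identities for the bracket. -/
theorem t_prod (h : C.IsInduced j L) (hV : 0 < finrank ℝ FV) (φ₁ φ₂ : Sec EM FW W) :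
    happ L.t (C.prod φ₁ φ₂) = -C.proj (C.bracket φ₁ φ₂ + C.bracket φ₂ φ₁) :=
  eq_of_forall_happ (FV := FV) (V := V) hV fun a => by
    have e := C.prod_bracket_add (C.star a) φ₁ φ₂
    rw [h.t_eq, C.prod_star_left, C.prod_star_left] at e
    rw [map_add, happ_neg, happ_add, e, neg_neg]

theorem proj_star_bracket (h : C.IsInduced j L) (hV : 1 < finrank ℝ FV) (a : HomSec EM FE E FV V)
    (ψ : Sec EM FW W) :
    C.proj (C.bracket (C.star a) ψ) = -happ L.t (happ a (C.proj ψ)) := by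
  have e := h.t_prod (zero_lt_one.trans hV) (C.star a) ψ
  rw [C.prod_star_left, map_add, C.proj_bracket_star hV, add_zero] at e
  rw [e, neg_neg]

theorem conn_add (h : C.IsInduced j L) (X : Sec EM FE E) (a : HomSec EM FE E FV V)
    (v : Sec EM FV V) :
    C.conn (happ j X + C.star a) v = L.conn X v - happ a (happ L.t v) := by
  rw [map_add, LinearMap.add_apply, h.conn_eq, h.t_eq, sub_eq_add_neg]

theorem proj_bracket (h : C.IsInduced j L) (hj : C.IsIsotropicSplitting j) (hV : 1 < finrank ℝ FV)
    (X : Sec EM FE E) (a : HomSec EM FE E FV V) (Y : Sec EM FE E) (b : HomSec EM FE E FV V) :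
    C.proj (C.bracket (happ j X + C.star a) (happ j Y + C.star b))
      = L.bracket X Y - happ L.t (happ a Y) := by
  simp only [map_add, LinearMap.add_apply, C.proj_bracket_star hV, h.bracket_eq,
    h.proj_star_bracket hV, hj.proj]
  abel

/-- This lemma and the next two determine the form components of the mixed and pure-form blocks of
the bracket: from invariance when the form stands on the right, and from the symmetric part when
only the left argument is a form. -/
theorem prod_bracket_star (h : C.IsInduced j L) (hj : C.IsIsotropicSplitting j)
    (X : Sec EM FE E) (b : HomSec EM FE E FV V) (Z : Sec EM FE E) :
    C.prod (C.bracket (happ j X) (C.star b)) (happ j Z)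
      = L.conn X (happ b Z) - happ b (L.bracket X Z) := by
  have e := C.conn_prod (happ j X) (C.star b) (happ j Z)
  rw [C.prod_star_left, C.prod_star_left, hj.proj, h.bracket_eq, h.conn_eq] at e
  rw [e, add_sub_cancel_right]

theorem prod_star_bracket (h : C.IsInduced j L) (hj : C.IsIsotropicSplitting j)
    (a : HomSec EM FE E FV V) (Y Z : Sec EM FE E) :
    C.prod (C.bracket (C.star a) (happ j Y)) (happ j Z)
      = L.conn Z (happ a Y) - L.conn Y (happ a Z) + happ a (L.bracket Y Z) := by
  have e := C.prod_bracket_add (happ j Z) (C.star a) (happ j Y)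
  rw [C.prod_symm, C.prod_symm _ (C.bracket (happ j Y) _), h.prod_bracket_star hj,
    C.prod_star_left, hj.proj, h.conn_eq] at e
  linear_combination (norm := module) e

theorem prod_star_bracket_star (h : C.IsInduced j L) (hj : C.IsIsotropicSplitting j)
    (hV : 1 < finrank ℝ FV) (a b : HomSec EM FE E FV V) (Z : Sec EM FE E) :
    C.prod (C.bracket (C.star a) (C.star b)) (happ j Z)
      = happ b (happ L.t (happ a Z)) - happ a (happ L.t (happ b Z)) := by
  have e := C.conn_prod (C.star a) (C.star b) (happ j Z)
  rw [C.prod_star_left, C.prod_star_left, hj.proj, h.t_eq, h.proj_star_bracket hV, hj.proj,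
    happ_neg] at e
  linear_combination (norm := module) -e

theorem prod_bracket (h : C.IsInduced j L) (hj : C.IsIsotropicSplitting j) (hV : 1 < finrank ℝ FV)
    (X : Sec EM FE E) (a : HomSec EM FE E FV V) (Y : Sec EM FE E) (b : HomSec EM FE E FV V)
    (Z : Sec EM FE E) :
    C.prod (C.bracket (happ j X + C.star a) (happ j Y + C.star b)) (happ j Z)
      = L.formPart X a Y b Z := by
  rw [Lie2Data.formPart_eq]
  simp only [map_add, LinearMap.add_apply, h.H_eq, h.prod_bracket_star hj, h.prod_star_bracket hj,
    h.prod_star_bracket_star hj hV]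
  abel

theorem bracket_eq_add (h : C.IsInduced j L) (hj : C.IsIsotropicSplitting j) (X Y : Sec EM FE E) :
    C.bracket (happ j X) (happ j Y)
      = happ j (L.bracket X Y) + C.star (C.coord j (C.bracket (happ j X) (happ j Y))) := by
  nth_rewrite 1 [hj.decomp (C.bracket (happ j X) (happ j Y))]
  rw [h.bracket_eq]

theorem happ_coord_bracket (h : C.IsInduced j L) (X Y Z : Sec EM FE E) :
    happ (C.coord j (C.bracket (happ j X) (happ j Y))) Z = -happ₃ L.H X Y Z := by
  rw [happ_coord, h.H_eq, happ₃_swap₁]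

/-- On products `t` is minus the projected symmetric part of the bracket, which the anchor kills. -/
theorem anchor_t (h : C.IsInduced j L) (hj : C.IsIsotropicSplitting j) (hV : 0 < finrank ℝ FV)
    (x : M) (v : V x) : L.anchor x (L.t x v) = 0 := by
  obtain ⟨v, rfl⟩ := exists_sec_apply_eq (EM := EM) (FE := FV) v
  have e := C.eq_zero_of_prod (T := happₗ L.anchor ∘ₗ happₗ L.t)
    (fun f v => by simp only [LinearMap.comp_apply, happₗ_apply, happ_fsmul])
    (fun φ₁ φ₂ => by
      obtain ⟨ρ, hρ⟩ := C.anchor_factors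
      ext1 x
      have e1 := C.anchor_sum_bracket hV φ₁ φ₂ x
      rw [hρ] at e1
      rw [LinearMap.comp_apply, happₗ_apply, happₗ_apply, h.t_prod hV, happ_neg]
      change -L.anchor x (C.pi x _) = 0
      rw [← h.anchor_eq, hρ, hj.1, e1, neg_zero]) v
  exact congrArg (fun s : Sec EM EM (fun x : M => TangentSpace 𝓘(ℝ, EM) x) => s x) e

theorem anchorFun_t (h : C.IsInduced j L) (hj : C.IsIsotropicSplitting j) (hV : 0 < finrank ℝ FV)
    (v : Sec EM FV V) (f : C^∞⟮𝓘(ℝ, EM), M; ℝ⟯) : anchorFun L.anchor (happ L.t v) f = 0 := by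
  ext x
  change mvfderiv 𝓘(ℝ, EM) f x (L.anchor x (L.t x (v x))) = 0
  rw [h.anchor_t hj hV, map_zero]

theorem bracket_fsmul (h : C.IsInduced j L) (hj : C.IsIsotropicSplitting j) (X : Sec EM FE E)
    (f : C^∞⟮𝓘(ℝ, EM), M; ℝ⟯) (Y : Sec EM FE E) :
    L.bracket X (fsmul f Y) = fsmul (anchorFun L.anchor X f) Y + fsmul f (L.bracket X Y) := by
  rw [← h.bracket_eq, ← h.bracket_eq, happ_fsmul, C.bracket_fsmul, map_add, C.proj_fsmul,
    C.proj_fsmul, hj.proj, h.anchorFun_eq]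

theorem conn_fsmul_right (h : C.IsInduced j L) (X : Sec EM FE E)
    (f : C^∞⟮𝓘(ℝ, EM), M; ℝ⟯) (v : Sec EM FV V) :
    L.conn X (fsmul f v) = fsmul (anchorFun L.anchor X f) v + fsmul f (L.conn X v) := by
  rw [← h.conn_eq, ← h.conn_eq, C.conn_fsmul_right, h.anchorFun_eq]

theorem conn_fsmul (h : C.IsInduced j L) (X : Sec EM FE E)
    (f : C^∞⟮𝓘(ℝ, EM), M; ℝ⟯) (v : Sec EM FV V) :
    L.conn (fsmul f X) v = fsmul f (L.conn X v) := by
  rw [← h.conn_eq, ← h.conn_eq, happ_fsmul, C.conn_fsmul]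

theorem bracket_skew (h : C.IsInduced j L) (hj : C.IsIsotropicSplitting j) (hV : 0 < finrank ℝ FV)
    (X Y : Sec EM FE E) : L.bracket X Y = -L.bracket Y X := by
  have e := h.t_prod hV (happ j X) (happ j Y)
  rw [hj.prod, happ_zero, map_add, h.bracket_eq, h.bracket_eq] at e
  linear_combination (norm := module) e

/-- The `E`-component of the Loday identity on `j X, j Y, j Z`. The form part `-H(X, Y, ·)` of `[j
X, j Y]` acts from the left and contributes `t H`, whereas forms on the right contribute nothing. -/
theorem jacobi (h : C.IsInduced j L) (hj : C.IsIsotropicSplitting j) (hV : 1 < finrank ℝ FV)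
    (X Y Z : Sec EM FE E) :
    L.bracket X (L.bracket Y Z) + L.bracket Y (L.bracket Z X) + L.bracket Z (L.bracket X Y)
      = happ L.t (happ₃ L.H X Y Z) := by
  have h1 : ∀ X Y Z, C.proj (C.bracket (happ j X) (C.bracket (happ j Y) (happ j Z)))
      = L.bracket X (L.bracket Y Z) := fun X Y Z => by
    rw [h.bracket_eq_add hj Y Z, map_add, map_add, C.proj_bracket_star hV, h.bracket_eq, add_zero]
  have h2 : C.proj (C.bracket (C.bracket (happ j X) (happ j Y)) (happ j Z))
      = L.bracket (L.bracket X Y) Z + happ L.t (happ₃ L.H X Y Z) := by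
    rw [h.bracket_eq_add hj X Y, map_add, LinearMap.add_apply, map_add, h.bracket_eq,
      h.proj_star_bracket hV, hj.proj, h.happ_coord_bracket, happ_neg, neg_neg]
  have e := congrArg C.proj (C.loday (happ j X) (happ j Y) (happ j Z))
  have hs := h.bracket_skew hj (zero_lt_one.trans hV)
  rw [map_add, h1, h1, h2, hs (L.bracket X Y) Z] at e
  rw [hs Z X, map_neg]
  linear_combination (norm := module) e

/-- Flatness of the `W`-connection: the failure of `j` to preserve brackets is the form `-H(X, Y,
·)`, along which the connection is algebraic. -/
theorem curvature (h : C.IsInduced j L) (hj : C.IsIsotropicSplitting j) (hV : 0 < finrank ℝ FV)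
    (X Y : Sec EM FE E) (v : Sec EM FV V) :
    L.conn X (L.conn Y v) - L.conn Y (L.conn X v) - L.conn (L.bracket X Y) v
      = happ₃ L.H X Y (happ L.t v) := by
  have e := C.conn_flat hV (happ j X) (happ j Y) v
  rw [h.bracket_eq_add hj, h.conn_add, h.happ_coord_bracket] at e
  simp only [h.conn_eq] at e
  rw [e]
  abel

/-- Both sides differ by a tensorial operator. On products, `[j X, ·]` is a derivation of the
product and of the symmetrized bracket, which `t` relates. -/
theorem t_conn (h : C.IsInduced j L) (hj : C.IsIsotropicSplitting j) (hV : 1 < finrank ℝ FV)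
    (X : Sec EM FE E) (v : Sec EM FV V) :
    happ L.t (L.conn X v) = L.bracket X (happ L.t v) := by
  rw [← sub_eq_zero]
  refine C.eq_zero_of_prod (T := happₗ L.t ∘ₗ L.conn X - L.bracket X ∘ₗ happₗ L.t) ?_ ?_ v
  · intro f v
    simp only [LinearMap.sub_apply, LinearMap.comp_apply, happₗ_apply, happ_fsmul,
      h.conn_fsmul_right, h.bracket_fsmul hj, happ_add, fsmul_sub]
    abel
  · intro φ₁ φ₂
    have hV' := zero_lt_one.trans hV
    simp only [LinearMap.sub_apply, LinearMap.comp_apply, happₗ_apply]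
    rw [← h.conn_eq, C.conn_prod, happ_add, h.t_prod hV', h.t_prod hV', h.t_prod hV', map_neg]
    have e : ∀ ψ, L.bracket X (C.proj ψ) = C.proj (C.bracket (happ j X) ψ) := fun ψ => by
      conv_rhs => rw [hj.decomp ψ, map_add, map_add, C.proj_bracket_star hV, h.bracket_eq, add_zero]
    rw [e]
    simp only [map_add, C.loday (happ j X) φ₁ φ₂, C.loday (happ j X) φ₂ φ₁]
    abel

/-- The expression is tensorial in both arguments, so both may be taken to be products. -/
theorem conn_t_skew (h : C.IsInduced j L) (hj : C.IsIsotropicSplitting j) (hV : 0 < finrank ℝ FV)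
    (v w : Sec EM FV V) : L.conn (happ L.t v) w = -L.conn (happ L.t w) v := by
  rw [← sub_eq_zero, sub_neg_eq_add]
  refine C.eq_zero_of_prod (T := L.conn (happ L.t v) + (L.conn.flip v) ∘ₗ happₗ L.t) ?_ ?_ w
  · intro f w
    simp only [LinearMap.add_apply, LinearMap.comp_apply, happₗ_apply, happ_fsmul,
      LinearMap.flip_apply, h.conn_fsmul_right, h.conn_fsmul, h.anchorFun_t hj hV, zero_fsmul,
      zero_add, fsmul_add]
  · intro χ₁ χ₂
    simp only [LinearMap.add_apply, LinearMap.comp_apply, happₗ_apply, LinearMap.flip_apply]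
    set w := C.prod χ₁ χ₂ with hw
    refine C.eq_zero_of_prod (T := (L.conn.flip w) ∘ₗ happₗ L.t + L.conn (happ L.t w)) ?_ ?_ v
    · intro f w
      simp only [LinearMap.add_apply, LinearMap.comp_apply, happₗ_apply, happ_fsmul,
        LinearMap.flip_apply, h.conn_fsmul_right, h.conn_fsmul, h.anchorFun_t hj hV, zero_fsmul,
        zero_add, fsmul_add]
    · intro φ₁ φ₂
      simp only [LinearMap.add_apply, LinearMap.comp_apply, happₗ_apply, LinearMap.flip_apply]
      -- The symmetric part of the bracket acts trivially, so the connection along it annihilates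
      -- the product `w`. Its components are `-t⟨φ₁, φ₂⟩` in `E` and `Z ↦ ∇_Z ⟨φ₁, φ₂⟩` in `Hom(E,
      -- V)`, which gives the two terms.
      have e0 : C.conn (C.bracket φ₁ φ₂ + C.bracket φ₂ φ₁) w = 0 := by
        rw [hw, C.conn_prod, C.bracket_sum_bracket, C.bracket_sum_bracket, map_zero, map_zero,
          LinearMap.zero_apply, add_zero]
      rw [hj.decomp (C.bracket φ₁ φ₂ + C.bracket φ₂ φ₁), h.conn_add, happ_coord, C.prod_symm,
        map_add (C.prod _), C.prod_bracket_add, h.conn_eq, ← neg_neg (C.proj _),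
        ← h.t_prod hV, map_neg, LinearMap.neg_apply] at e0
      linear_combination (norm := module) -e0

/-- The form component of the Loday identity on `j X, j Y, j Z`, extracted by pairing with `j U`. -/
theorem closed (h : C.IsInduced j L) (hj : C.IsIsotropicSplitting j)
    (X Y Z U : Sec EM FE E) : L.extD₃ L.H X Y Z U = 0 := by
  have h1 : ∀ X Y Z U : Sec EM FE E,
      C.prod (C.bracket (happ j X) (C.bracket (happ j Y) (happ j Z))) (happ j U)
        = -happ₃ L.H X (L.bracket Y Z) U - L.conn X (happ₃ L.H Y Z U)
          + happ₃ L.H Y Z (L.bracket X U) := fun X Y Z U => by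
    rw [h.bracket_eq_add hj Y Z, map_add, map_add, LinearMap.add_apply, h.prod_bracket_star hj,
      h.H_eq, h.happ_coord_bracket, h.happ_coord_bracket, map_neg, happ₃_swap₁ L.H (L.bracket Y Z)]
    abel
  have h2 : C.prod (C.bracket (C.bracket (happ j X) (happ j Y)) (happ j Z)) (happ j U)
      = -happ₃ L.H (L.bracket X Y) Z U - L.conn U (happ₃ L.H X Y Z)
        + L.conn Z (happ₃ L.H X Y U) - happ₃ L.H X Y (L.bracket Z U) := by
    rw [h.bracket_eq_add hj X Y, map_add, LinearMap.add_apply, map_add, LinearMap.add_apply,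
      h.prod_star_bracket hj, h.H_eq, h.happ_coord_bracket, h.happ_coord_bracket,
      h.happ_coord_bracket, map_neg, map_neg, happ₃_swap₁ L.H Z (L.bracket X Y)]
    abel
  have e := congrArg (fun ψ => C.prod ψ (happ j U)) (C.loday (happ j X) (happ j Y) (happ j Z))
  simp only [map_add, LinearMap.add_apply] at e
  rw [h1, h1, h2] at e
  have s13 : ∀ X Y Z, happ₃ L.H X Y Z = happ₃ L.H Z X Y := fun X Y Z => by
    rw [happ₃_swap₂, happ₃_swap₁, neg_neg]
  rw [happ₃_swap₁ L.H X (L.bracket Y Z), happ₃_swap₁ L.H Y (L.bracket X Z), s13 X Y (L.bracket Z U),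
    s13 X Z (L.bracket Y U), s13 Y Z (L.bracket X U)] at e
  rw [Lie2Data.extD₃]
  linear_combination (norm := module) -e

end IsInduced

end VExactCourant

end Induced

/-! ### Standard form and induced data of an isotropic splitting -/

section StandardForm

variable {EM : Type*} [NormedAddCommGroup EM] [NormedSpace ℝ EM] [FiniteDimensional ℝ EM]
  {M : Type*} [TopologicalSpace M] [ChartedSpace EM M] [IsManifold 𝓘(ℝ, EM) ∞ M] [T2Space M]
  {FE : Type*} [NormedAddCommGroup FE] [NormedSpace ℝ FE] [FiniteDimensional ℝ FE]
  {E : M → Type*} [TopologicalSpace (TotalSpace FE E)] [∀ x, TopologicalSpace (E x)]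
  [∀ x, AddCommGroup (E x)] [∀ x, Module ℝ (E x)]
  [∀ x, IsTopologicalAddGroup (E x)] [∀ x, ContinuousSMul ℝ (E x)]
  [FiberBundle FE E] [VectorBundle ℝ FE E] [ContMDiffVectorBundle ∞ FE E 𝓘(ℝ, EM)]
  {FV : Type*} [NormedAddCommGroup FV] [NormedSpace ℝ FV] [FiniteDimensional ℝ FV]
  {V : M → Type*} [TopologicalSpace (TotalSpace FV V)] [∀ x, TopologicalSpace (V x)]
  [∀ x, AddCommGroup (V x)] [∀ x, Module ℝ (V x)]
  [∀ x, IsTopologicalAddGroup (V x)] [∀ x, ContinuousSMul ℝ (V x)]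
  [FiberBundle FV V] [VectorBundle ℝ FV V] [ContMDiffVectorBundle ∞ FV V 𝓘(ℝ, EM)]
  {FW : Type*} [NormedAddCommGroup FW] [NormedSpace ℝ FW] [FiniteDimensional ℝ FW]
  {W : M → Type*} [TopologicalSpace (TotalSpace FW W)] [∀ x, TopologicalSpace (W x)]
  [∀ x, AddCommGroup (W x)] [∀ x, Module ℝ (W x)]
  [∀ x, IsTopologicalAddGroup (W x)] [∀ x, ContinuousSMul ℝ (W x)]
  [FiberBundle FW W] [VectorBundle ℝ FW W] [ContMDiffVectorBundle ∞ FW W 𝓘(ℝ, EM)]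
namespace Lie2Algebroid

theorem toLie2Data_injective :
    Function.Injective (toLie2Data : Lie2Algebroid EM FE E FV V → Lie2Data EM FE E FV V) := by
  rintro ⟨_, _⟩ ⟨_, _⟩ h
  cases h
  rfl

end Lie2Algebroid

theorem ThreeForm.ext_of_sec {H H' : ThreeForm EM FE E FV V}
    (h : ∀ X Y Z, happ₃ H X Y Z = happ₃ H' X Y Z) : H = H' := by
  ext x u
  obtain ⟨X, hX⟩ := exists_sec_apply_eq (EM := EM) (FE := FE) (u 0)
  obtain ⟨Y, hY⟩ := exists_sec_apply_eq (EM := EM) (FE := FE) (u 1)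
  obtain ⟨Z, hZ⟩ := exists_sec_apply_eq (EM := EM) (FE := FE) (u 2)
  have hu : u = ![X x, Y x, Z x] := by
    funext i
    fin_cases i
    exacts [hX.symm, hY.symm, hZ.symm]
  rw [hu]
  exact congrArg (fun s : Sec EM FV V => s x) (h X Y Z)

namespace VExactCourant

variable {C : VExactCourant EM FE E FV V FW W} {j : HomSec EM FE E FW W}

namespace IsInduced

/-- The operations induced by an isotropic splitting form a Lie 2-algebroid. -/
def toLie2Algebroid {L : Lie2Data EM FE E FV V} (h : C.IsInduced j L)
    (hj : C.IsIsotropicSplitting j) (hV : 1 < finrank ℝ FV) : Lie2Algebroid EM FE E FV V where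
  toLie2Data := L
  anchor_t := h.anchor_t hj (zero_lt_one.trans hV)
  bracket_skew := h.bracket_skew hj (zero_lt_one.trans hV)
  bracket_leibniz X Y f x :=
    congrArg (fun s : Sec EM FE E => s x) (h.bracket_fsmul hj X f Y)
  conn_fsmul f X v := h.conn_fsmul X f v
  conn_leibniz X f v x := congrArg (fun s : Sec EM FV V => s x) (h.conn_fsmul_right X f v)
  jacobi := h.jacobi hj hV
  curvature := h.curvature hj (zero_lt_one.trans hV)
  t_conn := h.t_conn hj hV
  conn_t_skew := h.conn_t_skew hj (zero_lt_one.trans hV)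
  closed := h.closed hj

/-- Each operation is prescribed by `C` and `j`; for `t` this uses that `Hom(E, V)` separates points
of `E`. -/
theorem eq {L L' : Lie2Data EM FE E FV V} (hV : 0 < finrank ℝ FV) (h : C.IsInduced j L)
    (h' : C.IsInduced j L') : L = L' := by
  have h1 : L.anchor = L'.anchor := ContMDiffSection.ext fun x =>
    ContinuousLinearMap.ext fun u => (h.anchor_eq x u).symm.trans (h'.anchor_eq x u)
  have h2 : L.t = L'.t := ext_of_sec fun v => eq_of_forall_happ (FV := FV) (V := V) hV fun a =>
    neg_injective ((h.t_eq a v).symm.trans (h'.t_eq a v))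
  have h3 : L.bracket = L'.bracket := LinearMap.ext fun X => LinearMap.ext fun Y =>
    (h.bracket_eq X Y).symm.trans (h'.bracket_eq X Y)
  have h4 : L.conn = L'.conn := LinearMap.ext fun X => LinearMap.ext fun v =>
    (h.conn_eq X v).symm.trans (h'.conn_eq X v)
  have h5 : L.H = L'.H := ThreeForm.ext_of_sec fun X Y Z =>
    (h.H_eq Y X Z).symm.trans (h'.H_eq Y X Z)
  cases L
  cases L'
  subst h1 h2 h3 h4 h5
  rfl

theorem hasStandardForm {L : Lie2Algebroid EM FE E FV V} (h : C.IsInduced j L.toLie2Data)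
    (hj : C.IsIsotropicSplitting j) (hV : 1 < finrank ℝ FV) : C.HasStandardForm j L where
  anchor_eq x u a := by
    obtain ⟨ρ, hρ⟩ := C.anchor_factors
    rw [map_add, h.anchor_eq, hρ, pi_piStar, map_zero, add_zero]
  conn_eq := h.conn_add
  pairing_eq x u w a b := by
    rw [map_add, map_add, add_apply, add_apply, hj.2, pairing_piStar, C.pairing_symm x (j x u),
      C.piStar_adjoint, C.piStar_adjoint, hj.1, hj.1, zero_add, add_zero]
  bracket_eq X a Y b := by
    refine ⟨C.coord j (C.bracket (C.oplus j X a) (C.oplus j Y b)), fun Z => ?_, ?_⟩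
    · rw [happ_coord]
      exact h.prod_bracket hj hV X a Y b Z
    · rw [← h.proj_bracket hj hV X a Y b]
      exact hj.decomp _

end IsInduced

theorem oplus_zero (X : Sec EM FE E) : C.oplus j X 0 = happ j X := by
  rw [oplus, happ_zero, add_zero]

/-- Setting one of the components to zero in the formulas recovers each induced operation. With
`IsInduced.hasStandardForm`, this makes the two notions interchangeable for isotropic splittings
when `rk V > 1`. -/
theorem HasStandardForm.isInduced {L : Lie2Algebroid EM FE E FV V} (h : C.HasStandardForm j L)
    (hj : C.IsIsotropicSplitting j) : C.IsInduced j L.toLie2Data := by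
  have hb : ∀ X Y, ∃ c : HomSec EM FE E FV V, (∀ Z, happ c Z = happ₃ L.H Y X Z) ∧
      C.bracket (happ j X) (happ j Y) = happ j (L.bracket X Y) + C.star c := fun X Y => by
    obtain ⟨c, hc, e⟩ := h.bracket_eq X 0 Y 0
    rw [oplus_zero, oplus_zero, zero_happ, happ_zero, sub_zero] at e
    refine ⟨c, fun Z => ?_, e⟩
    rw [hc, Lie2Data.formPart_eq]
    simp only [zero_happ, happ_zero, map_zero]
    abel
  refine ⟨fun x u => ?_, fun a v => ?_, fun X Y => ?_, fun X v => ?_, fun X Y Z => ?_⟩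
  · rw [← h.anchor_eq x u 0, map_zero, add_zero]
  · have e := h.conn_eq 0 a v
    rw [oplus, happ_zero, zero_add, map_zero, LinearMap.zero_apply, zero_sub] at e
    exact e
  · obtain ⟨c, -, e⟩ := hb X Y
    rw [e, map_add, hj.proj, C.proj_star, add_zero]
  · rw [← oplus_zero (C := C) X, h.conn_eq, zero_happ, sub_zero]
  · obtain ⟨c, hc, e⟩ := hb X Y
    rw [e, map_add, LinearMap.add_apply, hj.prod, C.prod_star_left, hj.proj, zero_add, hc]

/-- That `⟨[j X, j Y], j Z⟩` alternates comes from isotropy of `j`: the symmetric-part axiom handles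
the first two arguments and invariance the remaining pair. -/
theorem IsIsotropicSplitting.exists_isInduced (hj : C.IsIsotropicSplitting j)
    (hV : 0 < finrank ℝ FV) : ∃ L : Lie2Data EM FE E FV V, C.IsInduced j L := by
  obtain ⟨t, ht⟩ := hj.exists_t hV
  have h₁ : ∀ X Y, C.prod (C.bracket (happ j X) (happ j X)) (happ j Y) = 0 := fun X Y => by
    have e := C.prod_bracket_add (happ j Y) (happ j X) (happ j X)
    rw [hj.prod, map_zero] at e
    rw [C.prod_symm]
    exact eq_zero_of_eq_neg (eq_neg_of_add_eq_zero_left e)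
  -- The bracket is flipped because the convention is `⟨[j X, j Y], j Z⟩ = H(Y, X, Z)`.
  obtain ⟨H, hH⟩ := exists_threeForm (FE := FE) (E := E) (FV := FV) (V := V)
    (((C.bracket.compl₁₂ (happₗ j) (happₗ j)).flip).compr₂ (C.prod.compl₂ (happₗ j)))
    h₁
    (fun X Y => by
      change C.prod (C.bracket (happ j Y) (happ j X)) (happ j Y) = 0
      have e := C.conn_prod (happ j Y) (happ j X) (happ j Y)
      rw [hj.prod, map_zero, C.prod_symm (happ j X), h₁, add_zero] at e
      exact e.symm)
    (fun f X Y Z => by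
      change C.prod (C.bracket (happ j Y) (happ j X)) (happ j (fsmul f Z)) = _
      rw [happ_fsmul, C.prod_fsmul_right]
      rfl)
  exact ⟨{ anchor := HomSec.ofSmooth (fun x => (C.anchor x).comp (j x))
            fun X => (happ C.anchor (happ j X)).contMDiff
           t := t
           bracket := (C.bracket.compl₁₂ (happₗ j) (happₗ j)).compr₂ C.proj
           conn := C.conn ∘ₗ happₗ j
           H := H },
    { anchor_eq := fun _ _ => rfl
      t_eq := ht
      bracket_eq := fun _ _ => rfl
      conn_eq := fun _ _ => rfl
      H_eq := fun X Y Z => (hH Y X Z).symm }⟩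

/-- An isotropic splitting induces a unique Lie 2-algebroid. -/
theorem IsIsotropicSplitting.existsUnique_hasStandardForm (hj : C.IsIsotropicSplitting j)
    (hV : 1 < finrank ℝ FV) : ∃! L : Lie2Algebroid EM FE E FV V, C.HasStandardForm j L := by
  obtain ⟨L, h⟩ := hj.exists_isInduced (zero_lt_one.trans hV)
  refine ⟨h.toLie2Algebroid hj hV, IsInduced.hasStandardForm h hj hV, fun L' h' => ?_⟩
  exact Lie2Algebroid.toLie2Data_injective ((h'.isInduced hj).eq (zero_lt_one.trans hV) h)

/-! ### Changes of the splitting -/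

theorem IsIsotropicSplitting.shift (hj : C.IsIsotropicSplitting j) {B : BilinSec EM FE E FV V}
    (hB : IsTwoForm B) : C.IsIsotropicSplitting (C.shift j B) := by
  refine ⟨fun x u => ?_, fun x u w => ?_⟩
  · rw [shift_apply, map_sub, hj.1, pi_piStar, sub_zero]
  · rw [C.pairing_shift hj.1, hj.2, hB.swap x u w]
    abel

theorem eq_shift_iff {j' : HomSec EM FE E FW W} {B : BilinSec EM FE E FV V} :
    (∀ (x : M) (u : E x), j' x u = j x u - C.piStar x (B x u)) ↔ j' = C.shift j B := by
  refine ⟨fun h => ContMDiffSection.ext fun x => ContinuousLinearMap.ext fun u => h x u, ?_⟩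
  rintro rfl x u
  rfl

theorem shift_injective {B B' : BilinSec EM FE E FV V} (h : C.shift j B = C.shift j B') :
    B = B' := by
  ext1 x
  refine ContinuousLinearMap.ext fun u => C.piStar_injective x ?_
  have e := eq_shift_iff.mpr h x u
  rw [shift_apply] at e
  exact sub_right_injective e

/-- The form component of `j'` relative to `j` is its pairing with `j`, so `B = -⟨j' ·, j ·⟩`;
isotropy of `j'` makes `B` alternating. -/
theorem IsIsotropicSplitting.exists_eq_shift (hj : C.IsIsotropicSplitting j)
    {j' : HomSec EM FE E FW W} (hj' : C.IsIsotropicSplitting j') :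
    ∃ B : BilinSec EM FE E FV V, IsTwoForm B ∧ j' = C.shift j B := by
  obtain ⟨B, hB⟩ := exists_bilinSec (-C.prod.compl₁₂ (happₗ j') (happₗ j))
    (fun f X Y => by
      simp only [LinearMap.neg_apply, LinearMap.compl₁₂_apply, happₗ_apply, happ_fsmul,
        C.prod_fsmul_left, fsmul_neg])
    (fun f X Y => by
      simp only [LinearMap.neg_apply, LinearMap.compl₁₂_apply, happₗ_apply, happ_fsmul,
        C.prod_fsmul_right, fsmul_neg])
  have hB' : ∀ x u w, B x u w = -C.pairing x (j' x u) (j x w) := by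
    intro x u w
    obtain ⟨X, rfl⟩ := exists_sec_apply_eq (EM := EM) (FE := FE) u
    obtain ⟨Y, rfl⟩ := exists_sec_apply_eq (EM := EM) (FE := FE) w
    exact congrArg (fun s : Sec EM FV V => s x) (hB X Y)
  have hs : j' = C.shift j B := eq_shift_iff.mp fun x u => by
    obtain ⟨a, ha, ha'⟩ := hj.exists_eq x (j' x u)
    have e : a = -B x u := ContinuousLinearMap.ext fun w => by
      rw [ha', neg_apply, hB', neg_neg]
    rw [ha, hj'.1, e, map_neg, sub_eq_add_neg]
  refine ⟨B, fun x u => ?_, hs⟩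
  have e := hj'.2 x u u
  rw [hs, C.pairing_shift hj.1, hj.2, zero_sub] at e
  exact eq_zero_of_eq_neg (sub_eq_zero.mp e).symm

/-- The data induced by the shifted splitting are computed from the block formulas with `a = -B(X,
·)`, and they turn out to be those of the `B`-change. -/
theorem IsInduced.shift_iff {L : Lie2Algebroid EM FE E FV V} (h : C.IsInduced j L.toLie2Data)
    (hj : C.IsIsotropicSplitting j) (hV : 1 < finrank ℝ FV) {B : BilinSec EM FE E FV V}
    (hB : IsTwoForm B) (L' : Lie2Algebroid EM FE E FV V) :
    C.IsInduced (C.shift j B) L'.toLie2Data ↔ IsChangeOfSplitting L B L' := by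
  have hs : ∀ X, happ (C.shift j B) X = happ j X + C.star (-happ B X) := fun X => by
    rw [happ_shift, map_neg, sub_eq_add_neg]
  have hA : ∀ x u, C.anchor x (C.shift j B x u) = L.anchor x u := fun x u => by
    obtain ⟨ρ, hρ⟩ := C.anchor_factors
    rw [shift_apply, map_sub, h.anchor_eq, hρ, pi_piStar, map_zero, sub_zero]
  have hb : ∀ X Y, C.proj (C.bracket (happ (C.shift j B) X) (happ (C.shift j B) Y))
      = L.bracket X Y + happ L.t (happ₂ B X Y) := fun X Y => by
    rw [hs, hs, h.proj_bracket hj hV, neg_happ, happ_neg, sub_neg_eq_add]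
    rfl
  have hc : ∀ X v, C.conn (happ (C.shift j B) X) v = L.conn X v + happ₂ B X (happ L.t v) :=
    fun X v => by
      rw [hs, h.conn_add, neg_happ, sub_neg_eq_add]
      rfl
  have hH : ∀ X Y Z, C.prod (C.bracket (happ (C.shift j B) Y) (happ (C.shift j B) X))
      (happ (C.shift j B) Z)
        = happ₃ L.H X Y Z + L.extD₂ B X Y Z - cubicTerm L B X Y Z := fun X Y Z => by
    -- Two of the three cubic terms come from `T`; the third comes from pairing `-π^* B(Z, ·)` with
    -- the `t`-part of the projected bracket. The swaps bring all arguments into a common order.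
    have s := hB.happ₂_swap
    rw [hs Z, map_add, C.prod_symm _ (C.star _), C.prod_star_left, hb, hs, hs,
      h.prod_bracket hj hV, Lie2Data.formPart_eq, Lie2Data.extD₂, cubicTerm, s Y X,
      L.bracket_skew Y X, s (L.bracket X Y) Z, s (L.bracket X Z) Y, s (L.bracket Y Z) X,
      s (happ L.t (happ₂ B X Y)) Z, s (happ L.t (happ₂ B Y Z)) X, s (happ L.t (happ₂ B Z X)) Y,
      s Z X]
    simp only [happ₂, neg_happ, happ_neg, map_neg, happ_add]
    rw [show happ (happ B Y) X = -happ (happ B X) Y from s Y X, map_neg]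
    abel
  constructor
  · intro h'
    exact
      { anchor_eq := ContMDiffSection.ext fun x => ContinuousLinearMap.ext fun u =>
          (h'.anchor_eq x u).symm.trans (hA x u)
        t_eq := ext_of_sec fun v =>
          eq_of_forall_happ (FV := FV) (V := V) (zero_lt_one.trans hV) fun a =>
            neg_injective ((h'.t_eq a v).symm.trans (h.t_eq a v))
        bracket_eq := fun X Y => (h'.bracket_eq X Y).symm.trans (hb X Y)
        conn_eq := fun X v => (h'.conn_eq X v).symm.trans (hc X v)
        H_eq := fun X Y Z => (h'.H_eq Y X Z).symm.trans (hH X Y Z) }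
  · intro h'
    exact
      { anchor_eq := fun x u => by rw [hA, h'.anchor_eq]
        t_eq := fun a v => by rw [h.t_eq, h'.t_eq]
        bracket_eq := fun X Y => by rw [hb, h'.bracket_eq]
        conn_eq := fun X v => by rw [hc, h'.conn_eq]
        H_eq := fun X Y Z => by rw [hH, h'.H_eq] }

theorem HasStandardForm.shift_iff {L : Lie2Algebroid EM FE E FV V} (h : C.HasStandardForm j L)
    (hj : C.IsIsotropicSplitting j) (hV : 1 < finrank ℝ FV) {B : BilinSec EM FE E FV V}
    (hB : IsTwoForm B) (L' : Lie2Algebroid EM FE E FV V) :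
    C.HasStandardForm (C.shift j B) L' ↔ IsChangeOfSplitting L B L' :=
  ⟨fun h' => ((h.isInduced hj).shift_iff hj hV hB L').mp (h'.isInduced (hj.shift hB)),
    fun h' => (((h.isInduced hj).shift_iff hj hV hB L').mpr h').hasStandardForm (hj.shift hB) hV⟩

theorem IsIsotropicSplitting.iff_existsUnique (hj : C.IsIsotropicSplitting j)
    (j' : HomSec EM FE E FW W) :
    C.IsIsotropicSplitting j' ↔ ∃! B : BilinSec EM FE E FV V, IsTwoForm B ∧
      ∀ (x : M) (u : E x), j' x u = j x u - C.piStar x (B x u) := by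
  simp only [eq_shift_iff]
  constructor
  · intro hj'
    obtain ⟨B, hB, e⟩ := hj.exists_eq_shift hj'
    exact ⟨B, ⟨hB, e⟩, fun B' h' => shift_injective (h'.2.symm.trans e)⟩
  · rintro ⟨B, ⟨hB, rfl⟩, -⟩
    exact hj.shift hB

end VExactCourant

end StandardForm

/-! ### Isomorphisms -/

section Isomorphisms

variable {EM : Type*} [NormedAddCommGroup EM] [NormedSpace ℝ EM] [FiniteDimensional ℝ EM]
  {M : Type*} [TopologicalSpace M] [ChartedSpace EM M] [IsManifold 𝓘(ℝ, EM) ∞ M] [T2Space M]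
  {FE : Type*} [NormedAddCommGroup FE] [NormedSpace ℝ FE] [FiniteDimensional ℝ FE]
  {E : M → Type*} [TopologicalSpace (TotalSpace FE E)] [∀ x, TopologicalSpace (E x)]
  [∀ x, AddCommGroup (E x)] [∀ x, Module ℝ (E x)]
  [∀ x, IsTopologicalAddGroup (E x)] [∀ x, ContinuousSMul ℝ (E x)]
  [FiberBundle FE E] [VectorBundle ℝ FE E] [ContMDiffVectorBundle ∞ FE E 𝓘(ℝ, EM)]
  {FV : Type*} [NormedAddCommGroup FV] [NormedSpace ℝ FV] [FiniteDimensional ℝ FV]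
  {V : M → Type*} [TopologicalSpace (TotalSpace FV V)] [∀ x, TopologicalSpace (V x)]
  [∀ x, AddCommGroup (V x)] [∀ x, Module ℝ (V x)]
  [∀ x, IsTopologicalAddGroup (V x)] [∀ x, ContinuousSMul ℝ (V x)]
  [FiberBundle FV V] [VectorBundle ℝ FV V] [ContMDiffVectorBundle ∞ FV V 𝓘(ℝ, EM)]
  {FW : Type*} [NormedAddCommGroup FW] [NormedSpace ℝ FW] [FiniteDimensional ℝ FW]
  {W : M → Type*} [TopologicalSpace (TotalSpace FW W)] [∀ x, TopologicalSpace (W x)]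
  [∀ x, AddCommGroup (W x)] [∀ x, Module ℝ (W x)]
  [∀ x, IsTopologicalAddGroup (W x)] [∀ x, ContinuousSMul ℝ (W x)]
  [FiberBundle FW W] [VectorBundle ℝ FW W] [ContMDiffVectorBundle ∞ FW W 𝓘(ℝ, EM)]
  {FE' : Type*} [NormedAddCommGroup FE'] [NormedSpace ℝ FE'] [FiniteDimensional ℝ FE']
  {E' : M → Type*} [TopologicalSpace (TotalSpace FE' E')] [∀ x, TopologicalSpace (E' x)]
  [∀ x, AddCommGroup (E' x)] [∀ x, Module ℝ (E' x)]
  [∀ x, IsTopologicalAddGroup (E' x)] [∀ x, ContinuousSMul ℝ (E' x)]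
  [FiberBundle FE' E'] [VectorBundle ℝ FE' E'] [ContMDiffVectorBundle ∞ FE' E' 𝓘(ℝ, EM)]
  {FV' : Type*} [NormedAddCommGroup FV'] [NormedSpace ℝ FV'] [FiniteDimensional ℝ FV']
  {V' : M → Type*} [TopologicalSpace (TotalSpace FV' V')] [∀ x, TopologicalSpace (V' x)]
  [∀ x, AddCommGroup (V' x)] [∀ x, Module ℝ (V' x)]
  [∀ x, IsTopologicalAddGroup (V' x)] [∀ x, ContinuousSMul ℝ (V' x)]
  [FiberBundle FV' V'] [VectorBundle ℝ FV' V'] [ContMDiffVectorBundle ∞ FV' V' 𝓘(ℝ, EM)]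
  {FW' : Type*} [NormedAddCommGroup FW'] [NormedSpace ℝ FW'] [FiniteDimensional ℝ FW']
  {W' : M → Type*} [TopologicalSpace (TotalSpace FW' W')] [∀ x, TopologicalSpace (W' x)]
  [∀ x, AddCommGroup (W' x)] [∀ x, Module ℝ (W' x)]
  [∀ x, IsTopologicalAddGroup (W' x)] [∀ x, ContinuousSMul ℝ (W' x)]
  [FiberBundle FW' W'] [VectorBundle ℝ FW' W'] [ContMDiffVectorBundle ∞ FW' W' 𝓘(ℝ, EM)]
/-- The bundle maps `φ` and `ν` intertwine the operations of `L` and `L'`. -/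
structure IsStrictMorphism (L : Lie2Data EM FE E FV V) (L' : Lie2Data EM FE' E' FV' V')
    (φ : HomSec EM FE E FE' E') (ν : HomSec EM FV V FV' V') : Prop where
  anchor_eq : ∀ (x : M) (u : E x), L'.anchor x (φ x u) = L.anchor x u
  t_eq : ∀ v, happ L'.t (happ ν v) = happ φ (happ L.t v)
  bracket_eq : ∀ X Y, L'.bracket (happ φ X) (happ φ Y) = happ φ (L.bracket X Y)
  conn_eq : ∀ X v, L'.conn (happ φ X) (happ ν v) = happ ν (L.conn X v)
  H_eq : ∀ X Y Z, happ₃ L'.H (happ φ X) (happ φ Y) (happ φ Z) = happ ν (happ₃ L.H X Y Z)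

/-- Separates the two ingredients of an isomorphism: the two-form is absorbed into `L₁`, and only
bundle maps that intertwine the operations remain. -/
theorem IsChangeOfSplitting.isLie2Iso_iff {L L₁ : Lie2Algebroid EM FE E FV V}
    {B : BilinSec EM FE E FV V} (h : IsChangeOfSplitting L B L₁) (hB : IsTwoForm B)
    {L' : Lie2Algebroid EM FE' E' FV' V'} {φ : HomSec EM FE E FE' E'} (hφ : IsBundleIso φ)
    {ν : HomSec EM FV V FV' V'} (hν : IsBundleIso ν) :
    IsLie2Iso L L' φ ν B ↔ IsStrictMorphism L₁.toLie2Data L'.toLie2Data φ ν := by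
  constructor
  · intro k
    exact
      { anchor_eq := fun x u => by rw [k.anchor_eq, h.anchor_eq]
        t_eq := fun v => ContMDiffSection.ext fun x => by
          rw [h.t_eq]
          exact k.t_eq x (v x)
        bracket_eq := fun X Y => by rw [k.bracket_eq, h.bracket_eq]
        conn_eq := fun X v => by rw [k.conn_eq, h.conn_eq]
        H_eq := fun X Y Z => by rw [k.H_eq, h.H_eq] }
  · intro k
    exact
      { φ_iso := hφ
        ν_iso := hν
        twoForm := hB
        anchor_eq := fun x u => by rw [k.anchor_eq, h.anchor_eq]
        t_eq := fun x v => by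
          obtain ⟨v, rfl⟩ := exists_sec_apply_eq (EM := EM) (FE := FV) v
          rw [← h.t_eq]
          exact congrArg (fun s : Sec EM FE' E' => s x) (k.t_eq v)
        bracket_eq := fun X Y => by rw [k.bracket_eq, h.bracket_eq]
        conn_eq := fun X v => by rw [k.conn_eq, h.conn_eq]
        H_eq := fun X Y Z => by rw [k.H_eq, h.H_eq] }

/-- Conjugation of `a : E → V` to a bundle map `E' → V'`. -/
def conj (ψ : HomSec EM FE' E' FE E) (ν : HomSec EM FV V FV' V') (a : HomSec EM FE E FV V) :
    HomSec EM FE' E' FV' V' :=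
  HomSec.ofSmooth (fun x => (ν x).comp ((a x).comp (ψ x)))
    fun X => (happ ν (happ a (happ ψ X))).contMDiff

theorem happ_conj (ψ : HomSec EM FE' E' FE E) (ν : HomSec EM FV V FV' V')
    (a : HomSec EM FE E FV V) (X : Sec EM FE' E') :
    happ (conj ψ ν a) X = happ ν (happ a (happ ψ X)) := rfl

theorem IsBundleIso.exists_inverse_happ {φ : HomSec EM FE E FE' E'} (hφ : IsBundleIso φ) :
    ∃ ψ : HomSec EM FE' E' FE E, (∀ X, happ φ (happ ψ X) = X) ∧ ∀ X, happ ψ (happ φ X) = X := by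
  obtain ⟨ψ, h₁, h₂⟩ := hφ.exists_inverse
  exact ⟨ψ, fun X => ContMDiffSection.ext fun x => h₁ x _,
    fun X => ContMDiffSection.ext fun x => h₂ x _⟩

theorem IsStrictMorphism.formPart_eq {L : Lie2Data EM FE E FV V} {L' : Lie2Data EM FE' E' FV' V'}
    {φ : HomSec EM FE E FE' E'} {ν : HomSec EM FV V FV' V'} (k : IsStrictMorphism L L' φ ν)
    {ψ : HomSec EM FE' E' FE E} (hψ : ∀ X, happ ψ (happ φ X) = X)
    (X : Sec EM FE E) (a : HomSec EM FE E FV V) (Y : Sec EM FE E) (b : HomSec EM FE E FV V)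
    (Z : Sec EM FE E) :
    L'.formPart (happ φ X) (conj ψ ν a) (happ φ Y) (conj ψ ν b) (happ φ Z)
      = happ ν (L.formPart X a Y b Z) := by
  rw [Lie2Data.formPart_eq, Lie2Data.formPart_eq]
  simp only [happ_conj, hψ, k.bracket_eq, k.conn_eq, k.H_eq, k.t_eq, happ_add, happ_sub]

namespace VExactCourant

variable {C : VExactCourant EM FE E FV V FW W} {j : HomSec EM FE E FW W}
  {C' : VExactCourant EM FE' E' FV' V' FW' W'} {j' : HomSec EM FE' E' FW' W'}

/-- The candidate isomorphism in terms of splittings: `φ` on the `E`-component and `a ↦ ν ∘ a ∘ ψ`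
on forms. At this stage only tensoriality matters, so `ψ` need not yet invert `φ`. -/
theorem exists_transport (C : VExactCourant EM FE E FV V FW W) (j : HomSec EM FE E FW W)
    (C' : VExactCourant EM FE' E' FV' V' FW' W') (j' : HomSec EM FE' E' FW' W')
    (φ : HomSec EM FE E FE' E') (ψ : HomSec EM FE' E' FE E) (ν : HomSec EM FV V FV' V') :
    ∃ Φ : HomSec EM FW W FW' W', ∀ χ, happ Φ χ
      = happ j' (happ φ (C.proj χ)) + C'.star (conj ψ ν (C.coord j χ)) := by
  refine exists_homSec_of_fsmul
    { toFun := fun χ => happ j' (happ φ (C.proj χ)) + C'.star (conj ψ ν (C.coord j χ))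
      map_add' := fun χ χ' => ?_
      map_smul' := fun r χ => ?_ } fun f χ => ?_
  · have e : conj ψ ν (C.coord j (χ + χ')) = conj ψ ν (C.coord j χ) + conj ψ ν (C.coord j χ') :=
      ext_of_sec fun X => by
        simp only [add_happ, happ_conj, happ_coord, map_add, LinearMap.add_apply, happ_add]
    rw [e, map_add, map_add, happ_add, happ_add]
    abel
  · have e : conj ψ ν (C.coord j (r • χ)) = r • conj ψ ν (C.coord j χ) :=
      ext_of_sec fun X => by
        simp only [smul_happ, happ_conj, happ_coord, map_smul, LinearMap.smul_apply, happ_smul]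
    rw [e, map_smul, map_smul, happ_smul, happ_smul, RingHom.id_apply, smul_add]
  · have e : conj ψ ν (C.coord j (fsmul f χ)) = fsmul f (conj ψ ν (C.coord j χ)) :=
      ext_of_sec fun X => by
        simp only [fsmul_happ, happ_conj, happ_coord, prod_fsmul_left, happ_fsmul]
    change happ j' (happ φ (C.proj (fsmul f χ))) + C'.star (conj ψ ν (C.coord j (fsmul f χ))) = _
    rw [e, C.proj_fsmul, C'.star_fsmul, happ_fsmul, happ_fsmul, ← fsmul_add]
    rfl

theorem IsIsotropicSplitting.proj_add (hj : C.IsIsotropicSplitting j) (X : Sec EM FE E)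
    (a : HomSec EM FE E FV V) : C.proj (happ j X + C.star a) = X := by
  rw [map_add, hj.proj, C.proj_star, add_zero]

theorem IsIsotropicSplitting.coord_add (hj : C.IsIsotropicSplitting j) (X : Sec EM FE E)
    (a : HomSec EM FE E FV V) : C.coord j (happ j X + C.star a) = a :=
  ext_of_sec fun Y => by
    rw [happ_coord, map_add, LinearMap.add_apply, hj.prod, C.prod_star_left, hj.proj, zero_add]

/-- A strict isomorphism of Lie 2-algebroids extends to the exact Courant algebroids. -/
theorem HasStandardForm.exists_isCourantIso {L : Lie2Algebroid EM FE E FV V}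
    (h : C.HasStandardForm j L) (hj : C.IsIsotropicSplitting j)
    {L' : Lie2Algebroid EM FE' E' FV' V'} (h' : C'.HasStandardForm j' L')
    (hj' : C'.IsIsotropicSplitting j') {φ : HomSec EM FE E FE' E'} (hφ : IsBundleIso φ)
    {ν : HomSec EM FV V FV' V'} (hν : IsBundleIso ν)
    (k : IsStrictMorphism L.toLie2Data L'.toLie2Data φ ν) : ∃ Φ, IsCourantIso C C' φ ν Φ := by
  obtain ⟨φ', hφ₁, hφ₂⟩ := hφ.exists_inverse_happ
  obtain ⟨ν', hν₁, hν₂⟩ := hν.exists_inverse_happ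
  obtain ⟨Φ, hΦ⟩ := exists_transport C j C' j' φ φ' ν
  -- The same construction with the inverse bundle maps gives the inverse of `Φ`.
  obtain ⟨Ψ, hΨ⟩ := exists_transport C' j' C j φ' φ ν'
  have hΦ' : ∀ X a, happ Φ (happ j X + C.star a)
      = happ j' (happ φ X) + C'.star (conj φ' ν a) := fun X a => by
    rw [hΦ, hj.proj_add, hj.coord_add]
  have hΨ' : ∀ X a, happ Ψ (happ j' X + C'.star a)
      = happ j (happ φ' X) + C.star (conj φ ν' a) := fun X a => by
    rw [hΨ, hj'.proj_add, hj'.coord_add]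
  have hΨΦ : ∀ χ, happ Ψ (happ Φ χ) = χ := fun χ => by
    rw [hΦ, hΨ', hφ₂]
    conv_rhs => rw [hj.decomp χ]
    congr 2
    exact ext_of_sec fun X => by rw [happ_conj, happ_conj, hν₂, hφ₂]
  have hΦΨ : ∀ χ, happ Φ (happ Ψ χ) = χ := fun χ => by
    rw [hΨ, hΦ', hφ₁]
    conv_rhs => rw [hj'.decomp χ]
    congr 2
    exact ext_of_sec fun X => by rw [happ_conj, happ_conj, hν₁, hφ₁]
  have hpi : ∀ χ, C'.proj (happ Φ χ) = happ φ (C.proj χ) := fun χ => by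
    rw [hΦ, hj'.proj_add]
  have hprod : ∀ χ₁ χ₂, C'.prod (happ Φ χ₁) (happ Φ χ₂) = happ ν (C.prod χ₁ χ₂) := by
    intro χ₁ χ₂
    rw [hj.decomp χ₁, hj.decomp χ₂, hΦ', hΦ']
    simp only [map_add, LinearMap.add_apply, hj.prod, hj'.prod, prod_star_left, proj_star,
      hj.proj, hj'.proj, C.prod_symm (happ j _) (C.star _), C'.prod_symm (happ j' _) (C'.star _),
      happ_conj, hφ₂, happ_add, happ_zero]
  refine ⟨Φ, ⟨hφ, hν, fun x => ⟨fun w₁ w₂ e => ?_, fun w => ?_⟩, fun x w => ?_, fun x w => ?_,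
    fun x w₁ w₂ => ?_, fun χ v => ?_, fun χ₁ χ₂ => ?_⟩⟩
  · obtain ⟨χ₁, rfl⟩ := exists_sec_apply_eq (EM := EM) (FE := FW) w₁
    obtain ⟨χ₂, rfl⟩ := exists_sec_apply_eq (EM := EM) (FE := FW) w₂
    have e₁ := congrArg (fun s : Sec EM FW W => s x) (hΨΦ χ₁)
    have e₂ := congrArg (fun s : Sec EM FW W => s x) (hΨΦ χ₂)
    exact e₁.symm.trans ((congrArg (Ψ x) e).trans e₂)
  · obtain ⟨χ, rfl⟩ := exists_sec_apply_eq (EM := EM) (FE := FW') w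
    exact ⟨happ Ψ χ x, congrArg (fun s : Sec EM FW' W' => s x) (hΦΨ χ)⟩
  · obtain ⟨χ, rfl⟩ := exists_sec_apply_eq (EM := EM) (FE := FW) w
    exact congrArg (fun s : Sec EM FE' E' => s x) (hpi χ)
  · obtain ⟨χ, rfl⟩ := exists_sec_apply_eq (EM := EM) (FE := FW) w
    have e := congrArg (fun s : Sec EM FW' W' => s x) (hΦ χ)
    have e' := congrArg (fun s : Sec EM FW W => s x) (hj.decomp χ)
    refine (congrArg (C'.anchor x) e).trans (((h'.anchor_eq x _ _).trans ?_).trans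
      (congrArg (C.anchor x) e').symm)
    exact (k.anchor_eq x _).trans (h.anchor_eq x _ _).symm
  · obtain ⟨χ₁, rfl⟩ := exists_sec_apply_eq (EM := EM) (FE := FW) w₁
    obtain ⟨χ₂, rfl⟩ := exists_sec_apply_eq (EM := EM) (FE := FW) w₂
    exact congrArg (fun s : Sec EM FV' V' => s x) (hprod χ₁ χ₂)
  · rw [hj.decomp χ, hΦ']
    have e₁ := h.conn_eq (C.proj χ) (C.coord j χ) v
    have e₂ := h'.conn_eq (happ φ (C.proj χ)) (conj φ' ν (C.coord j χ)) (happ ν v)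
    refine e₂.trans (Eq.trans ?_ (congrArg (happ ν) e₁).symm)
    rw [k.conn_eq, happ_conj, k.t_eq, hφ₂, happ_sub]
  · rw [hj.decomp χ₁, hj.decomp χ₂, hΦ', hΦ']
    obtain ⟨c, hc, e⟩ := h.bracket_eq (C.proj χ₁) (C.coord j χ₁) (C.proj χ₂) (C.coord j χ₂)
    obtain ⟨c', hc', e'⟩ := h'.bracket_eq (happ φ (C.proj χ₁)) (conj φ' ν (C.coord j χ₁))
      (happ φ (C.proj χ₂)) (conj φ' ν (C.coord j χ₂))
    have hcc : c' = conj φ' ν c := ext_of_sec fun Z => by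
      rw [happ_conj, hc, ← k.formPart_eq hφ₂, hφ₁, hc']
    refine e'.trans (Eq.trans ?_ (congrArg (happ Φ) e).symm)
    refine Eq.trans ?_ (hΦ' _ _).symm
    rw [hcc, happ_conj, hφ₂, k.bracket_eq, k.t_eq, ← happ_sub]
    rfl

/-- Adjointness of `π^*` leaves no freedom: since `Φ` preserves products and covers `φ`, its effect
on forms is conjugation. -/
theorem _root_.Lie2Courant.IsCourantIso.happ_star {φ : HomSec EM FE E FE' E'} {ν : HomSec EM FV V FV' V'}
    {Φ : HomSec EM FW W FW' W'} (k : IsCourantIso C C' φ ν Φ)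
    {φ' : HomSec EM FE' E' FE E} (hφ' : ∀ X, happ φ' (happ φ X) = X) (a : HomSec EM FE E FV V) :
    happ Φ (C.star a) = C'.star (conj φ' ν a) := by
  obtain ⟨Ψ, hΨ, -⟩ := k.Φ_iso.exists_inverse_happ
  refine C'.eq_of_prod_eq fun χ => ?_
  have e₁ : C'.prod (happ Φ (C.star a)) (happ Φ (happ Ψ χ))
      = happ ν (C.prod (C.star a) (happ Ψ χ)) :=
    ContMDiffSection.ext fun x => k.pairing_eq x _ _
  have e₂ : C'.proj (happ Φ (happ Ψ χ)) = happ φ (C.proj (happ Ψ χ)) :=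
    ContMDiffSection.ext fun x => k.pi_eq x _
  rw [hΨ] at e₁ e₂
  rw [e₁, C.prod_star_left, C'.prod_star_left, e₂, happ_conj, hφ']

/-- A splitting that is carried to `j'` by an isomorphism induces an isomorphic Lie 2-algebroid. -/
theorem _root_.Lie2Courant.IsCourantIso.isStrictMorphism {φ : HomSec EM FE E FE' E'} {ν : HomSec EM FV V FV' V'}
    {Φ : HomSec EM FW W FW' W'} (k : IsCourantIso C C' φ ν Φ) (hV : 0 < finrank ℝ FV)
    {L : Lie2Data EM FE E FV V} (h : C.IsInduced j L)
    {L' : Lie2Data EM FE' E' FV' V'} (h' : C'.IsInduced j' L')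
    (e : ∀ (x : M) (u : E x), Φ x (j x u) = j' x (φ x u)) : IsStrictMorphism L L' φ ν := by
  obtain ⟨φ', hφ₁, hφ₂⟩ := k.φ_iso.exists_inverse_happ
  obtain ⟨ν', -, hν₂⟩ := k.ν_iso.exists_inverse_happ
  have es : ∀ X, happ j' (happ φ X) = happ Φ (happ j X) := fun X =>
    ContMDiffSection.ext fun x => (e x _).symm
  refine ⟨fun x u => ?_, fun v => ?_, fun X Y => ?_, fun X v => ?_, fun X Y Z => ?_⟩
  · rw [← h'.anchor_eq, ← e, k.anchor_eq, h.anchor_eq]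
  · have e₁ : happ φ' (happ L'.t (happ ν v)) = happ L.t v :=
      eq_of_forall_happ (FV := FV) (V := V) hV fun a => by
        have e₂ := k.conn_eq (C.star a) v
        rw [k.happ_star hφ₂, h'.t_eq, h.t_eq, happ_conj, happ_neg, neg_inj] at e₂
        rw [← hν₂ (happ a _), e₂, hν₂]
    rw [← e₁, hφ₁]
  · rw [← h'.bracket_eq, es, es, k.bracket_eq, ← h.bracket_eq]
    exact ContMDiffSection.ext fun x => k.pi_eq x _
  · rw [← h'.conn_eq, es, k.conn_eq, h.conn_eq]
  · rw [← h'.H_eq, es, es, es, k.bracket_eq, ← h.H_eq]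
    exact ContMDiffSection.ext fun x => k.pairing_eq x _ _

/-- A two-form is the same as a change of splitting. Given `B`, the shifted splitting induces a Lie
2-algebroid strictly isomorphic to `L'`; given `Φ`, the splitting `j'` is pulled back and `B` is its
difference from `j`. -/
theorem HasStandardForm.exists_isLie2Iso_iff {L : Lie2Algebroid EM FE E FV V}
    (h : C.HasStandardForm j L) (hj : C.IsIsotropicSplitting j) (hV : 1 < finrank ℝ FV)
    {L' : Lie2Algebroid EM FE' E' FV' V'} (h' : C'.HasStandardForm j' L')
    (hj' : C'.IsIsotropicSplitting j') (φ : HomSec EM FE E FE' E') (ν : HomSec EM FV V FV' V') :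
    (∃ B, IsLie2Iso L L' φ ν B) ↔ ∃ Φ, IsCourantIso C C' φ ν Φ := by
  constructor
  · rintro ⟨B, k⟩
    have hj₁ := hj.shift k.twoForm
    obtain ⟨L₁, h₁, -⟩ := hj₁.existsUnique_hasStandardForm hV
    have hL := (h.shift_iff hj hV k.twoForm L₁).mp h₁
    exact h₁.exists_isCourantIso hj₁ h' hj' k.φ_iso k.ν_iso
      ((hL.isLie2Iso_iff k.twoForm k.φ_iso k.ν_iso).mp k)
  · rintro ⟨Φ, k⟩
    obtain ⟨Ψ, hΨ, -⟩ := k.Φ_iso.exists_inverse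
    -- The pullback of `j'` along `Φ` and `φ`; it is isotropic because `Φ` preserves products and
    -- `ν` is injective.
    let j₁ : HomSec EM FE E FW W := HomSec.ofSmooth (fun x => (Ψ x).comp ((j' x).comp (φ x)))
      fun X => (happ Ψ (happ j' (happ φ X))).contMDiff
    have e : ∀ (x : M) (u : E x), Φ x (j₁ x u) = j' x (φ x u) := fun x u => hΨ x _
    have hj₁ : C.IsIsotropicSplitting j₁ := by
      refine ⟨fun x u => (k.φ_iso x).1 ?_, fun x u w => (k.ν_iso x).1 ?_⟩
      · rw [← k.pi_eq, e, hj'.1]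
      · rw [← k.pairing_eq, e, e, hj'.2, map_zero]
    obtain ⟨B, hB, hs⟩ := hj.exists_eq_shift hj₁
    obtain ⟨L₁, h₁, -⟩ := hj₁.existsUnique_hasStandardForm hV
    have hL := (h.shift_iff hj hV hB L₁).mp (hs ▸ h₁)
    exact ⟨B, (hL.isLie2Iso_iff hB k.φ_iso k.ν_iso).mpr
      (k.isStrictMorphism (zero_lt_one.trans hV) (h₁.isInduced hj₁) (h'.isInduced hj') e)⟩

theorem IsStandardModel.isIsotropicSplitting
    {C : VExactCourant EM FE E FV V (FE × (FE →L[ℝ] FV)) (E ×ᵇ fun x : M => E x →L[ℝ] V x)}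
    {j : HomSec EM FE E (FE × (FE →L[ℝ] FV)) (E ×ᵇ fun x : M => E x →L[ℝ] V x)}
    {L : Lie2Algebroid EM FE E FV V} (h : C.IsStandardModel j L) : C.IsIsotropicSplitting j := by
  refine ⟨fun x u => ?_, fun x u w => ?_⟩
  · rw [h.j_eq]
    exact h.pi_eq x u 0
  · have e := h.standardForm.pairing_eq x u w 0 0
    rw [map_zero, add_zero, add_zero] at e
    rw [e]
    exact add_zero 0

end VExactCourant

variable (EM FE E) in
/-- The identity of a vector bundle. -/
def idHom : HomSec EM FE E FE E :=
  HomSec.ofSmooth (fun x => ContinuousLinearMap.id ℝ (E x)) fun X => X.contMDiff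

theorem happ_idHom (X : Sec EM FE E) : happ (idHom EM FE E) X = X := rfl

theorem Lie2Algebroid.isLie2Iso_id (L : Lie2Algebroid EM FE E FV V) :
    IsLie2Iso L L (idHom EM FE E) (idHom EM FV V) 0 := by
  have h0 : ∀ X Y : Sec EM FE E, happ₂ (0 : BilinSec EM FE E FV V) X Y = 0 := fun _ _ => rfl
  refine ⟨fun x => Function.bijective_id, fun x => Function.bijective_id, fun _ _ => rfl,
    fun _ _ => rfl, fun _ _ => rfl, fun X Y => ?_, fun X v => ?_, fun X Y Z => ?_⟩
  · simp only [happ_idHom, h0, happ_zero, add_zero]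
  · simp only [happ_idHom, h0, add_zero]
  · simp only [happ_idHom, h0, Lie2Data.extD₂, cubicTerm, map_zero, add_zero, sub_zero]

end Isomorphisms

end Lie2Courant

end

/-! ### The correspondence -/

theorem theorem1p6
    {EM : Type*} [NormedAddCommGroup EM] [NormedSpace ℝ EM] [FiniteDimensional ℝ EM]
    {M : Type*} [TopologicalSpace M] [ChartedSpace EM M] [IsManifold 𝓘(ℝ, EM) ∞ M]
    [T2Space M] [SigmaCompactSpace M]
    {FE : Type*} [NormedAddCommGroup FE] [NormedSpace ℝ FE] [FiniteDimensional ℝ FE]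
    {E : M → Type*} [TopologicalSpace (TotalSpace FE E)] [∀ x, TopologicalSpace (E x)]
    [∀ x, AddCommGroup (E x)] [∀ x, Module ℝ (E x)]
    [∀ x, IsTopologicalAddGroup (E x)] [∀ x, ContinuousSMul ℝ (E x)]
    [FiberBundle FE E] [VectorBundle ℝ FE E] [ContMDiffVectorBundle ∞ FE E 𝓘(ℝ, EM)]
    {FV : Type*} [NormedAddCommGroup FV] [NormedSpace ℝ FV] [FiniteDimensional ℝ FV]
    {V : M → Type*} [TopologicalSpace (TotalSpace FV V)] [∀ x, TopologicalSpace (V x)]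
    [∀ x, AddCommGroup (V x)] [∀ x, Module ℝ (V x)]
    [∀ x, IsTopologicalAddGroup (V x)] [∀ x, ContinuousSMul ℝ (V x)]
    [FiberBundle FV V] [VectorBundle ℝ FV V] [ContMDiffVectorBundle ∞ FV V 𝓘(ℝ, EM)]
    {FE' : Type*} [NormedAddCommGroup FE'] [NormedSpace ℝ FE'] [FiniteDimensional ℝ FE']
    {E' : M → Type*} [TopologicalSpace (TotalSpace FE' E')] [∀ x, TopologicalSpace (E' x)]
    [∀ x, AddCommGroup (E' x)] [∀ x, Module ℝ (E' x)]
    [∀ x, IsTopologicalAddGroup (E' x)] [∀ x, ContinuousSMul ℝ (E' x)]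
    [FiberBundle FE' E'] [VectorBundle ℝ FE' E'] [ContMDiffVectorBundle ∞ FE' E' 𝓘(ℝ, EM)]
    {FV' : Type*} [NormedAddCommGroup FV'] [NormedSpace ℝ FV'] [FiniteDimensional ℝ FV']
    {V' : M → Type*} [TopologicalSpace (TotalSpace FV' V')] [∀ x, TopologicalSpace (V' x)]
    [∀ x, AddCommGroup (V' x)] [∀ x, Module ℝ (V' x)]
    [∀ x, IsTopologicalAddGroup (V' x)] [∀ x, ContinuousSMul ℝ (V' x)]
    [FiberBundle FV' V'] [VectorBundle ℝ FV' V'] [ContMDiffVectorBundle ∞ FV' V' 𝓘(ℝ, EM)]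
    {FW : Type*} [NormedAddCommGroup FW] [NormedSpace ℝ FW] [FiniteDimensional ℝ FW]
    {W : M → Type*} [TopologicalSpace (TotalSpace FW W)] [∀ x, TopologicalSpace (W x)]
    [∀ x, AddCommGroup (W x)] [∀ x, Module ℝ (W x)]
    [∀ x, IsTopologicalAddGroup (W x)] [∀ x, ContinuousSMul ℝ (W x)]
    [FiberBundle FW W] [VectorBundle ℝ FW W] [ContMDiffVectorBundle ∞ FW W 𝓘(ℝ, EM)] :
    -- every Lie 2-algebroid gives a `V`-exact Courant algebroid structure on `E ⊕ Hom(E, V)`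
    (0 < finrank ℝ FE → 0 < finrank ℝ FV → ∀ L : Lie2Courant.Lie2Algebroid EM FE E FV V,
      ∃! p : Lie2Courant.VExactCourant EM FE E FV V
            (FE × (FE →L[ℝ] FV)) (E ×ᵇ fun x : M => E x →L[ℝ] V x) ×
          Lie2Courant.HomSec EM FE E
            (FE × (FE →L[ℝ] FV)) (E ×ᵇ fun x : M => E x →L[ℝ] V x),
        Lie2Courant.VExactCourant.IsStandardModel p.1 p.2 L) ∧
    (1 < finrank ℝ FV →
      -- isotropic splittings exist, and each one induces a unique Lie 2-algebroid
      (∀ C : Lie2Courant.VExactCourant EM FE E FV V FW W,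
        (∃ j, C.IsIsotropicSplitting j) ∧
        ∀ j, C.IsIsotropicSplitting j →
          ∃! L : Lie2Courant.Lie2Algebroid EM FE E FV V, C.HasStandardForm j L) ∧
      -- the effect of a change of splitting
      (∀ (C : Lie2Courant.VExactCourant EM FE E FV V FW W) (j : Lie2Courant.HomSec EM FE E FW W)
          (L : Lie2Courant.Lie2Algebroid EM FE E FV V),
        C.IsIsotropicSplitting j → C.HasStandardForm j L →
        (∀ j', C.IsIsotropicSplitting j' ↔
          ∃! B : Lie2Courant.BilinSec EM FE E FV V, Lie2Courant.IsTwoForm B ∧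
            ∀ (x : M) (u : E x), j' x u = j x u - C.piStar x (B x u)) ∧
        ∀ B : Lie2Courant.BilinSec EM FE E FV V, Lie2Courant.IsTwoForm B →
          ∃! j', (∀ (x : M) (u : E x), j' x u = j x u - C.piStar x (B x u)) ∧
            ∀ L' : Lie2Courant.Lie2Algebroid EM FE E FV V,
              C.HasStandardForm j' L' ↔ Lie2Courant.IsChangeOfSplitting L B L') ∧
      -- the correspondence is well defined and injective on isomorphism classes
      (∀ (L : Lie2Courant.Lie2Algebroid EM FE E FV V)
          (L' : Lie2Courant.Lie2Algebroid EM FE' E' FV' V') (C : _) (j : _) (C' : _) (j' : _),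
        Lie2Courant.VExactCourant.IsStandardModel C j L →
        Lie2Courant.VExactCourant.IsStandardModel C' j' L' →
        ∀ (φ : Lie2Courant.HomSec EM FE E FE' E') (ν : Lie2Courant.HomSec EM FV V FV' V'),
          (∃ B, Lie2Courant.IsLie2Iso L L' φ ν B) ↔
            ∃ Φ, Lie2Courant.IsCourantIso C C' φ ν Φ) ∧
      -- it is surjective on isomorphism classes
      ∀ C' : Lie2Courant.VExactCourant EM FE E FV V FW W,
        ∃ (L : Lie2Courant.Lie2Algebroid EM FE E FV V) (C : _) (j : _),
          Lie2Courant.VExactCourant.IsStandardModel C j L ∧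
          ∃ φ ν Φ, Lie2Courant.IsCourantIso C C' φ ν Φ ∧
            (∀ (x : M) (u : E x), φ x u = u) ∧ ∀ (x : M) (v : V x), ν x v = v) := by
  refine ⟨fun hE hV L => ?_, fun hV => ⟨fun C => ⟨C.exists_isotropicSplitting, fun j hj =>
    hj.existsUnique_hasStandardForm hV⟩, fun C j L hj h => ⟨hj.iff_existsUnique, fun B hB => ?_⟩,
    fun L L' C j C' j' h h' φ ν => h.standardForm.exists_isLie2Iso_iff h.isIsotropicSplitting hV
      h'.standardForm h'.isIsotropicSplitting φ ν, fun C' => ?_⟩⟩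
  · have h := L.model_isStandardModel (Lie2Courant.exists_ne_zero_fiber hE) hV
    refine ⟨(_, _), h, fun p hp => ?_⟩
    obtain ⟨e₁, e₂⟩ := hp.unique h
    exact Prod.ext e₁ e₂
  · exact ⟨C.shift j B, ⟨fun _ _ => rfl, h.shift_iff hj hV hB⟩,
      fun j' h' => Lie2Courant.VExactCourant.eq_shift_iff.mp h'.1⟩
  · obtain ⟨j', hj'⟩ := C'.exists_isotropicSplitting
    obtain ⟨L, h', -⟩ := hj'.existsUnique_hasStandardForm hV
    have hV' := zero_lt_one.trans hV
    have h := L.model_isStandardModel (C'.exists_ne_zero_base hV') hV'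
    obtain ⟨Φ, k⟩ := (h.standardForm.exists_isLie2Iso_iff h.isIsotropicSplitting hV h' hj' _ _).mp
      ⟨0, L.isLie2Iso_id⟩
    exact ⟨L, _, _, h, _, _, Φ, k, fun _ _ => rfl, fun _ _ => rfl⟩
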